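/- **Model.** Let $K\ge 1$ and $D,p,n\ge 0$ be integers and let $T_{\max}$ be the perfect $K$-ary tree of depth $D$, with set of nodes $\mathcal S_{\max}$, inner nodes $\mathcal I_{\max}$, leaves $\mathcal L_{\max}$ and root $s_\lambda$. Write $\mathrm{Ch}(s)$ for the children of $s$, $s_{\mathrm{pa}}$ for its parent, and $s\preceq s'$ if $s$ is an ancestor of $s'$ or equal to it. A path $z\in\{0,\dots,K-1\}^D$ leads from the root to a leaf $s(z)\in\mathcal L_{\max}$. Let $\mathcal T$ be the set of full subtrees $T$ of $T_{\max}$ with root $s_\lambda$ (every inner node of $T$ has all its $K$ children in $T$), and let $\mathcal I(T),\mathcal L(T)$ be the inner nodes and leaves of $T$. Let $\mathcal W(\nu,W)$ be the Wishart distribution on positive definite $p\times p$ matrices, with density proportional to $|\Lambda|^{(\nu-p-1)/2}e^{-\mathrm{tr}(W^{-1}\Lambda)/2}$. Given hyperparameters $\alpha_s\in\mathbb R_{>0}^K$, $a_s,b_s>0$ ($s\in\mathcal I_{\max}$), $\nu_s>p-1$, $W_s\succ0$ ($s\in\mathcal S_{\max}$), $u>p-1$, $V\succ0$, $m_{s_\lambda}\in\mathbb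 R^p$, consider the joint law of data $x=(x_i)_{i\le n}$ in $\mathbb R^p$ and latent variables $z=(z_i),T=(T_i),\pi=(\pi_s),g=(g_s),\mu=(\mu_s),\Lambda=(\Lambda_s),L$ with density $$\prod_{i}\Big[p(z_i|\pi)\,p(T_i|g)\prod_{s\in\mathcal L(T_i)}\mathcal N(x_i|\mu_s,\Lambda_s^{-1})^{I\{s\preceq s(z_i)\}}\Big]\prod_{s\in\mathcal I_{\max}}\mathrm{Dir}(\pi_s|\alpha_s)\,\mathrm{Beta}(g_s|a_s,b_s)\prod_{s\in\mathcal S_{\max}}\mathcal W(\Lambda_s|\nu_s,W_s)\,\mathcal N(\mu_s|\mu_{s_{\mathrm{pa}}},L^{-1})\;\mathcal W(L|u,V),$$ where $\mu_{(s_\lambda)_{\mathrm{pa}}}:=m_{s_\lambda}$, $p(z_i|\pi)=\prod_{s\in\mathcal I_{\max}}\prod_{c\in\mathrm{Ch}(s)}\pi_{s,c}^{I\{c\preceq s(z_i)\}}$ and $p(T_i|g)=\prod_{s\in\mathcal I(T_i)}g_s\prod_{s\in\mathcal L(T_i)}(1-g_s)$ with $g_s:=0$ for $s\in\mathcal L_{\max}$.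 **Variational distributions.** Let $q=q(g)q(L)\prod_iq(z_i)\prod_iq(T_i)\prod_{s\in\mathcal I_{\max}}q(\pi_s)\prod_{s\in\mathcal S_{\max}}q(\mu_s)\prod_{s\in\mathcal S_{\max}}q(\Lambda_s)$ be a mean-field distribution whose factors are arbitrary probability measures, with $\mathrm{KL}(q\,\|\,p(\cdot|x))<\infty$. A factor is called *optimal given the others* if it minimizes $\mathrm{KL}(q\,\|\,p(\cdot|x))$ among all probability measures in its place, the other factors being fixed. Put $\omega_{i,s}:=q(s\in\mathcal L(T_i))\,q(s\preceq s(z_i))$, $N_s:=\sum_iq(s\preceq s(z_i))$, $\tilde N_s:=\sum_i\omega_{i,s}$, $\bar x_s:=\tilde N_s^{-1}\sum_i\omega_{i,s}x_i$, $S_s(m):=\tilde N_s^{-1}\sum_i\omega_{i,s}(x_i-m)(x_i-m)^\top$ (products of $\tilde N_s$ with any of $\bar x_s$, $S_s$ and expectations being read as $0$ when $\tilde N_s=0$). Let $\hat m_s$ and $\hat C_s$ be the mean and covariance matrix of $q(\mu_s)$, with $\hat m_{(s_\lambda)_{\mathrm{pa}}}:=m_{s_\lambda}$. **(A) Updates.**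 For given other factors, the optimal factor is unique and is as follows. 1. $q(\pi_s)=\mathrm{Dir}(\hat\alpha_s)$ with $\hat\alpha_{s,c}=\alpha_{s,c}+N_c$ for $c\in\mathrm{Ch}(s)$. 2. $q(\mu_s)=\mathcal N(m,\hat L_s^{-1})$ with $\hat L_s=\tilde N_s\mathbb E_q[\Lambda_s]+(K+1)\mathbb E_q[L]$ and $m=\hat L_s^{-1}\{\tilde N_s\mathbb E_q[\Lambda_s]\bar x_s+\mathbb E_q[L](\hat m_{s_{\mathrm{pa}}}+\sum_{c\in\mathrm{Ch}(s)}\hat m_c)\}$ if $s\in\mathcal I_{\max}$; for $s\in\mathcal L_{\max}$ the factor $K+1$ is replaced by $1$ and the sum over children is absent. 3. $q(\Lambda_s)=\mathcal W(\hat\nu_s,\hat W_s)$ with $\hat\nu_s=\nu_s+\tilde N_s$ and $\hat W_s^{-1}=W_s^{-1}+\tilde N_s(S_s(\hat m_s)+\hat C_s)$. 4. $q(L)=\mathcal W(\hat u,\hat V)$ with $\hat u=u+|\mathcal S_{\max}|$ and $\hat V^{-1}=V^{-1}+\hat C_{s_\lambda}+(\hat m_{s_\lambda}-m_{s_\lambda})(\hat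 m_{s_\lambda}-m_{s_\lambda})^\top+\sum_{s\ne s_\lambda}\big(\hat C_s+\hat C_{s_{\mathrm{pa}}}+(\hat m_s-\hat m_{s_{\mathrm{pa}}})(\hat m_s-\hat m_{s_{\mathrm{pa}}})^\top\big)$. 5. $q(g)=\prod_{s\in\mathcal I_{\max}}\mathrm{Beta}(\hat a_s,\hat b_s)$ with $\hat a_s=a_s+\sum_iq(s\in\mathcal I(T_i))$ and $\hat b_s=b_s+\sum_iq(s\in\mathcal L(T_i))$. 6. If $\ln\pi_{s,c}$ is $q(\pi_s)$-integrable for all $s\in\mathcal I_{\max}$, $c\in\mathrm{Ch}(s)$, and $\ln\mathcal N(x_i|\mu_s,\Lambda_s^{-1})$ is $q(\mu_s)q(\Lambda_s)$-integrable for all $s$ with $q(s\in\mathcal L(T_i))\neq0$, then $q(z_i)=\prod_{s\in\mathcal I_{\max}}\prod_{c\in\mathrm{Ch}(s)}\hat\pi_{i,s,c}^{I\{c\preceq s(z_i)\}}$ with $\hat\pi_{i,s,c}=\xi_{i,s,c}/\sum_{c'\in\mathrm{Ch}(s)}\xi_{i,s,c'}$, where recursively $\ln\xi_{i,s,c}=\mathbb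 E_q[\ln\pi_{s,c}]+\ln\zeta_{i,c}+\ln\sum_{c'\in\mathrm{Ch}(c)}\xi_{i,c,c'}$, the last term being absent for $c\in\mathcal L_{\max}$, and $\ln\zeta_{i,s}=q(s\in\mathcal L(T_i))\,\mathbb E_q[\ln\mathcal N(x_i|\mu_s,\Lambda_s^{-1})]$. **(B) Form of the optimal factors.** If each of the factors $q(\pi_s),q(\mu_s),q(\Lambda_s),q(L),q(g),q(z_i)$ is optimal given the others (in particular if $q$ minimizes the divergence among all mean-field distributions), then there are $\hat\alpha_s\in\mathbb R_{>0}^K$, $\hat m_s\in\mathbb R^p$, $\hat L_s\succ0$, $\hat\nu_s>p-1$, $\hat W_s\succ0$, $\hat u>p-1$, $\hat V\succ0$, $\hat a_s,\hat b_s>0$, $\hat\pi_{i,s,c}>0$ with $$q(\pi_s)=\mathrm{Dir}(\hat\alpha_s),\quad q(\mu_s)=\mathcal N(\hat m_s,\hat L_s^{-1}),\quad q(\Lambda_s)=\mathcal W(\hat\nu_s,\hat W_s),\quad q(L)=\mathcal W(\hat u,\hat V),$$ $$q(g)=\prod_{s\in\mathcal I_{\max}}\mathrm{Beta}(\hat a_s,\hat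 b_s),\qquad q(z_i)=\prod_{s\in\mathcal I_{\max}}\prod_{c\in\mathrm{Ch}(s)}\hat\pi_{i,s,c}^{I\{c\preceq s(z_i)\}},$$ and these parameters satisfy all the formulas in 1–6 with $m=\hat m_s$ and $\hat C_s=\hat L_s^{-1}$. -/

import Mathlib

open MeasureTheory ProbabilityTheory
open scoped ENNReal Matrix

namespace TreeMixture

noncomputable section

/-! ### The `K`-ary perfect tree of depth `D` -/

/-- Nodes of the perfect tree: words of length at most `D`; the root is the empty word, and the
`k`-th child of `s` is `s ++ [k]`. -/
abbrev Node (K D : ℕ) : Type := {l : List (Fin K) // l.length ≤ D}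

/-- Inner nodes of the perfect tree: words of length less than `D`. -/
abbrev Inner (K D : ℕ) : Type := {l : List (Fin K) // l.length < D}

instance instFintypeNode (K D : ℕ) : Fintype (Node K D) :=
  (List.finite_length_le (Fin K) D).fintype

instance instFintypeInner (K D : ℕ) : Fintype (Inner K D) :=
  (List.finite_length_lt (Fin K) D).fintype

/-- Paths `z ∈ {0, …, K-1}^D` from the root to a leaf of the perfect tree. -/
abbrev TreePath (K D : ℕ) : Type := Fin D → Fin K

variable {K D p n : ℕ}

def root : Node K D := ⟨[], Nat.zero_le D⟩

def Inner.toNode (s : Inner K D) : Node K D := ⟨s.1, s.2.le⟩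

def child (s : Inner K D) (k : Fin K) : Node K D :=
  ⟨s.1 ++ [k], by simpa using Nat.succ_le_of_lt s.2⟩

/-- The parent node (only meaningful for `s ≠ root`). -/
def parent (s : Node K D) : Node K D :=
  ⟨s.1.dropLast, by have := s.2; simp only [List.length_dropLast]; omega⟩

/-- `s ⪯ s(z)`: the node `s` lies on the path `z`, whose end point is the word `z₁ … z_D`. -/
def OnPath (s : Node K D) (z : TreePath K D) : Prop := s.1 <+: List.ofFn z

/-- Full subtrees of the perfect tree that contain its root: sets of nodes containing the root,
closed under parents, in which a node with one child has all `K` children. -/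
@[ext]
structure Subtree (K D : ℕ) where
  nodes : Set (Node K D)
  root_mem : root ∈ nodes
  parent_mem : ∀ (s : Inner K D) (k : Fin K), child s k ∈ nodes → s.toNode ∈ nodes
  full : ∀ (s : Inner K D) (k k' : Fin K), child s k ∈ nodes → child s k' ∈ nodes

/-- Inner nodes of a subtree. -/
def Subtree.IsInner (T : Subtree K D) (s : Node K D) : Prop :=
  s ∈ T.nodes ∧ ∃ (h : s.1.length < D) (k : Fin K), child ⟨s.1, h⟩ k ∈ T.nodes

/-- Leaf nodes of a subtree. -/
def Subtree.IsLeaf (T : Subtree K D) (s : Node K D) : Prop :=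
  s ∈ T.nodes ∧ ¬ T.IsInner s

instance instFiniteSubtree (K D : ℕ) : Finite (Subtree K D) :=
  Finite.of_injective (fun T : Subtree K D => T.nodes) fun _ _ h => Subtree.ext h

instance instMeasurableSpaceSubtree (K D : ℕ) : MeasurableSpace (Subtree K D) := ⊤

/-! ### Vectors, matrices and the distributions of the model -/

abbrev Vec (p : ℕ) : Type := Fin p → ℝ

abbrev Mat (p : ℕ) : Type := Matrix (Fin p) (Fin p) ℝ

/-- The Borel σ-algebra on matrices, i.e. the product σ-algebra of the entries. -/
instance instMeasurableSpaceMat (p : ℕ) : MeasurableSpace (Mat p) :=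
  inferInstanceAs (MeasurableSpace (Fin p → Fin p → ℝ))

/-- A measure divided by its total mass. -/
def normalized {Ω : Type*} [MeasurableSpace Ω] (m : Measure Ω) : Measure Ω :=
  (m Set.univ)⁻¹ • m

/-- Density of the Gaussian distribution `N(m, P⁻¹)` with mean `m` and precision matrix `P`. -/
def gaussianDensity (m : Vec p) (P : Mat p) (x : Vec p) : ℝ :=
  Real.sqrt (P.det / (2 * Real.pi) ^ p) * Real.exp (-(1 / 2) * ((x - m) ⬝ᵥ (P *ᵥ (x - m))))

/-- The Gaussian distribution `N(m, P⁻¹)`. -/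
def gaussianMeasure (m : Vec p) (P : Mat p) : Measure (Vec p) :=
  volume.withDensity fun x => ENNReal.ofReal (gaussianDensity m P x)

/-- The point `(1 - ∑ y, y)` of the hyperplane `∑ v = 1` whose coordinates of nonzero index
are `y`. -/
def simplexPoint [NeZero K] (y : {k : Fin K // k ≠ 0} → ℝ) : Fin K → ℝ :=
  fun k => if h : k = 0 then 1 - ∑ j, y j else y ⟨k, h⟩

/-- The Dirichlet distribution: the probability measure on the open simplex whose density with
respect to Lebesgue measure in `K - 1` of the coordinates is proportional to
`∏ k, v k ^ (α k - 1)`. -/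
def dirichletMeasure [NeZero K] (α : Fin K → ℝ) : Measure (Fin K → ℝ) :=
  normalized ((Measure.map simplexPoint volume).withDensity
    (Set.indicator {v | ∀ k, 0 < v k} fun v => ENNReal.ofReal (∏ k, v k ^ (α k - 1))))

/-- The symmetric matrix with the given entries on and above the diagonal. -/
def symMatrix (y : {ij : Fin p × Fin p // ij.1 ≤ ij.2} → ℝ) : Mat p :=
  Matrix.of fun i j => y ⟨(min i j, max i j), min_le_max⟩

/-- The Wishart distribution with `ν` degrees of freedom and scale matrix `W`: the probability
measure on the positive definite matrices whose density with respect to Lebesgue measure in the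
entries on and above the diagonal is proportional to
`det Λ ^ ((ν - p - 1) / 2) * exp (- tr (W⁻¹ Λ) / 2)`. -/
def wishartMeasure (ν : ℝ) (W : Mat p) : Measure (Mat p) :=
  normalized ((Measure.map symMatrix volume).withDensity
    (Set.indicator {Λ | Λ.PosDef} fun Λ => ENNReal.ofReal
      (Λ.det ^ ((ν - p - 1) / 2) * Real.exp (-(1 / 2) * (W⁻¹ * Λ).trace))))

/-! ### The model -/

/-- The hyperparameters of the prior, with the constraints imposed on them. -/
structure Hyper (K D p : ℕ) where
  α : Inner K D → Fin K → ℝ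
  α_pos : ∀ s k, 0 < α s k
  a : Inner K D → ℝ
  a_pos : ∀ s, 0 < a s
  b : Inner K D → ℝ
  b_pos : ∀ s, 0 < b s
  ν : Node K D → ℝ
  ν_gt : ∀ s, (p : ℝ) - 1 < ν s
  W : Node K D → Mat p
  W_posDef : ∀ s, (W s).PosDef
  u : ℝ
  u_gt : (p : ℝ) - 1 < u
  V : Mat p
  V_posDef : V.PosDef
  m₀ : Vec p

/-- The value at the parent of `s` of a family of vectors indexed by nodes, where the missing
parent of the root is given the vector `m₀`. -/
def parentVec (m₀ : Vec p) (m : Node K D → Vec p) (s : Node K D) : Vec p :=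
  if s = root then m₀ else m (parent s)

/-- The edge spreading probability of a node, equal to `0` at the leaves of the perfect tree. -/
def edgeProb (g : Inner K D → ℝ) (s : Node K D) : ℝ :=
  if h : s.1.length < D then g ⟨s.1, h⟩ else 0

/-- A path distribution `∏ s, ∏ k, π s k ^ I{child s k ⪯ s(z)}`. -/
def pathProb (π : Inner K D → Fin K → ℝ) (z : TreePath K D) : ℝ :=
  open Classical in ∏ s, ∏ k, π s k ^ (if OnPath (child s k) z then 1 else 0 : ℕ)

/-- The subtree distribution `p(T | g)`. -/
def treeProb (g : Inner K D → ℝ) (T : Subtree K D) : ℝ :=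
  open Classical in
  (∏ s with T.IsInner s, edgeProb g s) * ∏ s with T.IsLeaf s, (1 - edgeProb g s)

/-- The density `p(μ | L)`. -/
def meanDensity (m₀ : Vec p) (L : Mat p) (μ : Node K D → Vec p) : ℝ :=
  ∏ s, gaussianDensity (parentVec m₀ μ s) L (μ s)

/-- The density `p(xᵢ | zᵢ, Tᵢ, μ, Λ)` of one data point. -/
def dataDensity (z : TreePath K D) (T : Subtree K D) (μ : Node K D → Vec p) (Λ : Node K D → Mat p)
    (x : Vec p) : ℝ :=
  open Classical in
  ∏ s with T.IsLeaf s, gaussianDensity (μ s) (Λ s) x ^ (if OnPath s z then 1 else 0 : ℕ)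

/-- The space of all latent variables `(z, T, π, g, μ, Λ, L)`. -/
abbrev Latent (K D p n : ℕ) : Type :=
  (Fin n → TreePath K D) × (Fin n → Subtree K D) × (Inner K D → Fin K → ℝ) × (Inner K D → ℝ) ×
    (Node K D → Vec p) × (Node K D → Mat p) × Mat p

/-- The measure `p(x, dz, dT, dπ, dg, dμ, dΛ, dL)` on the latent variables, for observed data `x`:
the priors of `π`, `g`, `Λ`, `L` times counting measure in `z` and `T` and Lebesgue measure in `μ`,
with density `p(z | π) p(T | g) p(μ | L) p(x | z, T, μ, Λ)`. -/
def jointMeasure [NeZero K] (M : Hyper K D p) (x : Fin n → Vec p) : Measure (Latent K D p n) :=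
  ((Measure.pi fun _ => Measure.count).prod <|
    (Measure.pi fun _ => Measure.count).prod <|
    (Measure.pi fun s => dirichletMeasure (M.α s)).prod <|
    (Measure.pi fun s => betaMeasure (M.a s) (M.b s)).prod <|
    (Measure.pi fun _ => volume).prod <|
    (Measure.pi fun s => wishartMeasure (M.ν s) (M.W s)).prod <|
    wishartMeasure M.u M.V).withDensity
  fun (z, T, π, g, μ, Λ, L) => ENNReal.ofReal
    ((∏ i, pathProb π (z i)) * (∏ i, treeProb g (T i)) * meanDensity M.m₀ L μ *
      ∏ i, dataDensity (z i) (T i) μ Λ (x i))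

/-- The posterior distribution `p(z, T, π, g, μ, Λ, L | x)`. -/
def posterior [NeZero K] (M : Hyper K D p) (x : Fin n → Vec p) : Measure (Latent K D p n) :=
  normalized (jointMeasure M x)

/-! ### Variational distributions -/

/-- A variational distribution satisfying the mean-field factorization, given by its factors
`q(zᵢ)`, `q(Tᵢ)`, `q(π_s)`, `q(g)`, `q(μ_s)`, `q(Λ_s)`, `q(L)`, which are arbitrary probability
measures. -/
structure MeanField (K D p n : ℕ) where
  z : Fin n → ProbabilityMeasure (TreePath K D)
  T : Fin n → ProbabilityMeasure (Subtree K D)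
  π : Inner K D → ProbabilityMeasure (Fin K → ℝ)
  g : ProbabilityMeasure (Inner K D → ℝ)
  μ : Node K D → ProbabilityMeasure (Vec p)
  Λ : Node K D → ProbabilityMeasure (Mat p)
  L : ProbabilityMeasure (Mat p)

/-- The product distribution with the given factors. -/
def MeanField.toMeasure (q : MeanField K D p n) : Measure (Latent K D p n) :=
  (Measure.pi fun i => (q.z i : Measure (TreePath K D))).prod <|
    (Measure.pi fun i => (q.T i : Measure (Subtree K D))).prod <|
    (Measure.pi fun s => (q.π s : Measure (Fin K → ℝ))).prod <|
    (q.g : Measure (Inner K D → ℝ)).prod <|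
    (Measure.pi fun s => (q.μ s : Measure (Vec p))).prod <|
    (Measure.pi fun s => (q.Λ s : Measure (Mat p))).prod <|
    (q.L : Measure (Mat p))

/-- The Kullback–Leibler divergence from a variational distribution to the posterior. -/
def KL [NeZero K] (M : Hyper K D p) (x : Fin n → Vec p) (q : MeanField K D p n) : ℝ≥0∞ :=
  InformationTheory.klDiv q.toMeasure (posterior M x)

/-- `r` is a global minimizer of `F`. -/
def Minimizes {β : Type*} (F : β → ℝ≥0∞) (r : β) : Prop := ∀ r', F r ≤ F r'

/-- `r` is an optimal choice of the factor `q(π_s)`, the other factors of `q` being fixed. -/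
def OptimalPi [NeZero K] (M : Hyper K D p) (x : Fin n → Vec p) (q : MeanField K D p n)
    (s : Inner K D) (r : ProbabilityMeasure (Fin K → ℝ)) : Prop :=
  Minimizes (fun r => KL M x { q with π := Function.update q.π s r }) r

/-- `r` is an optimal choice of the factor `q(μ_s)`, the other factors of `q` being fixed. -/
def OptimalMu [NeZero K] (M : Hyper K D p) (x : Fin n → Vec p) (q : MeanField K D p n)
    (s : Node K D) (r : ProbabilityMeasure (Vec p)) : Prop :=
  Minimizes (fun r => KL M x { q with μ := Function.update q.μ s r }) r

/-- `r` is an optimal choice of the factor `q(Λ_s)`, the other factors of `q` being fixed. -/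
def OptimalLambda [NeZero K] (M : Hyper K D p) (x : Fin n → Vec p) (q : MeanField K D p n)
    (s : Node K D) (r : ProbabilityMeasure (Mat p)) : Prop :=
  Minimizes (fun r => KL M x { q with Λ := Function.update q.Λ s r }) r

/-- `r` is an optimal choice of the factor `q(L)`, the other factors of `q` being fixed. -/
def OptimalL [NeZero K] (M : Hyper K D p) (x : Fin n → Vec p) (q : MeanField K D p n)
    (r : ProbabilityMeasure (Mat p)) : Prop :=
  Minimizes (fun r => KL M x { q with L := r }) r

/-- `r` is an optimal choice of the factor `q(g)`, the other factors of `q` being fixed. -/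
def OptimalG [NeZero K] (M : Hyper K D p) (x : Fin n → Vec p) (q : MeanField K D p n)
    (r : ProbabilityMeasure (Inner K D → ℝ)) : Prop :=
  Minimizes (fun r => KL M x { q with g := r }) r

/-- `r` is an optimal choice of the factor `q(zᵢ)`, the other factors of `q` being fixed. -/
def OptimalZ [NeZero K] (M : Hyper K D p) (x : Fin n → Vec p) (q : MeanField K D p n)
    (i : Fin n) (r : ProbabilityMeasure (TreePath K D)) : Prop :=
  Minimizes (fun r => KL M x { q with z := Function.update q.z i r }) r

/-- Every factor other than the `q(Tᵢ)` is optimal given all the other factors. This holds in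
particular if `q` minimizes the divergence among all mean-field distributions. -/
structure Optimal [NeZero K] (M : Hyper K D p) (x : Fin n → Vec p)
    (q : MeanField K D p n) : Prop where
  pi : ∀ s, OptimalPi M x q s (q.π s)
  mu : ∀ s, OptimalMu M x q s (q.μ s)
  lambda : ∀ s, OptimalLambda M x q s (q.Λ s)
  L : OptimalL M x q q.L
  g : OptimalG M x q q.g
  z : ∀ i, OptimalZ M x q i (q.z i)

/-! ### Statistics and update formulas -/

/-- `q(s ⪯ s(zᵢ))`. -/
def probOnPath (q : MeanField K D p n) (i : Fin n) (s : Node K D) : ℝ :=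
  (q.z i : Measure (TreePath K D)).real {z | OnPath s z}

/-- `q(s ∈ 𝓛(Tᵢ))`. -/
def probLeaf (q : MeanField K D p n) (i : Fin n) (s : Node K D) : ℝ :=
  (q.T i : Measure (Subtree K D)).real {T | T.IsLeaf s}

/-- `q(s ∈ 𝓘(Tᵢ))`. -/
def probInner (q : MeanField K D p n) (i : Fin n) (s : Node K D) : ℝ :=
  (q.T i : Measure (Subtree K D)).real {T | T.IsInner s}

/-- `N_s`. -/
def count (q : MeanField K D p n) (s : Node K D) : ℝ := ∑ i, probOnPath q i s

/-- `Ñ_s`. -/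
def wcount (q : MeanField K D p n) (s : Node K D) : ℝ :=
  ∑ i, probLeaf q i s * probOnPath q i s

/-- `x̄_s`. -/
def wmean (x : Fin n → Vec p) (q : MeanField K D p n) (s : Node K D) : Vec p :=
  (1 / wcount q s) • ∑ i, (probLeaf q i s * probOnPath q i s) • x i

/-- `S_s`, centred at `m`. -/
def wscatter (x : Fin n → Vec p) (q : MeanField K D p n) (s : Node K D) (m : Vec p) : Mat p :=
  (1 / wcount q s) •
    ∑ i, (probLeaf q i s * probOnPath q i s) • Matrix.vecMulVec (x i - m) (x i - m)

/-- Expectation of a random matrix (entrywise). -/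
def matMean (r : Measure (Mat p)) : Mat p := Matrix.of fun i j => ∫ A, A i j ∂r

/-- Expectation of a random vector (coordinatewise). -/
def vecMean (r : Measure (Vec p)) : Vec p := fun i => ∫ v, v i ∂r

/-- Covariance matrix of a random vector. -/
def vecCov (r : Measure (Vec p)) : Mat p :=
  Matrix.of fun i j => ∫ v, (v i - vecMean r i) * (v j - vecMean r j) ∂r

/-- `α̂_s`. -/
def alphaHat (M : Hyper K D p) (q : MeanField K D p n) (s : Inner K D) (k : Fin K) : ℝ :=
  M.α s k + count q (child s k)

/-- `L̂_s`. -/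
def precHat (q : MeanField K D p n) (s : Node K D) : Mat p :=
  wcount q s • matMean (q.Λ s) +
    (if s.1.length < D then (K : ℝ) + 1 else 1) • matMean (q.L)

/-- `m̂_s`, computed from the means `m` at the neighbours of `s`. -/
def meanHat (M : Hyper K D p) (x : Fin n → Vec p) (q : MeanField K D p n)
    (m : Node K D → Vec p) (s : Node K D) : Vec p :=
  (precHat q s)⁻¹ *ᵥ (wcount q s • (matMean (q.Λ s) *ᵥ wmean x q s) +
    matMean (q.L) *ᵥ (parentVec M.m₀ m s +
      if h : s.1.length < D then ∑ k, m (child ⟨s.1, h⟩ k) else 0))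

/-- `ν̂_s`. -/
def nuHat (M : Hyper K D p) (q : MeanField K D p n) (s : Node K D) : ℝ :=
  M.ν s + wcount q s

/-- `Ŵ_s⁻¹`, computed from the mean `m` and the covariance matrix `C` of `q(μ_s)`. -/
def WHatInv (M : Hyper K D p) (x : Fin n → Vec p) (q : MeanField K D p n)
    (m : Vec p) (C : Mat p) (s : Node K D) : Mat p :=
  (M.W s)⁻¹ + wcount q s • (wscatter x q s m + C)

/-- `û`. -/
def uHat (M : Hyper K D p) : ℝ := M.u + Fintype.card (Node K D)

/-- `V̂⁻¹`, computed from the means `m` and the covariance matrices `C` of the `q(μ_s)`. -/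
def VHatInv (M : Hyper K D p) (m : Node K D → Vec p) (C : Node K D → Mat p) : Mat p :=
  M.V⁻¹ + C root + Matrix.vecMulVec (m root - M.m₀) (m root - M.m₀) +
    ∑ s with s ≠ root, (C s + C (parent s) +
      Matrix.vecMulVec (m s - m (parent s)) (m s - m (parent s)))

/-- `â_s`. -/
def aHat (M : Hyper K D p) (q : MeanField K D p n) (s : Inner K D) : ℝ :=
  M.a s + ∑ i, probInner q i s.toNode

/-- `b̂_s`. -/
def bHat (M : Hyper K D p) (q : MeanField K D p n) (s : Inner K D) : ℝ :=
  M.b s + ∑ i, probLeaf q i s.toNode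

/-- `E[ln π_{s,k}]` under `q(π_s)`. -/
def expLogPi (q : MeanField K D p n) (s : Inner K D) (k : Fin K) : ℝ :=
  ∫ v, Real.log (v k) ∂(q.π s : Measure (Fin K → ℝ))

/-- `ln ζ_{i,s}`. -/
def logZeta (x : Fin n → Vec p) (q : MeanField K D p n) (i : Fin n) (s : Node K D) : ℝ :=
  probLeaf q i s * ∫ w, Real.log (gaussianDensity w.1 w.2 (x i))
    ∂((q.μ s : Measure (Vec p)).prod (q.Λ s : Measure (Mat p)))

/-- `ξ_{i,s,k}`, by recursion from the leaves of the perfect tree to its root. -/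
def xi (x : Fin n → Vec p) (q : MeanField K D p n) (i : Fin n) (s : Inner K D) (k : Fin K) : ℝ :=
  if h : s.1.length + 1 < D then
    Real.exp (expLogPi q s k + logZeta x q i (child s k) +
      Real.log (∑ k', xi x q i ⟨s.1 ++ [k], by simpa using h⟩ k'))
  else
    Real.exp (expLogPi q s k + logZeta x q i (child s k))
termination_by D - s.1.length
decreasing_by
  have := s.2
  simp only [List.length_append, List.length_singleton]
  omega

/-- `π̂_{i,s,k}`. -/
def piHat (x : Fin n → Vec p) (q : MeanField K D p n) (i : Fin n) (s : Inner K D) (k : Fin K) : ℝ :=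
  xi x q i s k / ∑ k', xi x q i s k'

end

end TreeMixture

/-! Let ℓ be the logarithm of the joint density relative to a product base measure: the priors of π,
g, Λ, L, counting measure in z and T, Lebesgue measure in μ. If all factors of q but one are frozen,
the divergence as a function of the remaining factor r is KL(r ‖ r*) + constant wherever it is
finite, where r* has density proportional to exp E[ℓ] relative to the base measure of that variable,
the expectation being over the frozen factors. Hence r* is the unique minimizer
(`minimizes_klDiv_prod_iff`, applied to the latent space through `minimizes_iff_of_splits`). Every
update is then a computation of E[ℓ] as a function of one variable, followed by conjugacy: the prior
tilted by that exponential is again Dirichlet, Beta or Wishart, and for μ a square is completed.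

The factors are arbitrary probability measures, so the formal computation has to be justified from
the finiteness of the divergence alone. First, ℓ itself may fail to be integrable. Only differences
of ℓ between a value of the free variable and a fixed reference value are averaged; all terms
without that variable cancel, and the common remainder is integrable because the divergence at q is
finite. It must also be shown that r* with the frozen factors has finite divergence; this follows
because the negative part of the log-likelihood ratio is always integrable, while its conditional
means are constant.

Second, E[Λ], E[L] and the first two moments of μ must exist. By Young's inequality a function with
an exponential moment under the posterior has finite positive part under q
(`lintegral_le_klDiv_add_lintegral_exp`). The traces of the Λ_s and of L, and the quadratic forms of
L in the increments of μ along the tree, have joint exponential moments for small coefficients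
(`exists_lintegral_exp_momentFun_lt_top`), hence are q-integrable (`integrable_traces`). Traces
bound matrix entries, and the quadratic forms give square integrable increments, hence square
integrable μ_s by descent from the root.

The Dirichlet and Wishart laws are defined by normalization, so their masses must be shown finite
and nonzero. For the Wishart law this is an induction on the dimension through Schur complements;
for the Dirichlet law one uses that some coordinate of a point of the simplex is at least 1/K.

For z, the logarithm of the path distribution built from π̂ telescopes along a path and agrees with
the expected log density up to a constant (`exists_logPath_piHat`). Its integrability hypotheses
hold automatically when q(π_s) and q(Λ_s) are optimal, since log π_{s,k} and log det Λ are
integrable under Dirichlet and Wishart laws. Part (B) then reads the updates at q itself,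
identifying the parameters of q(μ_s) with its mean and covariance. -/

namespace TreeMixture

noncomputable section

open InformationTheory

variable {K D p n : ℕ}

/-! ### Minimizing the divergence over one factor of a product measure -/

section ProductOptimization

variable {X Y : Type*} [MeasurableSpace X] [MeasurableSpace Y]

theorem prod_eq_withDensity_of_ac {ρ₁ : Measure X} {ρ₂ : Measure Y} [SigmaFinite ρ₁] [SigmaFinite ρ₂]
    {ℓ : X × Y → ℝ} (hℓ : Measurable ℓ) {Ψ : X → ℝ} (hΨ : Measurable Ψ)
    {r : Measure X} [IsProbabilityMeasure r] {q₂ : Measure Y} [IsProbabilityMeasure q₂]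
    [IsProbabilityMeasure (ρ₁.withDensity fun x => ENNReal.ofReal (Real.exp (Ψ x)))]
    (hr : r ≪ ρ₁.withDensity fun x => ENNReal.ofReal (Real.exp (Ψ x))) (hq₂ : q₂ ≪ ρ₂) :
    r.prod q₂ = ((ρ₁.prod ρ₂).withDensity fun z => ENNReal.ofReal (Real.exp (ℓ z))).withDensity
      fun z => r.rnDeriv (ρ₁.withDensity fun x => ENNReal.ofReal (Real.exp (Ψ x))) z.1 *
        q₂.rnDeriv ρ₂ z.2 * ENNReal.ofReal (Real.exp (Ψ z.1 - ℓ z)) := by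
  set rs := ρ₁.withDensity fun x => ENNReal.ofReal (Real.exp (Ψ x)) with hrs
  have h1 : r = ρ₁.withDensity
      ((fun x => ENNReal.ofReal (Real.exp (Ψ x))) * r.rnDeriv rs) := by
    rw [withDensity_mul _ (by fun_prop) (by fun_prop), ← hrs,
      Measure.withDensity_rnDeriv_eq _ _ hr]
  have h2 : q₂ = ρ₂.withDensity (q₂.rnDeriv ρ₂) := (Measure.withDensity_rnDeriv_eq _ _ hq₂).symm
  conv_lhs => rw [h1, h2]
  rw [← withDensity_mul _ (by fun_prop) (by fun_prop), prod_withDensity (by fun_prop) (by fun_prop)]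
  congr 1
  ext z
  simp only [Pi.mul_apply]
  have : ENNReal.ofReal (Real.exp (Ψ z.1)) =
      ENNReal.ofReal (Real.exp (ℓ z)) * ENNReal.ofReal (Real.exp (Ψ z.1 - ℓ z)) := by
    rw [← ENNReal.ofReal_mul (Real.exp_pos _).le, ← Real.exp_add]
    congr 2; ring
  rw [this]; ring

/-- The logarithm of the density of the preceding lemma splits into a sum because both Radon–Nikodym
derivatives are positive and finite almost everywhere for r ⊗ q₂. -/
theorem llr_prod_ae_eq {ρ₁ : Measure X} {ρ₂ : Measure Y} [SigmaFinite ρ₁] [SigmaFinite ρ₂]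
    {ℓ : X × Y → ℝ} (hℓ : Measurable ℓ) {Ψ : X → ℝ} (hΨ : Measurable Ψ)
    {r : Measure X} [IsProbabilityMeasure r] {q₂ : Measure Y} [IsProbabilityMeasure q₂]
    [IsProbabilityMeasure (ρ₁.withDensity fun x => ENNReal.ofReal (Real.exp (Ψ x)))]
    [IsProbabilityMeasure ((ρ₁.prod ρ₂).withDensity fun z => ENNReal.ofReal (Real.exp (ℓ z)))]
    (hr : r ≪ ρ₁.withDensity fun x => ENNReal.ofReal (Real.exp (Ψ x))) (hq₂ : q₂ ≪ ρ₂) :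
    llr (r.prod q₂) ((ρ₁.prod ρ₂).withDensity fun z => ENNReal.ofReal (Real.exp (ℓ z)))
      =ᵐ[r.prod q₂] fun z =>
        llr r (ρ₁.withDensity fun x => ENNReal.ofReal (Real.exp (Ψ x))) z.1 +
          (Ψ z.1 - ℓ z + llr q₂ ρ₂ z.2) := by
  have heq := prod_eq_withDensity_of_ac hℓ hΨ hr hq₂
  set rs := ρ₁.withDensity fun x => ENNReal.ofReal (Real.exp (Ψ x)) with hrs
  set P := (ρ₁.prod ρ₂).withDensity fun z => ENNReal.ofReal (Real.exp (ℓ z)) with hP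
  have hac : r.prod q₂ ≪ P := by rw [heq]; exact withDensity_absolutelyContinuous _ _
  have hd := Measure.rnDeriv_withDensity P (f := fun z => r.rnDeriv rs z.1 *
        q₂.rnDeriv ρ₂ z.2 * ENNReal.ofReal (Real.exp (Ψ z.1 - ℓ z))) (by fun_prop)
  rw [← heq] at hd
  have a1 : ∀ᵐ z ∂(r.prod q₂), 0 < r.rnDeriv rs z.1 :=
    Measure.quasiMeasurePreserving_fst.ae (Measure.rnDeriv_pos hr)
  have a2 : ∀ᵐ z ∂(r.prod q₂), r.rnDeriv rs z.1 < ∞ :=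
    Measure.quasiMeasurePreserving_fst.ae (hr.ae_le (Measure.rnDeriv_lt_top r rs))
  have a3 : ∀ᵐ z ∂(r.prod q₂), 0 < q₂.rnDeriv ρ₂ z.2 :=
    Measure.quasiMeasurePreserving_snd.ae (Measure.rnDeriv_pos hq₂)
  have a4 : ∀ᵐ z ∂(r.prod q₂), q₂.rnDeriv ρ₂ z.2 < ∞ :=
    Measure.quasiMeasurePreserving_snd.ae (hq₂.ae_le (Measure.rnDeriv_lt_top q₂ ρ₂))
  filter_upwards [hac.ae_le hd, a1, a2, a3, a4] with z hz h1 h2 h3 h4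
  simp only [llr, hz, ENNReal.toReal_mul, ENNReal.toReal_ofReal (Real.exp_pos _).le]
  have p1 := (ENNReal.toReal_pos h1.ne' h2.ne).ne'
  have p2 := (ENNReal.toReal_pos h3.ne' h4.ne).ne'
  rw [Real.log_mul (mul_ne_zero p1 p2) (Real.exp_pos _).ne', Real.log_mul p1 p2, Real.log_exp]
  ring

/-- The unique minimizer of the divergence of a product measure over its first factor: its density
is the exponential of the log density of the target, averaged over the second factor. -/
theorem minimizes_klDiv_prod_iff {ρ₁ : Measure X} {ρ₂ : Measure Y} [SigmaFinite ρ₁]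
    [SigmaFinite ρ₂] {ℓ : X × Y → ℝ} (hℓ : Measurable ℓ) {Ψ : X → ℝ} (hΨ : Measurable Ψ)
    {q₁ : Measure X} [IsProbabilityMeasure q₁] {q₂ : Measure Y} [IsProbabilityMeasure q₂]
    (hprob : IsProbabilityMeasure (ρ₁.withDensity fun x => ENNReal.ofReal (Real.exp (Ψ x))))
    (hPprob : IsProbabilityMeasure
      ((ρ₁.prod ρ₂).withDensity fun z => ENNReal.ofReal (Real.exp (ℓ z))))
    (hKL : klDiv (q₁.prod q₂)
      ((ρ₁.prod ρ₂).withDensity fun z => ENNReal.ofReal (Real.exp (ℓ z))) ≠ ∞)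
    (x₀ : X) (c : ℝ)
    (hφ : ∀ᵐ x ∂ρ₁, Integrable (fun y => ℓ (x, y) - ℓ (x₀, y)) q₂ ∧
      ∫ y, (ℓ (x, y) - ℓ (x₀, y)) ∂q₂ = Ψ x + c)
    (r : ProbabilityMeasure X) :
    Minimizes (fun r : ProbabilityMeasure X => klDiv ((r : Measure X).prod q₂)
      ((ρ₁.prod ρ₂).withDensity fun z => ENNReal.ofReal (Real.exp (ℓ z)))) r ↔
    (r : Measure X) = ρ₁.withDensity fun x => ENNReal.ofReal (Real.exp (Ψ x)) := by
  set rs := ρ₁.withDensity fun x => ENNReal.ofReal (Real.exp (Ψ x)) with hrs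
  set P := (ρ₁.prod ρ₂).withDensity fun z => ENNReal.ofReal (Real.exp (ℓ z)) with hP
  have hPac : P ≪ ρ₁.prod ρ₂ := withDensity_absolutelyContinuous _ _
  have hrsac : rs ≪ ρ₁ := withDensity_absolutelyContinuous _ _
  have hacrs : ρ₁ ≪ rs := withDensity_absolutelyContinuous' (by fun_prop)
    (ae_of_all _ fun x => by simp [Real.exp_pos])
  have fst_ac : ∀ r' : Measure X, r'.prod q₂ ≪ P → r' ≪ rs := by
    intro r' h
    refine Measure.AbsolutelyContinuous.trans ?_ hacrs
    have h2 := (h.trans hPac).map measurable_fst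
    rw [Measure.map_fst_prod, measure_univ, one_smul] at h2
    exact h2.trans Measure.quasiMeasurePreserving_fst.absolutelyContinuous
  obtain ⟨hac, hint⟩ := klDiv_ne_top_iff.1 hKL
  have hq₁ : q₁ ≪ rs := fst_ac _ hac
  have hq₂ : q₂ ≪ ρ₂ := by
    have h2 := (hac.trans hPac).map measurable_snd
    rw [Measure.map_snd_prod, measure_univ, one_smul] at h2
    exact h2.trans Measure.quasiMeasurePreserving_snd.absolutelyContinuous
  -- the part of the log density that depends on the second variable only
  set B : Y → ℝ := fun y => llr q₂ ρ₂ y - ℓ (x₀, y) with hB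
  -- The log-likelihood ratio of r' ⊗ q₂ is llr(r', rs) + A + B. Since ℓ(x, ·) alone need not be
  -- integrable, A carries only the difference to the reference point and averages to -c for every
  -- good x.
  set A : X → Y → ℝ := fun x y => Ψ x - (ℓ (x, y) - ℓ (x₀, y)) with hA
  have hllr : ∀ (r' : Measure X) [IsProbabilityMeasure r'], r' ≪ rs →
      llr (r'.prod q₂) P =ᵐ[r'.prod q₂] fun z => llr r' rs z.1 + (A z.1 z.2 + B z.2) := by
    intro r' _ h
    refine (llr_prod_ae_eq hℓ hΨ h hq₂).trans (ae_of_all _ fun z => ?_)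
    simp only [hA, hB]; ring
  have hA_int : ∀ᵐ x ∂ρ₁, Integrable (A x) q₂ ∧ ∫ y, A x y ∂q₂ = -c := by
    filter_upwards [hφ] with x hx
    refine ⟨(integrable_const _).sub hx.1, ?_⟩
    simp only [hA]
    rw [integral_sub (integrable_const _) hx.1, hx.2]
    simp
  -- Finite divergence at q₁ makes almost every section y ↦ llr + A + B integrable; removing the
  -- constant and A from one such section leaves B.
  have hBint : Integrable B q₂ := by
    have h1 := ((integrable_congr (hllr q₁ hq₁)).1 hint).prod_right_ae
    have h2 := (hq₁.trans hrsac).ae_le hA_int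
    obtain ⟨x, hx1, hx2⟩ := (h1.and h2).exists
    have := (hx1.sub (integrable_const (llr q₁ rs x))).sub hx2.1
    refine this.congr (ae_of_all _ fun y => ?_)
    simp
  set C : ℝ := -c + ∫ y, B y ∂q₂ with hC
  have hABint : ∀ᵐ x ∂ρ₁, Integrable (fun y => A x y + B y) q₂ ∧
      ∫ y, (A x y + B y) ∂q₂ = C := by
    filter_upwards [hA_int] with x hx
    exact ⟨hx.1.add hBint, by rw [integral_add hx.1 hBint, hx.2]⟩
  -- Where the divergence is finite, it equals KL(r' ‖ rs) plus a constant independent of r'.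
  have hfin : ∀ (r' : Measure X) [IsProbabilityMeasure r'], klDiv (r'.prod q₂) P ≠ ∞ →
      r' ≪ rs ∧ Integrable (llr r' rs) r' ∧
        (klDiv (r'.prod q₂) P).toReal = (klDiv r' rs).toReal + C := by
    intro r' _ h
    obtain ⟨h1, h2⟩ := klDiv_ne_top_iff.1 h
    have hr' := fst_ac _ h1
    have h3 := (integrable_congr (hllr r' hr')).1 h2
    have h4 : ∀ᵐ x ∂r', ∫ y, (llr r' rs x + (A x y + B y)) ∂q₂ = llr r' rs x + C := by
      filter_upwards [(hr'.trans hrsac).ae_le hABint] with x hx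
      rw [integral_add (integrable_const _) hx.1, hx.2]
      simp
    have h5 : Integrable (fun x => llr r' rs x + C) r' :=
      (integrable_congr h4).1 h3.integral_prod_left
    have h6 : Integrable (llr r' rs) r' := by
      have := h5.sub (integrable_const C)
      refine this.congr (ae_of_all _ fun x => ?_)
      simp
    refine ⟨hr', h6, ?_⟩
    rw [toReal_klDiv_of_measure_eq h1 (by simp), toReal_klDiv_of_measure_eq hr' (by simp),
      integral_congr_ae (hllr r' hr'), integral_prod _ h3, integral_congr_ae h4,
      integral_add h6 (integrable_const _)]
    simp
  -- Without this the decomposition would say nothing about the candidate. At rs the log-likelihood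
  -- ratio is A + B. Its exponential with the opposite sign has integral at most 1, so the negative
  -- part is integrable; its inner integrals all equal C, so |t| = t + 2 max(-t, 0) bounds the
  -- absolute value.
  have hstar : klDiv (rs.prod q₂) P ≠ ∞ := by
    have hdens := prod_eq_withDensity_of_ac hℓ hΨ (Measure.AbsolutelyContinuous.refl rs) hq₂
    have hacs : rs.prod q₂ ≪ P := by rw [hdens]; exact withDensity_absolutelyContinuous _ _
    refine klDiv_ne_top hacs ?_
    refine (integrable_congr (f := fun z => A z.1 z.2 + B z.2) ?_).1 ?_
    · have h0 := Measure.quasiMeasurePreserving_fst.ae (μa := rs.prod q₂) (llr_self rs)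
      filter_upwards [hllr rs (Measure.AbsolutelyContinuous.refl rs), h0] with z hz h0
      rw [hz, h0]; simp
    have hmeas : Measurable fun z : X × Y => A z.1 z.2 + B z.2 := by
      simp only [hA, hB]; fun_prop
    have hexp : ∫⁻ z, ENNReal.ofReal (Real.exp (-(A z.1 z.2 + B z.2))) ∂(rs.prod q₂) ≤ 1 := by
      have a1 : ∀ᵐ z ∂(rs.prod q₂), ENNReal.ofReal (Real.exp (-(A z.1 z.2 + B z.2))) ≤
          ((rs.prod q₂).rnDeriv P z)⁻¹ := by
        have hpos := Measure.rnDeriv_pos hacs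
        have hlt := hacs.ae_le (Measure.rnDeriv_lt_top (rs.prod q₂) P)
        have h0 := Measure.quasiMeasurePreserving_fst.ae (μa := rs.prod q₂) (llr_self rs)
        filter_upwards [hllr rs (Measure.AbsolutelyContinuous.refl rs), h0, hpos, hlt]
          with z hz h0 hp hl
        rw [h0] at hz
        simp only [Pi.zero_apply, zero_add] at hz
        rw [← hz, llr_def, Real.exp_neg, Real.exp_log (ENNReal.toReal_pos hp.ne' hl.ne),
          ENNReal.ofReal_inv_of_pos (ENNReal.toReal_pos hp.ne' hl.ne), ENNReal.ofReal_toReal hl.ne]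
      refine (lintegral_mono_ae a1).trans ?_
      rw [← lintegral_rnDeriv_mul hacs (by fun_prop)]
      calc ∫⁻ z, (rs.prod q₂).rnDeriv P z * ((rs.prod q₂).rnDeriv P z)⁻¹ ∂P
          ≤ ∫⁻ z, 1 ∂P := lintegral_mono fun z => ENNReal.mul_inv_le_one _
        _ = 1 := by simp
    refine ⟨hmeas.aestronglyMeasurable, ?_⟩
    have hneg : ∫⁻ z, ENNReal.ofReal (-(A z.1 z.2 + B z.2)) ∂(rs.prod q₂) ≤ 1 :=
      (lintegral_mono fun z => ENNReal.ofReal_le_ofReal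
        (by linarith [Real.add_one_le_exp (-(A z.1 z.2 + B z.2))])).trans hexp
    rw [hasFiniteIntegral_iff_enorm, lintegral_prod _ (by fun_prop)]
    rw [lintegral_prod _ (by fun_prop)] at hneg
    have hbound : ∀ᵐ x ∂rs, ∫⁻ y, ‖A x y + B y‖ₑ ∂q₂ ≤
        ENNReal.ofReal |C| + 2 * ∫⁻ y, ENNReal.ofReal (-(A x y + B y)) ∂q₂ := by
      filter_upwards [hrsac.ae_le hABint] with x hx
      have e1 : ∀ t : ℝ, ‖t‖ = t + 2 * max (-t) 0 := fun t => by
        rw [Real.norm_eq_abs]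
        rcases le_total 0 t with h | h
        · rw [abs_of_nonneg h, max_eq_right (by linarith)]; ring
        · rw [abs_of_nonpos h, max_eq_left (by linarith)]; ring
      have hmax : Integrable (fun y => max (-(A x y + B y)) 0) q₂ := hx.1.neg.pos_part
      rw [← ofReal_integral_norm_eq_lintegral_enorm hx.1]
      simp_rw [e1]
      rw [integral_add hx.1 (hmax.const_mul 2), hx.2, integral_const_mul]
      refine (ENNReal.ofReal_add_le).trans (add_le_add
        (ENNReal.ofReal_le_ofReal (le_abs_self C)) ?_)
      rw [ENNReal.ofReal_mul (by norm_num),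
        ofReal_integral_eq_lintegral_ofReal hmax (ae_of_all _ fun y => le_max_right _ _)]
      simp only [ENNReal.ofReal_ofNat]
      simp [ENNReal.ofReal_max]
    refine (lintegral_mono_ae hbound).trans_lt ?_
    rw [lintegral_add_left (by fun_prop), lintegral_const_mul' _ _ (by simp)]
    simp only [lintegral_const, measure_univ, mul_one]
    refine ENNReal.add_lt_top.2 ⟨ENNReal.ofReal_lt_top, ENNReal.mul_lt_top (by simp) ?_⟩
    exact hneg.trans_lt (by simp)
  have hstarC : (klDiv (rs.prod q₂) P).toReal = C := by
    have := (hfin rs hstar).2.2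
    rwa [klDiv_self, ENNReal.toReal_zero, zero_add] at this
  constructor
  · intro hmin
    have h1 : klDiv ((r : Measure X).prod q₂) P ≤ klDiv (rs.prod q₂) P := hmin ⟨rs, hprob⟩
    have h2 := ne_top_of_le_ne_top hstar h1
    obtain ⟨h3, h4, h5⟩ := hfin r h2
    have h6 := ENNReal.toReal_mono hstar h1
    rw [h5, hstarC] at h6
    have h7 : (klDiv (r : Measure X) rs).toReal = 0 :=
      le_antisymm (by linarith) ENNReal.toReal_nonneg
    rcases (ENNReal.toReal_eq_zero_iff _).1 h7 with h8 | h8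
    · exact klDiv_eq_zero_iff.1 h8
    · exact absurd h8 (klDiv_ne_top h3 h4)
  · intro hr r'
    simp only [hr]
    by_cases h : klDiv ((r' : Measure X).prod q₂) P = ∞
    · rw [h]; exact le_top
    · rw [← ENNReal.toReal_le_toReal hstar h, hstarC, (hfin r' h).2.2]
      linarith [ENNReal.toReal_nonneg (a := klDiv (r' : Measure X) rs)]

end ProductOptimization

/-- A function is integrable as soon as it has an exponential moment under a measure at finite
divergence. -/
theorem lintegral_le_klDiv_add_lintegral_exp {Ω : Type*} [MeasurableSpace Ω] {Q P : Measure Ω}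
    [IsFiniteMeasure Q] [IsFiniteMeasure P] (hQP : Q ≪ P) {φ : Ω → ℝ} (hφ : Measurable φ) :
    ∫⁻ ω, ENNReal.ofReal (φ ω) ∂Q ≤ klDiv Q P + ∫⁻ ω, ENNReal.ofReal (Real.exp (φ ω)) ∂P := by
  rw [klDiv_eq_lintegral_klFun_of_ac hQP, ← lintegral_add_right _ (by fun_prop),
    ← lintegral_rnDeriv_mul hQP (by fun_prop)]
  refine lintegral_mono_ae ?_
  filter_upwards [Measure.rnDeriv_lt_top Q P] with ω hω
  rw [← ENNReal.ofReal_add (klFun_nonneg ENNReal.toReal_nonneg) (Real.exp_pos _).le,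
    ← ENNReal.ofReal_toReal hω.ne]
  rw [← ENNReal.ofReal_mul ENNReal.toReal_nonneg, ENNReal.toReal_ofReal ENNReal.toReal_nonneg]
  refine ENNReal.ofReal_le_ofReal ?_
  generalize (Q.rnDeriv P ω).toReal = a, ENNReal.toReal_nonneg (a := Q.rnDeriv P ω) = ha
  rcases ha.eq_or_lt with h | h
  · subst h; simp [klFun]; positivity
  -- Young's inequality a φ ≤ `klFun` a + exp φ: the tangent inequality 1 + t ≤ exp t at t = φ - log
  -- a, multiplied by a.
  · have := Real.add_one_le_exp (φ ω - Real.log a)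
    rw [Real.exp_sub, Real.exp_log h, le_div_iff₀ h] at this
    rw [klFun_apply]
    nlinarith

/-! ### Transport along measurable equivalences and the unknown evidence -/

section Transfer

variable {Ω Ω' : Type*} [MeasurableSpace Ω] [MeasurableSpace Ω']

/-- Data processing for `e` and for its inverse. -/
theorem klDiv_map_measurableEquiv (e : Ω ≃ᵐ Ω') (μ ν : Measure Ω) [IsFiniteMeasure μ]
    [IsFiniteMeasure ν] : klDiv (μ.map e) (ν.map e) = klDiv μ ν := by
  refine le_antisymm (klDiv_map_le μ ν e.measurable) ?_
  have := klDiv_map_le (μ.map e) (ν.map e) e.symm.measurable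
  simpa [Measure.map_map e.symm.measurable e.measurable] using this

theorem map_withDensity_comp (e : Ω ≃ᵐ Ω') (μ : Measure Ω) (f : Ω' → ℝ≥0∞) :
    (μ.withDensity (f ∘ e)).map e = (μ.map e).withDensity f := by
  ext s hs
  rw [e.map_apply, withDensity_apply _ (e.measurable hs), withDensity_apply _ hs,
    e.measurableEmbedding.restrict_map, e.measurableEmbedding.lintegral_map]
  rfl

theorem normalized_eq_zero_of_univ_eq_zero {m : Measure Ω} (h : m Set.univ = 0) :
    normalized m = 0 := by
  rw [Measure.measure_univ_eq_zero.1 h]; simp [normalized]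

theorem normalized_eq_zero_of_univ_eq_top {m : Measure Ω} (h : m Set.univ = ∞) :
    normalized m = 0 := by
  simp [normalized, h]

theorem isProbabilityMeasure_normalized {m : Measure Ω} (h0 : m Set.univ ≠ 0)
    (htop : m Set.univ ≠ ∞) : IsProbabilityMeasure (normalized m) :=
  ⟨by simp [normalized, ENNReal.inv_mul_cancel h0 htop]⟩

/-- `minimizes_klDiv_prod_iff` for a space that is identified with a product by `e`, with the
averages taken over the whole space. -/
theorem minimizes_klDiv_iff_of_equiv {X Y : Type*} [MeasurableSpace X] [MeasurableSpace Y]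
    (e : X × Y ≃ᵐ Ω) {ρ : Measure Ω} {ρ₁ : Measure X} {ρ₂ : Measure Y} [SigmaFinite ρ₁]
    [SigmaFinite ρ₂] (hρ : (ρ₁.prod ρ₂).map e = ρ) {w : Ω → ℝ≥0∞} {ℓ : Ω → ℝ} (hℓ : Measurable ℓ)
    (hw : w =ᵐ[ρ] fun ω => ENNReal.ofReal (Real.exp (ℓ ω)))
    {Q : ProbabilityMeasure X → Measure Ω} {q₂ : Measure Y} [IsProbabilityMeasure q₂]
    (hQ : ∀ r : ProbabilityMeasure X, ((r : Measure X).prod q₂).map e = Q r)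
    (q₁ : ProbabilityMeasure X) (hKL : klDiv (Q q₁) (normalized (ρ.withDensity w)) ≠ ∞)
    {upd : X → Ω → Ω} (hupd : ∀ x x' y, upd x (e (x', y)) = e (x, y))
    (x₀ : X) (c : ℝ) {Ψ : X → ℝ} (hΨ : Measurable Ψ) {rs : Measure X}
    (hrs : rs = ρ₁.withDensity fun x => ENNReal.ofReal (Real.exp (Ψ x)))
    (hprob : IsProbabilityMeasure rs)
    (hφ : ∀ᵐ x ∂ρ₁, Integrable (fun ω => ℓ (upd x ω) - ℓ (upd x₀ ω)) (Q q₁) ∧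
      ∫ ω, (ℓ (upd x ω) - ℓ (upd x₀ ω)) ∂(Q q₁) = Ψ x + c)
    (r : ProbabilityMeasure X) :
    Minimizes (fun r => klDiv (Q r) (normalized (ρ.withDensity w))) r ↔ (r : Measure X) = rs := by
  have hQprob : ∀ r, IsProbabilityMeasure (Q r) := fun r => by
    rw [← hQ]; exact Measure.isProbabilityMeasure_map e.measurable.aemeasurable
  -- A mass of 0 or ∞ would make `normalized` the zero measure, at infinite divergence from every
  -- probability measure. So the finite divergence already forces the evidence to be positive and
  -- finite.
  have hne : normalized (ρ.withDensity w) ≠ 0 := by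
    intro h
    rw [h] at hKL
    have := hQprob q₁
    exact hKL klDiv_zero_right
  set m := ρ.withDensity w Set.univ with hm
  have h0 : m ≠ 0 := fun h => hne (normalized_eq_zero_of_univ_eq_zero h)
  have htop : m ≠ ∞ := fun h => hne (normalized_eq_zero_of_univ_eq_top h)
  have hmpos : 0 < m.toReal := ENNReal.toReal_pos h0 htop
  -- The log evidence is absorbed into the exponent; it cancels in the differences that are
  -- averaged.
  set ℓ' : X × Y → ℝ := fun z => ℓ (e z) - Real.log m.toReal with hℓ'
  have hP : normalized (ρ.withDensity w) =
      ((ρ₁.prod ρ₂).withDensity fun z => ENNReal.ofReal (Real.exp (ℓ' z))).map e := by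
    have e1 : (fun z => ENNReal.ofReal (Real.exp (ℓ' z))) =
        (m⁻¹ • fun ω => ENNReal.ofReal (Real.exp (ℓ ω))) ∘ e := by
      ext z
      simp only [hℓ', Function.comp_apply, Pi.smul_apply, smul_eq_mul]
      rw [Real.exp_sub, Real.exp_log hmpos, ENNReal.ofReal_div_of_pos hmpos,
        ENNReal.ofReal_toReal htop, ENNReal.div_eq_inv_mul]
    rw [e1, map_withDensity_comp, hρ, withDensity_smul _ (by fun_prop), normalized,
      withDensity_congr_ae hw]
    simp only [hm, withDensity_congr_ae hw]
  have hPprob : IsProbabilityMeasure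
      ((ρ₁.prod ρ₂).withDensity fun z => ENNReal.ofReal (Real.exp (ℓ' z))) := by
    have h1 := isProbabilityMeasure_normalized h0 htop
    rw [hP] at h1
    exact ⟨by have := h1.measure_univ; rwa [e.map_apply] at this⟩
  have hKLeq : ∀ r, klDiv (Q r) (normalized (ρ.withDensity w)) = klDiv ((r : Measure X).prod q₂)
      ((ρ₁.prod ρ₂).withDensity fun z => ENNReal.ofReal (Real.exp (ℓ' z))) := fun r => by
    rw [← hQ, hP, klDiv_map_measurableEquiv]
  simp_rw [hKLeq]
  rw [hKLeq] at hKL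
  subst hrs
  refine minimizes_klDiv_prod_iff (q₁ := q₁) (by fun_prop) hΨ hprob hPprob hKL x₀ c ?_ r
  filter_upwards [hφ] with x hx
  -- Overwriting the first coordinate makes the integrand a function of y only, so its average over
  -- the whole law is its average over q₂, whatever q₁ is.
  have hfun : ∀ z : X × Y, ℓ (upd x (e z)) - ℓ (upd x₀ (e z)) = ℓ' (x, z.2) - ℓ' (x₀, z.2) := by
    rintro ⟨x', y⟩
    rw [hupd, hupd]; simp [hℓ']
  have hmeas : Measurable fun y => ℓ' (x, y) - ℓ' (x₀, y) := by fun_prop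
  have hsnd : ((q₁ : Measure X).prod q₂).map Prod.snd = q₂ := by simp [Measure.map_snd_prod]
  obtain ⟨h1, h2⟩ := hx
  rw [← hQ] at h1 h2
  rw [e.measurableEmbedding.integrable_map_iff] at h1
  rw [e.measurableEmbedding.integral_map] at h2
  simp only [Function.comp_def, hfun] at h1 h2
  constructor
  · rw [← hsnd, integrable_map_measure hmeas.aestronglyMeasurable measurable_snd.aemeasurable]
    exact h1
  · rw [← h2]
    conv_lhs => rw [← hsnd]
    rw [integral_map measurable_snd.aemeasurable hmeas.aestronglyMeasurable]

end Transfer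

/-! ### Isolating one factor of a nested product -/

section Splitting

variable {X Y Z A B ι : Type*} [MeasurableSpace X] [MeasurableSpace Y] [MeasurableSpace Z]
  [MeasurableSpace A] [MeasurableSpace B]

/-- The family `m` of measures is, via `e`, the family of products with a fixed measure. -/
structure Splits (e : X × Y ≃ᵐ Z) (m : Measure X → Measure Z) (m₂ : Measure Y) : Prop where
  sigmaFinite : SigmaFinite m₂
  map_eq : ∀ r : Measure X, SigmaFinite r → (r.prod m₂).map e = m r

/-- Separating one coordinate from the others. -/
def piSlot [DecidableEq ι] (s : ι) : X × ({t : ι // t ≠ s} → X) ≃ᵐ (ι → X) where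
  toFun z t := if h : t = s then z.1 else z.2 ⟨t, h⟩
  invFun f := (f s, fun t => f t)
  left_inv := by
    rintro ⟨x, y⟩
    refine Prod.ext (by simp) (funext fun t => ?_)
    simp [t.2]
  right_inv f := by
    ext t
    by_cases h : t = s
    · subst h; simp
    · simp [h]
  measurable_toFun := by
    refine measurable_pi_iff.2 fun t => ?_
    by_cases h : t = s
    · simpa [h] using measurable_fst
    · simp only [Equiv.coe_fn_mk, h, dite_false]; fun_prop
  measurable_invFun := by
    simp only [Equiv.coe_fn_symm_mk]; fun_prop

theorem update_piSlot [DecidableEq ι] (s : ι) (x x' : X) (y : {t : ι // t ≠ s} → X) :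
    Function.update (piSlot s (x', y)) s x = piSlot s (x, y) := by
  ext t
  by_cases h : t = s
  · subst h; simp [piSlot]
  · simp [piSlot, h]

/-- If X is already isolated inside A, the other component B simply joins the remainder. Together
with `inrSlot` this reaches any position of a nested product. -/
def inlSlot (B : Type*) [MeasurableSpace B] (e : X × Y ≃ᵐ A) : X × (Y × B) ≃ᵐ A × B :=
  MeasurableEquiv.prodAssoc.symm.trans (e.prodCongr (MeasurableEquiv.refl B))

def inrSlot (A : Type*) [MeasurableSpace A] (e : X × Y ≃ᵐ B) : X × (A × Y) ≃ᵐ A × B :=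
  (MeasurableEquiv.prodAssoc.symm.trans
    ((MeasurableEquiv.prodComm.prodCongr (MeasurableEquiv.refl Y)).trans
      MeasurableEquiv.prodAssoc)).trans ((MeasurableEquiv.refl A).prodCongr e)

/-- For variables that are updated as a whole, namely g and L: the remainder is a point. -/
def unitSlot : X × Unit ≃ᵐ X where
  toFun := Prod.fst
  invFun x := (x, ())
  left_inv _ := rfl
  right_inv _ := rfl
  measurable_toFun := measurable_fst
  measurable_invFun := by simp only [Equiv.coe_fn_symm_mk]; fun_prop

@[simp] theorem inlSlot_apply (e : X × Y ≃ᵐ A) (x : X) (y : Y) (b : B) :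
    inlSlot B e (x, (y, b)) = (e (x, y), b) := rfl

@[simp] theorem inrSlot_apply (e : X × Y ≃ᵐ B) (x : X) (y : Y) (a : A) :
    inrSlot A e (x, (a, y)) = (a, e (x, y)) := rfl

theorem Splits.pi [Fintype ι] [DecidableEq ι] (s : ι) (m : ι → Measure X)
    (hm : ∀ t, SigmaFinite (m t)) :
    Splits (piSlot s) (fun r => Measure.pi (Function.update m s r))
      (Measure.pi fun t : {t : ι // t ≠ s} => m t) := by
  refine ⟨inferInstance, fun r hr => ?_⟩
  have : ∀ t, SigmaFinite (Function.update m s r t) := fun t => by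
    by_cases h : t = s
    · subst h; simpa using hr
    · simpa [h] using hm t
  refine (Measure.pi_eq fun S hS => ?_).symm
  rw [MeasurableEquiv.map_apply]
  have hpre : piSlot s ⁻¹' Set.univ.pi S =
      S s ×ˢ Set.univ.pi fun t : {t : ι // t ≠ s} => S t := by
    ext ⟨x, y⟩
    simp only [Set.mem_preimage, Set.mem_univ_pi, Set.mem_prod]
    constructor
    · intro h
      refine ⟨by simpa [piSlot] using h s, fun t => ?_⟩
      simpa [piSlot, t.2] using h t
    · rintro ⟨h1, h2⟩ t
      by_cases h : t = s
      · subst h; simpa [piSlot] using h1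
      · simpa [piSlot, h] using h2 ⟨t, h⟩
  rw [hpre, Measure.prod_prod, Measure.pi_pi, Fintype.prod_eq_mul_prod_subtype_ne _ s]
  simp only [Function.update_self]
  congr 1
  refine Finset.prod_congr rfl fun t _ => ?_
  rw [Function.update_of_ne t.2]

theorem Splits.inl {e : X × Y ≃ᵐ A} {m : Measure X → Measure A} {m₂ : Measure Y}
    (h : Splits e m m₂) (b : Measure B) [SigmaFinite b] :
    Splits (inlSlot B e) (fun r => (m r).prod b) (m₂.prod b) := by
  have := h.1
  refine ⟨inferInstance, fun r hr => ?_⟩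
  rw [← h.2 r hr]
  have h1 : (r.prod (m₂.prod b)).map MeasurableEquiv.prodAssoc.symm = (r.prod m₂).prod b :=
    ((measurePreserving_prodAssoc r m₂ b).symm).map_eq
  have h2 := Measure.map_prod_map (r.prod m₂) b e.measurable measurable_id
  rw [Measure.map_id] at h2
  rw [h2, ← h1, Measure.map_map (e.measurable.prodMap measurable_id)
    MeasurableEquiv.prodAssoc.symm.measurable]
  rfl

theorem Splits.inr {e : X × Y ≃ᵐ B} {m : Measure X → Measure B} {m₂ : Measure Y}
    (h : Splits e m m₂) (a : Measure A) [SigmaFinite a] :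
    Splits (inrSlot A e) (fun r => a.prod (m r)) (a.prod m₂) := by
  have := h.1
  refine ⟨inferInstance, fun r hr => ?_⟩
  rw [← h.2 r hr]
  have h1 := (measurePreserving_prodAssoc r a m₂).symm
  have h2 : MeasurePreserving (Prod.map Prod.swap id) ((r.prod a).prod m₂) ((a.prod r).prod m₂) :=
    Measure.measurePreserving_swap.prod (MeasurePreserving.id m₂)
  have h3 := measurePreserving_prodAssoc a r m₂
  have h4 : MeasurePreserving (Prod.map id e) (a.prod (r.prod m₂))
      (a.prod ((r.prod m₂).map e)) := by
    refine ⟨by fun_prop, ?_⟩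
    have := Measure.map_prod_map a (r.prod m₂) measurable_id e.measurable
    rw [Measure.map_id] at this
    exact this.symm
  exact (h4.comp (h3.comp (h2.comp h1))).map_eq

theorem Splits.unit : Splits (unitSlot (X := X)) (fun r => r) (Measure.dirac ()) := by
  refine ⟨inferInstance, fun r hr => ?_⟩
  have : (r.prod (Measure.dirac ())).map Prod.fst = r := by simp [Measure.map_fst_prod]
  exact this

end Splitting

/-! ### The position of each latent variable in the latent space -/

section Latent

def zSlot (i : Fin n) := inlSlot ((Fin n → Subtree K D) × (Inner K D → Fin K → ℝ) ×
  (Inner K D → ℝ) × (Node K D → Vec p) × (Node K D → Mat p) × Mat p) (piSlot (X := TreePath K D) i)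

def piFactorSlot (s : Inner K D) :=
  inrSlot (Fin n → TreePath K D) <| inrSlot (Fin n → Subtree K D) <|
    inlSlot ((Inner K D → ℝ) × (Node K D → Vec p) × (Node K D → Mat p) × Mat p)
      (piSlot (X := Fin K → ℝ) s)

def gSlot (K D p n : ℕ) :=
  inrSlot (Fin n → TreePath K D) <| inrSlot (Fin n → Subtree K D) <|
    inrSlot (Inner K D → Fin K → ℝ) <|
      inlSlot ((Node K D → Vec p) × (Node K D → Mat p) × Mat p) (unitSlot (X := Inner K D → ℝ))

def muSlot (s : Node K D) :=
  inrSlot (Fin n → TreePath K D) <| inrSlot (Fin n → Subtree K D) <|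
    inrSlot (Inner K D → Fin K → ℝ) <| inrSlot (Inner K D → ℝ) <|
      inlSlot ((Node K D → Mat p) × Mat p) (piSlot (X := Vec p) s)

def lambdaSlot (s : Node K D) :=
  inrSlot (Fin n → TreePath K D) <| inrSlot (Fin n → Subtree K D) <|
    inrSlot (Inner K D → Fin K → ℝ) <| inrSlot (Inner K D → ℝ) <| inrSlot (Node K D → Vec p) <|
      inlSlot (Mat p) (piSlot (X := Mat p) s)

def LSlot (K D p n : ℕ) :=
  inrSlot (Fin n → TreePath K D) <| inrSlot (Fin n → Subtree K D) <|
    inrSlot (Inner K D → Fin K → ℝ) <| inrSlot (Inner K D → ℝ) <| inrSlot (Node K D → Vec p) <|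
      inrSlot (Node K D → Mat p) (unitSlot (X := Mat p))

/-- The product of measures for all the latent variables. -/
def latentProd (mz : Fin n → Measure (TreePath K D)) (mT : Fin n → Measure (Subtree K D))
    (mπ : Inner K D → Measure (Fin K → ℝ)) (mg : Measure (Inner K D → ℝ))
    (mμ : Node K D → Measure (Vec p)) (mΛ : Node K D → Measure (Mat p)) (mL : Measure (Mat p)) :
    Measure (Latent K D p n) :=
  (Measure.pi mz).prod <| (Measure.pi mT).prod <| (Measure.pi mπ).prod <| mg.prod <|
    (Measure.pi mμ).prod <| (Measure.pi mΛ).prod mL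

variable {mz : Fin n → Measure (TreePath K D)} {mT : Fin n → Measure (Subtree K D)}
  {mπ : Inner K D → Measure (Fin K → ℝ)} {mg : Measure (Inner K D → ℝ)}
  {mμ : Node K D → Measure (Vec p)} {mΛ : Node K D → Measure (Mat p)} {mL : Measure (Mat p)}
  [∀ i, SigmaFinite (mz i)] [∀ i, SigmaFinite (mT i)] [∀ i, SigmaFinite (mπ i)] [SigmaFinite mg]
  [∀ i, SigmaFinite (mμ i)] [∀ i, SigmaFinite (mΛ i)] [SigmaFinite mL]

/-- This lemma and its companions are used twice, for the variational factors and for the base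
measures. The complementary measure is left existential since only its independence of the varying
factor matters. -/
theorem splits_z (i : Fin n) : ∃ m₂, Splits (zSlot i)
    (fun r => latentProd (Function.update mz i r) mT mπ mg mμ mΛ mL) m₂ :=
  ⟨_, (Splits.pi i mz inferInstance).inl ((Measure.pi mT).prod <| (Measure.pi mπ).prod <|
    mg.prod <| (Measure.pi mμ).prod <| (Measure.pi mΛ).prod mL)⟩

theorem splits_pi (s : Inner K D) : ∃ m₂, Splits (piFactorSlot s)
    (fun r => latentProd mz mT (Function.update mπ s r) mg mμ mΛ mL) m₂ :=
  ⟨_, (((Splits.pi s mπ inferInstance).inl (mg.prod <| (Measure.pi mμ).prod <|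
    (Measure.pi mΛ).prod mL)).inr (Measure.pi mT)).inr (Measure.pi mz)⟩

theorem splits_g : ∃ m₂, Splits (gSlot K D p n)
    (fun r => latentProd mz mT mπ r mμ mΛ mL) m₂ :=
  ⟨_, (((Splits.unit.inl ((Measure.pi mμ).prod <| (Measure.pi mΛ).prod mL)).inr
    (Measure.pi mπ)).inr (Measure.pi mT)).inr (Measure.pi mz)⟩

theorem splits_mu (s : Node K D) : ∃ m₂, Splits (muSlot s)
    (fun r => latentProd mz mT mπ mg (Function.update mμ s r) mΛ mL) m₂ :=
  ⟨_, (((((Splits.pi s mμ inferInstance).inl ((Measure.pi mΛ).prod mL)).inr mg).inr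
    (Measure.pi mπ)).inr (Measure.pi mT)).inr (Measure.pi mz)⟩

theorem splits_lambda (s : Node K D) : ∃ m₂, Splits (lambdaSlot s)
    (fun r => latentProd mz mT mπ mg mμ (Function.update mΛ s r) mL) m₂ :=
  ⟨_, ((((((Splits.pi s mΛ inferInstance).inl mL).inr (Measure.pi mμ)).inr mg).inr
    (Measure.pi mπ)).inr (Measure.pi mT)).inr (Measure.pi mz)⟩

theorem splits_L : ∃ m₂, Splits (LSlot K D p n)
    (fun r => latentProd mz mT mπ mg mμ mΛ r) m₂ :=
  ⟨_, (((((Splits.unit.inr (Measure.pi mΛ)).inr (Measure.pi mμ)).inr mg).inr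
    (Measure.pi mπ)).inr (Measure.pi mT)).inr (Measure.pi mz)⟩

end Latent

/-! ### Measurability and bounds for positive definite matrices -/

section MatrixFacts

instance instBorelSpaceMat (p : ℕ) : BorelSpace (Mat p) :=
  inferInstanceAs (BorelSpace (Fin p → Fin p → ℝ))

theorem measurable_entry (i j : Fin p) : Measurable fun A : Mat p => A i j :=
  (measurable_pi_apply j).comp (measurable_pi_apply (X := fun _ : Fin p => Fin p → ℝ) i)

theorem measurable_mat_iff {Ω : Type*} [MeasurableSpace Ω] {f : Ω → Mat p} :
    Measurable f ↔ ∀ i j, Measurable fun ω => f ω i j := by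
  constructor
  · intro h i j; exact (measurable_entry i j).comp h
  · intro h
    exact measurable_pi_iff.2 fun i => measurable_pi_iff.2 fun j => h i j

theorem measurable_det : Measurable fun A : Mat p => A.det := by
  simp only [Matrix.det_apply]
  fun_prop

@[fun_prop]
theorem measurable_trace_mul (B : Mat p) : Measurable fun A : Mat p => (B * A).trace := by
  simp only [Matrix.trace, Matrix.diag, Matrix.mul_apply]
  fun_prop

@[fun_prop]
theorem measurable_symMatrix : Measurable (symMatrix (p := p)) :=
  measurable_mat_iff.2 fun i j => by simp only [symMatrix, Matrix.of_apply]; fun_prop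

theorem posSemidef_iff_real {A : Mat p} :
    A.PosSemidef ↔ A.IsHermitian ∧ ∀ x : Vec p, 0 ≤ x ⬝ᵥ (A *ᵥ x) := by
  rw [Matrix.posSemidef_iff_dotProduct_mulVec]; simp

/-- Semidefiniteness is a closed condition, and a semidefinite matrix is definite exactly when its
determinant does not vanish. -/
theorem measurableSet_posDef : MeasurableSet {A : Mat p | A.PosDef} := by
  have h : {A : Mat p | A.PosDef} =
      ({A : Mat p | A.IsHermitian} ∩ ⋂ x : Vec p, {A : Mat p | 0 ≤ x ⬝ᵥ (A *ᵥ x)}) ∩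
        {A : Mat p | A.det ≠ 0} := by
    ext A
    simp only [Set.mem_ofPred_eq, Set.mem_inter_iff, Set.mem_iInter]
    rw [← posSemidef_iff_real]
    exact ⟨fun hA => ⟨hA.posSemidef, hA.det_pos.ne'⟩, fun ⟨h1, h2⟩ =>
      h1.posDef_iff_det_ne_zero.2 h2⟩
  rw [h]
  refine MeasurableSet.inter (IsClosed.inter ?_ (isClosed_iInter fun x => ?_)).measurableSet ?_
  · exact isClosed_eq (by fun_prop) continuous_id
  · exact isClosed_le continuous_const (by fun_prop)
  · exact measurable_det (measurableSet_singleton 0).compl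

open scoped MatrixOrder in
theorem exists_conjTranspose_mul_self {A : Mat p} (hA : A.PosSemidef) : ∃ S : Mat p, A = Sᴴ * S :=
  CStarAlgebra.nonneg_iff_eq_star_mul_self.1 hA.nonneg

/-- With B = Sᴴ S the trace is that of the semidefinite matrix S A Sᴴ. -/
theorem trace_mul_nonneg {A B : Mat p} (hA : A.PosSemidef) (hB : B.PosSemidef) :
    0 ≤ (A * B).trace := by
  obtain ⟨S, rfl⟩ := exists_conjTranspose_mul_self hB
  rw [← mul_assoc, Matrix.trace_mul_comm, ← mul_assoc]
  exact (hA.mul_mul_conjTranspose_same S).trace_nonneg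

theorem exists_pos_mul_dotProduct_le {B : Mat p} (hB : B.PosDef) :
    ∃ c : ℝ, 0 < c ∧ ∀ x : Vec p, c * (x ⬝ᵥ x) ≤ x ⬝ᵥ (B *ᵥ x) := by
  obtain ⟨S, hS⟩ := exists_conjTranspose_mul_self hB.posSemidef
  have hdet : S.det ≠ 0 := by
    intro h
    have := hB.det_pos
    rw [hS, Matrix.det_mul, h, mul_zero] at this
    exact lt_irrefl _ this
  -- By Cauchy–Schwarz the squared Frobenius norm of S⁻¹ bounds |x|² by |S x|² = xᵀ B x; the summand
  -- 1 keeps F positive even for p = 0.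
  set F : ℝ := 1 + ∑ i, ∑ j, (S⁻¹ i j) ^ 2 with hF
  have hFpos : 0 < F := by positivity
  refine ⟨F⁻¹, inv_pos.2 hFpos, fun x => ?_⟩
  have h1 : x ⬝ᵥ (B *ᵥ x) = (S *ᵥ x) ⬝ᵥ (S *ᵥ x) := by
    rw [hS, Matrix.conjTranspose_eq_transpose_of_trivial, ← Matrix.mulVec_mulVec,
      Matrix.dotProduct_mulVec, Matrix.vecMul_transpose]
  have h2 : x = S⁻¹ *ᵥ (S *ᵥ x) := by
    rw [Matrix.mulVec_mulVec, Matrix.nonsing_inv_mul _ (isUnit_iff_ne_zero.2 hdet),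
      Matrix.one_mulVec]
  rw [h1, inv_mul_le_iff₀ hFpos]
  set v := S *ᵥ x
  have h3 : x ⬝ᵥ x ≤ (∑ i, ∑ j, (S⁻¹ i j) ^ 2) * (v ⬝ᵥ v) := by
    conv_lhs => rw [h2]
    simp only [dotProduct, Matrix.mulVec, ← sq]
    rw [Finset.sum_mul]
    exact Finset.sum_le_sum fun i _ => Finset.sum_mul_sq_le_sq_mul_sq _ _ _
  have h4 : 0 ≤ v ⬝ᵥ v := by
    simp only [dotProduct]; exact Finset.sum_nonneg fun i _ => mul_self_nonneg _
  rw [hF]; linarith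

theorem exists_sub_smul_one_posDef {B : Mat p} (hB : B.PosDef) :
    ∃ c : ℝ, 0 < c ∧ (B - c • (1 : Mat p)).PosDef := by
  obtain ⟨c, hc, h⟩ := exists_pos_mul_dotProduct_le hB
  refine ⟨c / 2, by positivity, Matrix.posDef_iff_dotProduct_mulVec.2 ⟨?_, fun {x} hx => ?_⟩⟩
  · refine hB.isHermitian.sub ?_
    simp [Matrix.IsHermitian]
  · have hx2 : 0 < x ⬝ᵥ x := by
      have := Matrix.dotProduct_star_self_pos_iff.2 hx
      simpa using this
    have := h x
    simp only [star_trivial, Matrix.sub_mulVec, Matrix.smul_mulVec, Matrix.one_mulVec,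
      dotProduct_sub, dotProduct_smul, smul_eq_mul]
    nlinarith

theorem symMatrix_apply (y : {ij : Fin p × Fin p // ij.1 ≤ ij.2} → ℝ) (i j : Fin p) :
    symMatrix y i j = y ⟨(min i j, max i j), min_le_max⟩ := rfl

theorem symMatrix_isHermitian (y : {ij : Fin p × Fin p // ij.1 ≤ ij.2} → ℝ) :
    (symMatrix y).IsHermitian := by
  ext i j
  simp only [Matrix.conjTranspose_apply, star_trivial, symMatrix_apply]
  congr 2
  rw [min_comm, max_comm]

end MatrixFacts

/-! ### Finiteness of the Wishart integral by induction on the dimension -/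

section SchurReduction

/-- The unnormalized Wishart density, with exponent `a` and a rate `c`. -/
def coneFun (p : ℕ) (a c : ℝ) : Mat p → ℝ≥0∞ :=
  Set.indicator {Λ | Λ.PosDef} fun Λ => ENNReal.ofReal (Λ.det ^ a * Real.exp (-(c * Λ.trace)))

theorem measurable_coneFun (a c : ℝ) : Measurable (coneFun p a c) := by
  refine Measurable.indicator ?_ measurableSet_posDef
  have h1 := measurable_det (p := p)
  have h2 : Measurable fun A : Mat p => A.trace := by simpa using measurable_trace_mul (p := p) 1
  fun_prop

def splitIndex (p : ℕ) :
    (Unit ⊕ (Fin p ⊕ {ij : Fin p × Fin p // ij.1 ≤ ij.2})) ≃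
      {ij : Fin (p + 1) × Fin (p + 1) // ij.1 ≤ ij.2} :=
  Equiv.ofBijective
    (Sum.elim (fun _ => ⟨(0, 0), le_rfl⟩)
      (Sum.elim (fun j => ⟨(0, j.succ), Fin.zero_le _⟩)
        (fun ij => ⟨(ij.1.1.succ, ij.1.2.succ), Fin.succ_le_succ_iff.2 ij.2⟩))) <| by
    constructor
    · rintro (_ | j | ⟨⟨i, j⟩, h⟩) (_ | j' | ⟨⟨i', j'⟩, h'⟩) <;>
        simp [Fin.succ_ne_zero, (Fin.succ_ne_zero _).symm]
    · rintro ⟨⟨i, j⟩, h⟩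
      induction i using Fin.cases with
      | zero =>
        induction j using Fin.cases with
        | zero => exact ⟨Sum.inl (), rfl⟩
        | succ j => exact ⟨Sum.inr (Sum.inl j), rfl⟩
      | succ i =>
        induction j using Fin.cases with
        | zero => exact absurd h (by simp)
        | succ j => exact ⟨Sum.inr (Sum.inr ⟨(i, j), Fin.succ_le_succ_iff.1 h⟩), rfl⟩

/-- Splitting a symmetric matrix into its corner, the rest of its first row, and the rest. -/
def splitSym (p : ℕ) : (ℝ × (Fin p → ℝ) × ({ij : Fin p × Fin p // ij.1 ≤ ij.2} → ℝ)) ≃ᵐ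
    ({ij : Fin (p + 1) × Fin (p + 1) // ij.1 ≤ ij.2} → ℝ) :=
  (((MeasurableEquiv.funUnique Unit ℝ).symm.prodCongr
    (MeasurableEquiv.sumPiEquivProdPi
      (fun _ : Fin p ⊕ {ij : Fin p × Fin p // ij.1 ≤ ij.2} => ℝ)).symm).trans
    (MeasurableEquiv.sumPiEquivProdPi (fun _ => ℝ)).symm).trans
      (MeasurableEquiv.piCongrLeft (fun _ => ℝ) (splitIndex p))

theorem measurePreserving_splitSym (p : ℕ) : MeasurePreserving (splitSym p) := by
  have h1 := (volume_preserving_funUnique Unit ℝ).symm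
  have h2 := volume_measurePreserving_sumPiEquivProdPi_symm
    (fun _ : Fin p ⊕ {ij : Fin p × Fin p // ij.1 ≤ ij.2} => ℝ)
  have h3 := volume_measurePreserving_sumPiEquivProdPi_symm
    (fun _ : Unit ⊕ (Fin p ⊕ {ij : Fin p × Fin p // ij.1 ≤ ij.2}) => ℝ)
  have h4 := volume_measurePreserving_piCongrLeft (fun _ => ℝ) (splitIndex p)
  exact h4.comp (h3.comp (h1.prod h2))

theorem splitSym_apply (t : ℝ) (b : Fin p → ℝ) (y : {ij : Fin p × Fin p // ij.1 ≤ ij.2} → ℝ)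
    (k : Unit ⊕ (Fin p ⊕ {ij : Fin p × Fin p // ij.1 ≤ ij.2})) :
    splitSym p (t, b, y) (splitIndex p k) = Sum.elim (fun _ => t) (Sum.elim b y) k := by
  have : splitSym p (t, b, y) (splitIndex p k) =
      Equiv.piCongrLeft (fun _ => ℝ) (splitIndex p)
        ((MeasurableEquiv.sumPiEquivProdPi (fun _ => ℝ)).symm (fun _ => t,
          (MeasurableEquiv.sumPiEquivProdPi
      (fun _ : Fin p ⊕ {ij : Fin p × Fin p // ij.1 ≤ ij.2} => ℝ)).symm (b, y))) (splitIndex p k) := rfl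
  rw [this, Equiv.piCongrLeft_apply_apply]
  rcases k with _ | k | k <;> rfl

/-- The coordinates of the rank one matrix `b bᵀ / t`. -/
def rankOneShift (t : ℝ) (b : Fin p → ℝ) : {ij : Fin p × Fin p // ij.1 ≤ ij.2} → ℝ :=
  fun ij => b ij.1.1 * b ij.1.2 / t

/-- For M with corner t, first row b and remaining block Y, the Schur complement S = Y - b bᵀ / t
satisfies det M = t det S and tr M = t + tr S + |b|² / t, and S is positive definite with M. On such
M equality holds; elsewhere the left side is 0, and an upper bound is all that finiteness needs. -/
theorem coneFun_splitSym_le (a c t : ℝ) (b : Fin p → ℝ)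
    (y : {ij : Fin p × Fin p // ij.1 ≤ ij.2} → ℝ) :
    coneFun (p + 1) a c (symMatrix (splitSym p (t, b, y))) ≤
      Set.indicator (Set.Ioi 0) (fun t => ENNReal.ofReal (t ^ a * Real.exp (-(c * t)))) t *
        (ENNReal.ofReal (∏ j, Real.exp (-(c / t) * b j ^ 2)) *
          coneFun p a c (symMatrix (y - rankOneShift t b))) := by
  set M := symMatrix (splitSym p (t, b, y)) with hM
  by_cases hpd : M.PosDef
  swap
  · simp [coneFun, hpd]
  have hidx : ∀ k : Unit ⊕ (Fin p ⊕ {ij : Fin p × Fin p // ij.1 ≤ ij.2}),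
      ∀ i j, (splitIndex p k).1 = (min i j, max i j) →
        M i j = Sum.elim (fun _ => t) (Sum.elim b y) k := by
    intro k i j hk
    rw [← splitSym_apply, hM, symMatrix_apply]
    exact congrArg _ (Subtype.ext hk.symm)
  have h00 : M 0 0 = t := hidx (Sum.inl ()) 0 0 rfl
  have h0j : ∀ j, M 0 (Fin.succ j) = b j := fun j => hidx (Sum.inr (Sum.inl j)) _ _ (by
    rw [min_eq_left (Fin.zero_le _), max_eq_right (Fin.zero_le _)]; rfl)
  have hj0 : ∀ j, M (Fin.succ j) 0 = b j := fun j => hidx (Sum.inr (Sum.inl j)) _ _ (by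
    rw [min_eq_right (Fin.zero_le _), max_eq_left (Fin.zero_le _)]; rfl)
  have hij : ∀ i j, M (Fin.succ i) (Fin.succ j) = symMatrix y i j := fun i j =>
    hidx (Sum.inr (Sum.inr ⟨(min i j, max i j), min_le_max⟩)) _ _ (by
      rw [← Fin.strictMono_succ.monotone.map_min, ← Fin.strictMono_succ.monotone.map_max]; rfl)
  have ht : 0 < t := h00 ▸ hpd.diag_pos
  set S := symMatrix (y - rankOneShift t b) with hS
  have hSij : ∀ i j, S i j = symMatrix y i j - b i * b j / t := fun i j => by
    simp only [hS, symMatrix_apply, Pi.sub_apply, rankOneShift]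
    rcases le_total i j with h | h
    · simp [h]
    · simp [h, mul_comm]
  let f : Unit ⊕ Fin p ≃ Fin (p + 1) :=
    { toFun := Sum.elim (fun _ => 0) Fin.succ
      invFun := fun i => if h : i = 0 then Sum.inl () else Sum.inr (i.pred h)
      left_inv := by rintro (_ | j) <;> simp
      right_inv := fun i => by by_cases h : i = 0 <;> simp [h] }
  let A₁ : Matrix Unit Unit ℝ := Matrix.of fun _ _ => t
  let B₁ : Matrix Unit (Fin p) ℝ := Matrix.of fun _ j => b j
  have hblocks : M.submatrix f f = Matrix.fromBlocks A₁ B₁ B₁ᴴ (symMatrix y) := by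
    ext i j
    rcases i with _ | i <;> rcases j with _ | j
    · exact h00
    · exact h0j j
    · exact hj0 i
    · exact hij i j
  have hA₁inv : A₁⁻¹ = Matrix.of fun _ _ => t⁻¹ := by
    refine Matrix.inv_eq_right_inv ?_
    ext i j
    simp [A₁, Matrix.mul_apply, ht.ne']
  have hA₁ : A₁.PosDef := by
    have : A₁ = Matrix.diagonal fun _ => t := by ext i j; simp [A₁]
    rw [this]; exact Matrix.PosDef.diagonal fun _ => ht
  let : Invertible A₁ := hA₁.isUnit.invertible
  have hschur : symMatrix y - B₁ᴴ * A₁⁻¹ * B₁ = S := by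
    ext i j
    rw [hSij, Matrix.sub_apply]
    congr 1
    simp only [Matrix.mul_apply, hA₁inv, B₁, Matrix.conjTranspose_apply, star_trivial,
      Matrix.of_apply, Finset.univ_unique, Finset.sum_singleton]
    field_simp
  have hpd' : (M.submatrix f f).PosDef := hpd.submatrix f.injective
  have hdet : M.det = t * S.det := by
    rw [← Matrix.det_submatrix_equiv_self f M, hblocks, Matrix.det_fromBlocks₁₁,
      Matrix.invOf_eq_nonsing_inv, hschur]
    simp [A₁, Matrix.det_unique]
  have hSpd : S.PosDef := by
    have h1 : S.PosSemidef := by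
      rw [← hschur, ← Matrix.PosDef.fromBlocks₁₁ B₁ _ hA₁, ← hblocks]
      exact hpd'.posSemidef
    refine h1.posDef_iff_det_ne_zero.2 fun h => ?_
    have := hpd.det_pos
    rw [hdet, h, mul_zero] at this
    exact lt_irrefl _ this
  have htr : M.trace = t + (S.trace + (∑ j, b j ^ 2) / t) := by
    simp only [Matrix.trace, Matrix.diag]
    rw [Fin.sum_univ_succ, h00]
    congr 1
    simp only [hij, hSij, Finset.sum_sub_distrib, Finset.sum_div, sq]
    ring
  simp only [coneFun]
  rw [Set.indicator_of_mem (show M ∈ {Λ : Mat (p + 1) | Λ.PosDef} from hpd),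
    Set.indicator_of_mem (show S ∈ {Λ : Mat p | Λ.PosDef} from hSpd),
    Set.indicator_of_mem (show t ∈ Set.Ioi (0 : ℝ) from ht),
    ← ENNReal.ofReal_mul (Finset.prod_nonneg fun _ _ => (Real.exp_pos _).le),
    ← ENNReal.ofReal_mul (by positivity)]
  refine le_of_eq (congrArg _ ?_)
  rw [hdet, Real.mul_rpow ht.le hSpd.det_pos.le, htr, ← Real.exp_sum, ← Finset.mul_sum]
  have : Real.exp (-(c * (t + (S.trace + (∑ j, b j ^ 2) / t)))) =
      Real.exp (-(c * t)) * (Real.exp (-(c / t) * ∑ j, b j ^ 2) * Real.exp (-(c * S.trace))) := by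
    rw [← Real.exp_add, ← Real.exp_add]; congr 1; field_simp; ring
  rw [this]; ring

theorem lintegral_prod_exp_neg_mul_sq {c : ℝ} (hc : 0 < c) :
    ∫⁻ b : Fin p → ℝ, ENNReal.ofReal (∏ j, Real.exp (-c * b j ^ 2)) =
      ENNReal.ofReal (Real.sqrt (Real.pi / c) ^ p) := by
  have hint : Integrable (fun b : Fin p → ℝ => ∏ j, Real.exp (-c * b j ^ 2)) :=
    Integrable.fintype_prod (f := fun _ u => Real.exp (-c * u ^ 2))
      fun _ => integrable_exp_neg_mul_sq hc
  rw [← ofReal_integral_eq_lintegral_ofReal hint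
    (ae_of_all _ fun b => Finset.prod_nonneg fun _ _ => (Real.exp_pos _).le)]
  rw [integral_fintype_prod_volume_eq_prod (fun (_ : Fin p) u => Real.exp (-c * u ^ 2))]
  simp only [integral_gaussian, Finset.prod_const, Finset.card_univ, Fintype.card_fin]

/-- Each dimension is peeled off in the Schur coordinates (t, b, S): S gives the integral of the
previous dimension, b a Gaussian integral, and t a Gamma integral. -/
theorem lintegral_coneFun_lt_top {a c : ℝ} (ha : -1 < a) (hc : 0 < c) :
    ∀ p : ℕ, ∫⁻ y, coneFun p a c (symMatrix y) < ∞ := by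
  intro p
  induction p with
  | zero =>
    have : ∀ y, coneFun 0 a c (symMatrix y) ≤ 1 := fun y => by
      refine Set.indicator_le_self' (fun _ _ => zero_le) _ |>.trans ?_
      simp
    refine (lintegral_mono this).trans_lt ?_
    simp
  | succ p ih =>
    rw [← (measurePreserving_splitSym p).lintegral_comp
      (f := fun y => coneFun (p + 1) a c (symMatrix y))
      ((measurable_coneFun a c).comp measurable_symMatrix)]
    refine (lintegral_mono (g := fun z => Set.indicator (Set.Ioi 0)
        (fun t => ENNReal.ofReal (t ^ a * Real.exp (-(c * t)))) z.1 *
        (ENNReal.ofReal (∏ j, Real.exp (-(c / z.1) * z.2.1 j ^ 2)) *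
          coneFun p a c (symMatrix (z.2.2 - rankOneShift z.1 z.2.1))))
        fun z => coneFun_splitSym_le a c z.1 z.2.1 z.2.2).trans_lt ?_
    have hcone := measurable_coneFun (p := p) a c
    have hm1 : Measurable (Set.indicator (Set.Ioi (0 : ℝ))
        (fun t => ENNReal.ofReal (t ^ a * Real.exp (-(c * t))))) :=
      Measurable.indicator (by fun_prop) measurableSet_Ioi
    have hshift : Measurable fun z : ℝ × (Fin p → ℝ) × ({ij : Fin p × Fin p // ij.1 ≤ ij.2} → ℝ) =>
        coneFun p a c (symMatrix (z.2.2 - rankOneShift z.1 z.2.1)) := by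
      refine hcone.comp (measurable_symMatrix.comp ?_)
      refine measurable_pi_iff.2 fun ij => ?_
      simp only [Pi.sub_apply, rankOneShift]
      fun_prop
    rw [Measure.volume_eq_prod, lintegral_prod _ (by fun_prop)]
    -- At fixed t and b the passage from Y to S is a translation, which preserves Lebesgue measure.
    -- The Gaussian integral in b has rate c / t and contributes a multiple of t^(p/2).
    have hinner : ∀ t : ℝ, ∫⁻ w : (Fin p → ℝ) × ({ij : Fin p × Fin p // ij.1 ≤ ij.2} → ℝ),
        Set.indicator (Set.Ioi 0) (fun t => ENNReal.ofReal (t ^ a * Real.exp (-(c * t)))) t *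
          (ENNReal.ofReal (∏ j, Real.exp (-(c / t) * w.1 j ^ 2)) *
            coneFun p a c (symMatrix (w.2 - rankOneShift t w.1))) =
        (∫⁻ y, coneFun p a c (symMatrix y)) * (Set.indicator (Set.Ioi 0) (fun t =>
          ENNReal.ofReal (t ^ a * Real.exp (-(c * t)) * Real.sqrt (Real.pi / (c / t)) ^ p)) t) := by
      intro t
      by_cases ht : t ∈ Set.Ioi (0 : ℝ)
      swap
      · simp [ht]
      have ht' : (0 : ℝ) < t := ht
      simp only [Set.indicator_of_mem ht]
      have hsh : Measurable fun w : (Fin p → ℝ) × ({ij : Fin p × Fin p // ij.1 ≤ ij.2} → ℝ) =>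
          coneFun p a c (symMatrix (w.2 - rankOneShift t w.1)) :=
        hshift.comp (g := fun z : ℝ × (Fin p → ℝ) × ({ij : Fin p × Fin p // ij.1 ≤ ij.2} → ℝ) =>
          coneFun p a c (symMatrix (z.2.2 - rankOneShift z.1 z.2.1))) (f := fun w => (t, w))
          (by fun_prop)
      rw [lintegral_const_mul' _ _ (by simp), Measure.volume_eq_prod,
        lintegral_prod _ (by fun_prop)]
      have : ∀ b : Fin p → ℝ, ∫⁻ y, ENNReal.ofReal (∏ j, Real.exp (-(c / t) * b j ^ 2)) *
            coneFun p a c (symMatrix (y - rankOneShift t b)) =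
          ENNReal.ofReal (∏ j, Real.exp (-(c / t) * b j ^ 2)) *
            ∫⁻ y, coneFun p a c (symMatrix y) := fun b => by
        rw [lintegral_const_mul' _ _ (by simp),
          lintegral_sub_right_eq_self (fun y => coneFun p a c (symMatrix y))]
      simp only [this]
      rw [lintegral_mul_const _ (by fun_prop), lintegral_prod_exp_neg_mul_sq (by positivity),
        ENNReal.ofReal_mul (p := t ^ a * Real.exp (-(c * t))) (by positivity)]
      ring
    simp only [hinner]
    rw [lintegral_const_mul' _ _ ih.ne]
    refine ENNReal.mul_lt_top ih ?_
    rw [lintegral_indicator measurableSet_Ioi]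
    -- The surviving integral in t is of Gamma type, and its exponent a + p/2 still exceeds -1.
    have hint : IntegrableOn (fun t : ℝ => t ^ (a + p / 2) * Real.exp (-c * t ^ (1 : ℝ)))
        (Set.Ioi 0) := integrableOn_rpow_mul_exp_neg_mul_rpow
          (by have : (0 : ℝ) ≤ p / 2 := by positivity
              linarith) one_pos hc
    have hint2 := hint.const_mul (Real.sqrt (Real.pi / c) ^ p)
    refine lt_of_le_of_lt (le_of_eq ?_) hint2.lintegral_lt_top
    refine setLIntegral_congr_fun measurableSet_Ioi fun t ht => ?_
    have ht' : (0 : ℝ) < t := ht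
    congr 1
    have e1 : Real.pi / (c / t) = Real.pi / c * t := by field_simp
    rw [e1, Real.sqrt_mul (by positivity), mul_pow, Real.rpow_add ht', Real.rpow_one,
      Real.sqrt_eq_rpow t, ← Real.rpow_natCast (t ^ (1 / 2 : ℝ)), ← Real.rpow_mul ht'.le]
    have : (1 / 2 : ℝ) * p = p / 2 := by ring
    rw [this]
    have : -(c * t) = -c * t := by ring
    rw [this]
    ring

end SchurReduction

/-! ### Wishart laws: normalization, conjugacy, moments -/

section Wishart

/-- Lebesgue measure on the symmetric matrices. -/
def symVolume (p : ℕ) : Measure (Mat p) := Measure.map symMatrix volume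

/-- Some B - c I with c > 0 is positive definite, so tr(B Λ) ≥ c tr Λ and the integrand is dominated
by the isotropic one. -/
theorem lintegral_posDef_lt_top {a : ℝ} (ha : -1 < a) {B : Mat p} (hB : B.PosDef) :
    ∫⁻ Λ, Set.indicator {Λ : Mat p | Λ.PosDef} (fun Λ => ENNReal.ofReal
      (Λ.det ^ a * Real.exp (-(1 / 2) * (B * Λ).trace))) Λ ∂(symVolume p) < ∞ := by
  obtain ⟨c, hc, hBc⟩ := exists_sub_smul_one_posDef hB
  have hmono : ∀ Λ : Mat p, Set.indicator {Λ : Mat p | Λ.PosDef} (fun Λ => ENNReal.ofReal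
      (Λ.det ^ a * Real.exp (-(1 / 2) * (B * Λ).trace))) Λ ≤ coneFun p a (c / 2) Λ := by
    intro Λ
    refine Set.indicator_le_indicator' fun hΛ => ?_
    have hΛ' : Λ.PosDef := hΛ
    refine ENNReal.ofReal_le_ofReal (mul_le_mul_of_nonneg_left (Real.exp_le_exp.2 ?_)
      (Real.rpow_nonneg hΛ'.det_pos.le _))
    have := trace_mul_nonneg hBc.posSemidef hΛ'.posSemidef
    rw [Matrix.sub_mul, Matrix.trace_sub, Matrix.smul_mul, Matrix.one_mul, Matrix.trace_smul,
      smul_eq_mul] at this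
    linarith
  refine (lintegral_mono hmono).trans_lt ?_
  rw [symVolume, lintegral_map (measurable_coneFun _ _) measurable_symMatrix]
  exact lintegral_coneFun_lt_top ha (by positivity) p

/-- Entrywise errors of 1/(p+1) change the quadratic form by at most (∑ |x_i|)² / (p+1) ≤ p |x|² /
(p+1), which is less than |x|². Thus the positive definite matrices contain a ball in the
coordinates, and the Wishart mass is nonzero. -/
theorem posDef_symMatrix_of_near_one {y : {ij : Fin p × Fin p // ij.1 ≤ ij.2} → ℝ}
    (hy : ∀ ij, |y ij - (if ij.1.1 = ij.1.2 then 1 else 0)| ≤ 1 / (p + 1)) :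
    (symMatrix y).PosDef := by
  refine Matrix.posDef_iff_dotProduct_mulVec.2 ⟨symMatrix_isHermitian y, fun {x} hx => ?_⟩
  rw [star_trivial]
  have hx2 : 0 < x ⬝ᵥ x := by
    have := Matrix.dotProduct_star_self_pos_iff.2 hx
    simpa using this
  have hE : ∀ i j, |symMatrix y i j - (1 : Mat p) i j| ≤ 1 / (p + 1) := fun i j => by
    have := hy ⟨(min i j, max i j), min_le_max⟩
    have hiff : (min i j = max i j) = (i = j) := by
      rcases le_total i j with h | h
      · rw [min_eq_left h, max_eq_right h]
      · rw [min_eq_right h, max_eq_left h]; exact propext eq_comm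
    simp only [hiff] at this
    rwa [symMatrix_apply, Matrix.one_apply]
  have h1 : x ⬝ᵥ (symMatrix y *ᵥ x) = x ⬝ᵥ x + x ⬝ᵥ ((symMatrix y - 1) *ᵥ x) := by
    rw [Matrix.sub_mulVec, Matrix.one_mulVec, dotProduct_sub]; ring
  have h2 : |x ⬝ᵥ ((symMatrix y - 1) *ᵥ x)| ≤ 1 / (p + 1) * (∑ i, |x i|) ^ 2 := by
    simp only [dotProduct, Matrix.mulVec, Finset.mul_sum]
    refine (Finset.abs_sum_le_sum_abs _ _).trans ?_
    rw [sq, Finset.sum_mul_sum, Finset.mul_sum]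
    refine Finset.sum_le_sum fun i _ => (Finset.abs_sum_le_sum_abs _ _).trans ?_
    rw [Finset.mul_sum]
    refine Finset.sum_le_sum fun j _ => ?_
    rw [abs_mul, abs_mul]
    have := hE i j
    rw [← Matrix.sub_apply] at this
    calc |x i| * (|(symMatrix y - 1) i j| * |x j|)
        ≤ |x i| * (1 / (p + 1) * |x j|) := by gcongr
      _ = _ := by ring
  have h3 : (∑ i, |x i|) ^ 2 ≤ p * (x ⬝ᵥ x) := by
    have := sq_sum_le_card_mul_sum_sq (s := Finset.univ) (f := fun i => |x i|)
    simpa [dotProduct, sq] using this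
  have h4 : 1 / ((p : ℝ) + 1) * (∑ i, |x i|) ^ 2 < x ⬝ᵥ x := by
    rw [div_mul_eq_mul_div, one_mul, div_lt_iff₀ (by positivity)]
    nlinarith
  rw [h1]
  linarith [neg_abs_le (x ⬝ᵥ ((symMatrix y - 1) *ᵥ x))]

theorem symVolume_posDef_pos : 0 < symVolume p {Λ | Λ.PosDef} := by
  rw [symVolume, Measure.map_apply measurable_symMatrix measurableSet_posDef]
  set y₀ : {ij : Fin p × Fin p // ij.1 ≤ ij.2} → ℝ := fun ij => if ij.1.1 = ij.1.2 then 1 else 0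
  refine lt_of_lt_of_le (Metric.measure_closedBall_pos volume y₀
    (r := 1 / ((p : ℝ) + 1)) (by positivity)) (measure_mono fun y hy => ?_)
  refine posDef_symMatrix_of_near_one fun ij => ?_
  have := (dist_pi_le_iff (by positivity)).1 (Metric.mem_closedBall.1 hy) ij
  simpa [Real.dist_eq] using this

theorem measurable_wishartDensity (a : ℝ) (B : Mat p) :
    Measurable (Set.indicator {Λ : Mat p | Λ.PosDef} fun Λ => ENNReal.ofReal
      (Λ.det ^ a * Real.exp (-(1 / 2) * (B * Λ).trace))) := by
  refine Measurable.indicator ?_ measurableSet_posDef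
  have h1 := measurable_det (p := p)
  fun_prop

theorem wishart_mass_ne_zero (a : ℝ) (B : Mat p) :
    (symVolume p).withDensity (Set.indicator {Λ | Λ.PosDef} fun Λ => ENNReal.ofReal
      (Λ.det ^ a * Real.exp (-(1 / 2) * (B * Λ).trace))) Set.univ ≠ 0 := by
  rw [withDensity_apply _ MeasurableSet.univ, Measure.restrict_univ,
    lintegral_indicator measurableSet_posDef]
  refine (setLIntegral_pos_iff ?_).2 ?_ |>.ne'
  · have h1 := measurable_det (p := p)
    fun_prop
  · refine lt_of_lt_of_le symVolume_posDef_pos (measure_mono fun Λ hΛ => ⟨?_, hΛ⟩)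
    have hΛ' : Λ.PosDef := hΛ
    have := Real.rpow_pos_of_pos hΛ'.det_pos a
    simp only [Function.mem_support, ne_eq, ENNReal.ofReal_eq_zero, not_le]
    positivity

theorem wishart_mass_ne_top {a : ℝ} (ha : -1 < a) {B : Mat p} (hB : B.PosDef) :
    (symVolume p).withDensity (Set.indicator {Λ | Λ.PosDef} fun Λ => ENNReal.ofReal
      (Λ.det ^ a * Real.exp (-(1 / 2) * (B * Λ).trace))) Set.univ ≠ ∞ := by
  rw [withDensity_apply _ MeasurableSet.univ, Measure.restrict_univ]
  exact (lintegral_posDef_lt_top ha hB).ne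

/-- The bound on the degrees of freedom is the exponent condition of the cone integral. -/
theorem wishart_exponent {ν : ℝ} (hν : (p : ℝ) - 1 < ν) : -1 < (ν - p - 1) / 2 := by linarith

theorem isProbabilityMeasure_wishart {ν : ℝ} (hν : (p : ℝ) - 1 < ν) {W : Mat p} (hW : W.PosDef) :
    IsProbabilityMeasure (wishartMeasure ν W) :=
  isProbabilityMeasure_normalized (wishart_mass_ne_zero _ _)
    (wishart_mass_ne_top (wishart_exponent hν) hW.inv)

/-- The Wishart distribution with its normalizing constant in the exponent. -/
theorem exists_wishart_eq {ν : ℝ} (hν : (p : ℝ) - 1 < ν) {W : Mat p} (hW : W.PosDef) :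
    ∃ c : ℝ, wishartMeasure ν W = (symVolume p).withDensity
      (Set.indicator {Λ | Λ.PosDef} fun Λ => ENNReal.ofReal (Real.exp
        ((ν - p - 1) / 2 * Real.log Λ.det - 1 / 2 * (W⁻¹ * Λ).trace - c))) := by
  set m := (symVolume p).withDensity (Set.indicator {Λ | Λ.PosDef} fun Λ => ENNReal.ofReal
      (Λ.det ^ ((ν - p - 1) / 2) * Real.exp (-(1 / 2) * (W⁻¹ * Λ).trace))) with hm
  have h0 : m Set.univ ≠ 0 := wishart_mass_ne_zero _ _
  have htop : m Set.univ ≠ ∞ := wishart_mass_ne_top (wishart_exponent hν) hW.inv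
  have hpos := ENNReal.toReal_pos h0 htop
  refine ⟨Real.log (m Set.univ).toReal, ?_⟩
  change normalized m = _
  rw [normalized]
  conv_lhs => rw [hm]
  rw [← withDensity_smul _ (measurable_wishartDensity _ _)]
  congr 1
  ext Λ
  simp only [Pi.smul_apply, smul_eq_mul]
  by_cases hΛ : Λ ∈ {Λ : Mat p | Λ.PosDef}
  swap
  · simp [hΛ]
  have hΛ' : Λ.PosDef := hΛ
  rw [Set.indicator_of_mem hΛ, Set.indicator_of_mem hΛ, Real.exp_sub, Real.exp_log hpos,
    ENNReal.ofReal_div_of_pos hpos, ENNReal.ofReal_toReal htop, ENNReal.div_eq_inv_mul, ← hm,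
    Real.rpow_def_of_pos hΛ'.det_pos, ← Real.exp_add]
  congr 3; ring

theorem ae_posDef_wishart {ν : ℝ} (hν : (p : ℝ) - 1 < ν) {W : Mat p} (hW : W.PosDef) :
    ∀ᵐ Λ ∂(wishartMeasure ν W), Λ.PosDef := by
  obtain ⟨c, hc⟩ := exists_wishart_eq hν hW
  rw [hc, withDensity_indicator measurableSet_posDef]
  exact (withDensity_absolutelyContinuous _ _).ae_le (ae_restrict_mem measurableSet_posDef)

theorem measurable_logDet : Measurable fun Λ : Mat p => Real.log Λ.det :=
  Real.measurable_log.comp measurable_det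

/-- Multiplying a Wishart density by `det Λ ^ (κ / 2) exp (- tr (Δ Λ) / 2)`. -/
theorem exists_wishart_tilt {ν : ℝ} (hν : (p : ℝ) - 1 < ν) {W : Mat p} (hW : W.PosDef) {κ : ℝ}
    (hκ : 0 ≤ κ) {Δ : Mat p} (hΔ : Δ.PosSemidef) :
    ∃ c : ℝ, wishartMeasure (ν + κ) (W⁻¹ + Δ)⁻¹ = (wishartMeasure ν W).withDensity fun Λ =>
      ENNReal.ofReal (Real.exp (κ / 2 * Real.log Λ.det - 1 / 2 * (Δ * Λ).trace - c)) := by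
  have hWΔ : (W⁻¹ + Δ).PosDef := hW.inv.add_posSemidef hΔ
  obtain ⟨c₁, h₁⟩ := exists_wishart_eq (ν := ν + κ) (by linarith) hWΔ.inv
  obtain ⟨c₂, h₂⟩ := exists_wishart_eq hν hW
  have hlog := measurable_logDet (p := p)
  refine ⟨c₁ - c₂, ?_⟩
  rw [h₁, h₂, Matrix.nonsing_inv_nonsing_inv _ (isUnit_iff_ne_zero.2 hWΔ.det_pos.ne'),
    ← withDensity_mul _ (Measurable.indicator (by fun_prop) measurableSet_posDef) (by fun_prop)]
  congr 1
  ext Λ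
  by_cases hΛ : Λ ∈ {Λ : Mat p | Λ.PosDef}
  swap
  · simp [hΛ]
  rw [Pi.mul_apply, Set.indicator_of_mem hΛ, Set.indicator_of_mem hΛ,
    ← ENNReal.ofReal_mul (Real.exp_pos _).le, ← Real.exp_add, Matrix.add_mul, Matrix.trace_add]
  congr 2; ring

/-- The integrand merely shifts the determinant exponent by k and the rate matrix from W⁻¹ to W⁻¹ -
B, so the finiteness of the cone integral applies again. -/
theorem lintegral_wishart_lt_top {ν : ℝ} {W : Mat p}
    {k : ℝ} (hk : -1 < (ν - p - 1) / 2 + k) {B : Mat p} (hB : (W⁻¹ - B).PosDef) :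
    ∫⁻ Λ, ENNReal.ofReal (Λ.det ^ k * Real.exp (1 / 2 * (B * Λ).trace)) ∂(wishartMeasure ν W)
      < ∞ := by
  have h1 := measurable_det (p := p)
  rw [wishartMeasure, normalized, lintegral_smul_measure]
  refine ENNReal.mul_lt_top ?_ ?_
  · rw [ENNReal.inv_lt_top]; exact pos_iff_ne_zero.2 (wishart_mass_ne_zero _ _)
  rw [lintegral_withDensity_eq_lintegral_mul _ (measurable_wishartDensity _ _) (by fun_prop)]
  refine lt_of_le_of_lt (le_of_eq (lintegral_congr fun Λ => ?_)) (lintegral_posDef_lt_top hk hB)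
  by_cases hΛ : Λ ∈ {Λ : Mat p | Λ.PosDef}
  swap
  · simp [hΛ]
  have hΛ' : Λ.PosDef := hΛ
  have := Real.rpow_pos_of_pos hΛ'.det_pos ((ν - p - 1) / 2)
  rw [Pi.mul_apply, Set.indicator_of_mem hΛ, Set.indicator_of_mem hΛ,
    ← ENNReal.ofReal_mul (by positivity), Real.rpow_add hΛ'.det_pos, Matrix.sub_mul,
    Matrix.trace_sub]
  have e : Real.exp (-(1 / 2) * ((W⁻¹ * Λ).trace - (B * Λ).trace)) =
      Real.exp (-(1 / 2) * (W⁻¹ * Λ).trace) * Real.exp (1 / 2 * (B * Λ).trace) := by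
    rw [← Real.exp_add]; congr 1; ring
  rw [e]; congr 1; ring

/-- The inequality 1 + t ≤ exp t at t = ± δ log x. It reduces integrability of a logarithm to small
positive and negative powers. -/
theorem abs_log_le_rpow_add {δ : ℝ} (hδ : 0 < δ) {x : ℝ} (hx : 0 < x) :
    |Real.log x| ≤ (x ^ δ + x ^ (-δ)) / δ := by
  have h1 := Real.add_one_le_exp (δ * Real.log x)
  have h2 := Real.add_one_le_exp (-(δ * Real.log x))
  have h3 : x ^ δ = Real.exp (δ * Real.log x) := by rw [Real.rpow_def_of_pos hx, mul_comm]
  have h4 : x ^ (-δ) = Real.exp (-(δ * Real.log x)) := by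
    rw [Real.rpow_def_of_pos hx]; congr 1; ring
  have h5 := Real.exp_pos (δ * Real.log x)
  have h6 := Real.exp_pos (-(δ * Real.log x))
  rw [le_div_iff₀ hδ, h3, h4]
  rcases abs_cases (Real.log x) with ⟨h, _⟩ | ⟨h, _⟩ <;> rw [h] <;> nlinarith

theorem integrable_logDet_wishart {ν : ℝ} (hν : (p : ℝ) - 1 < ν) {W : Mat p} (hW : W.PosDef) :
    Integrable (fun Λ => Real.log Λ.det) (wishartMeasure ν W) := by
  -- Half of the distance of the exponent (ν - p - 1)/2 from -1, so that det^(-δ) is still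
  -- integrable.
  set δ : ℝ := (ν - (p - 1)) / 4 with hδ
  have hδpos : 0 < δ := by rw [hδ]; linarith
  have hdet := measurable_det (p := p)
  have hpow : ∀ k : ℝ, -1 < (ν - p - 1) / 2 + k →
      Integrable (fun Λ : Mat p => Λ.det ^ k) (wishartMeasure ν W) := by
    intro k hk
    have h := lintegral_wishart_lt_top hk (B := 0) (by simpa using hW.inv)
    refine ⟨(by fun_prop : Measurable _).aestronglyMeasurable, ?_⟩
    rw [hasFiniteIntegral_iff_enorm]
    refine lt_of_le_of_lt (lintegral_mono_ae ?_) h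
    filter_upwards [ae_posDef_wishart hν hW] with Λ hΛ
    rw [Real.enorm_of_nonneg (Real.rpow_nonneg hΛ.det_pos.le _)]
    simp
  refine (((hpow δ (by linarith)).add (hpow (-δ) (by rw [hδ]; linarith))).div_const δ).mono'
    measurable_logDet.aestronglyMeasurable ?_
  filter_upwards [ae_posDef_wishart hν hW] with Λ hΛ
  exact abs_log_le_rpow_add hδpos hΛ.det_pos

end Wishart

/-! ### Densities and independence for finite products -/

section PiMeasure

variable {ι : Type*} [Fintype ι] {X : ι → Type*} [∀ i, MeasurableSpace (X i)]

/-- On a box the indicator distributes over the product, and Fubini for products of integrable real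
functions gives the product of the masses. -/
theorem pi_withDensity_ofReal (m : ∀ i, Measure (X i)) [∀ i, SigmaFinite (m i)]
    {f : ∀ i, X i → ℝ} (hf0 : ∀ i x, 0 ≤ f i x)
    (hfi : ∀ i, Integrable (f i) (m i)) :
    Measure.pi (fun i => (m i).withDensity fun x => ENNReal.ofReal (f i x)) =
      (Measure.pi m).withDensity fun x => ENNReal.ofReal (∏ i, f i (x i)) := by
  refine Measure.pi_eq fun S hS => ?_
  have hind : ∀ i, Integrable ((S i).indicator (f i)) (m i) := fun i => (hfi i).indicator (hS i)
  rw [withDensity_apply _ (MeasurableSet.univ_pi hS), ← lintegral_indicator (MeasurableSet.univ_pi hS)]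
  have e1 : ∀ x : ∀ i, X i, (Set.univ.pi S).indicator
      (fun x => ENNReal.ofReal (∏ i, f i (x i))) x =
      ENNReal.ofReal (∏ i, (S i).indicator (f i) (x i)) := by
    intro x
    by_cases hx : x ∈ Set.univ.pi S
    · rw [Set.indicator_of_mem hx]
      congr 1
      refine Finset.prod_congr rfl fun i _ => ?_
      rw [Set.indicator_of_mem (hx i (Set.mem_univ i))]
    · rw [Set.indicator_of_notMem hx]
      simp only [Set.mem_univ_pi, not_forall] at hx
      obtain ⟨i, hi⟩ := hx
      rw [Finset.prod_eq_zero (Finset.mem_univ i) (by rw [Set.indicator_of_notMem hi])]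
      simp
  have hnn : ∀ i x, 0 ≤ (S i).indicator (f i) x := fun i x =>
    Set.indicator_nonneg (fun x _ => hf0 i x) x
  simp_rw [e1]
  rw [← ofReal_integral_eq_lintegral_ofReal (Integrable.fintype_prod_dep hind)
    (ae_of_all _ fun x => Finset.prod_nonneg fun i _ => hnn i _),
    integral_fintype_prod_eq_prod, ENNReal.ofReal_prod_of_nonneg fun i _ =>
      integral_nonneg (hnn i)]
  refine Finset.prod_congr rfl fun i _ => ?_
  rw [ofReal_integral_eq_lintegral_ofReal (hind i) (ae_of_all _ (hnn i)),
    withDensity_apply _ (hS i), ← lintegral_indicator (hS i)]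
  refine lintegral_congr fun x => ?_
  by_cases hx : x ∈ S i <;> simp [hx]

variable {m : ∀ i, Measure (X i)} [∀ i, IsProbabilityMeasure (m i)]

theorem indepFun_pi_eval {s t : ι} (hst : s ≠ t) {f : X s → ℝ} {g : X t → ℝ}
    (hf : Measurable f) (hg : Measurable g) :
    IndepFun (fun x : ∀ i, X i => f (x s)) (fun x => g (x t)) (Measure.pi m) := by
  have h := iIndepFun_pi (μ := m) (X := fun i (x : X i) => x) (fun i => aemeasurable_id)
  exact (h.indepFun hst).comp hf hg

theorem integrable_pi_mul_of_ne {s t : ι} (hst : s ≠ t) {f : X s → ℝ} {g : X t → ℝ}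
    (hf : Measurable f) (hg : Measurable g) (hfi : Integrable f (m s)) (hgi : Integrable g (m t)) :
    Integrable (fun x => f (x s) * g (x t)) (Measure.pi m) :=
  (indepFun_pi_eval hst hf hg).integrable_mul (integrable_comp_eval hfi) (integrable_comp_eval hgi)

theorem integral_pi_mul_of_ne {s t : ι} (hst : s ≠ t) {f : X s → ℝ} {g : X t → ℝ}
    (hf : Measurable f) (hg : Measurable g) :
    ∫ x, f (x s) * g (x t) ∂(Measure.pi m) = (∫ x, f x ∂(m s)) * ∫ x, g x ∂(m t) := by
  rw [(indepFun_pi_eval hst hf hg).integral_fun_mul_eq_mul_integral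
    (hf.comp (measurable_pi_apply s)).aestronglyMeasurable
    (hg.comp (measurable_pi_apply t)).aestronglyMeasurable,
    integral_comp_eval hf.aestronglyMeasurable, integral_comp_eval hg.aestronglyMeasurable]

end PiMeasure

/-! ### Gaussian measures given by their precision matrix -/

section Gaussian

theorem measurable_mulVec (A : Mat p) : Measurable fun x : Vec p => A *ᵥ x := by
  refine measurable_pi_iff.2 fun i => ?_
  simp only [Matrix.mulVec, dotProduct]
  fun_prop

theorem map_mulVec_sub_volume {S : Mat p} (hS : S.det ≠ 0) (m : Vec p) :
    Measure.map (fun x : Vec p => S *ᵥ (x - m)) volume = ENNReal.ofReal |S.det⁻¹| • volume := by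
  have h1 := Real.map_matrix_volume_pi_eq_smul_volume_pi hS
  have h2 : Measure.map (fun x : Vec p => x - m) volume = volume :=
    (measurePreserving_sub_right volume m).map_eq
  rw [← h1]
  conv_rhs => rw [← h2]
  exact (Measure.map_map (measurable_mulVec S) (by fun_prop)).symm

/-- The standard Gaussian measure. -/
theorem pi_gaussianReal_eq : Measure.pi (fun _ : Fin p => gaussianReal 0 1) =
    volume.withDensity fun x => ENNReal.ofReal (∏ i, gaussianPDFReal 0 1 (x i)) := by
  have h := pi_withDensity_ofReal (fun _ : Fin p => (volume : Measure ℝ))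
    (f := fun _ => gaussianPDFReal 0 1)
    (fun _ x => gaussianPDFReal_nonneg 0 1 x) (fun _ => integrable_gaussianPDFReal 0 1)
  rw [volume_pi, ← h]
  congr 1
  ext i : 1
  rw [gaussianReal_of_var_ne_zero _ one_ne_zero]
  rfl

/-- For precision Sᴴ S the quadratic form is |S (x - m)|², and |det S| is the Jacobian of the
standardizing map. -/
theorem gaussianDensity_eq {S : Mat p} (m x : Vec p) :
    gaussianDensity m (Sᴴ * S) x = |S.det| * ∏ i, gaussianPDFReal 0 1 ((S *ᵥ (x - m)) i) := by
  have h1 : (x - m) ⬝ᵥ ((Sᴴ * S) *ᵥ (x - m)) = ∑ i, (S *ᵥ (x - m)) i ^ 2 := by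
    rw [Matrix.conjTranspose_eq_transpose_of_trivial, ← Matrix.mulVec_mulVec,
      Matrix.dotProduct_mulVec, Matrix.vecMul_transpose]
    simp [dotProduct, sq]
  have h2 : (Sᴴ * S).det = S.det ^ 2 := by
    rw [Matrix.det_mul, Matrix.conjTranspose_eq_transpose_of_trivial, Matrix.det_transpose, sq]
  rw [gaussianDensity, h1, h2, Real.sqrt_div (sq_nonneg _), Real.sqrt_sq_eq_abs]
  simp only [gaussianPDFReal, Finset.prod_mul_distrib, ← Real.exp_sum, Finset.prod_const,
    Finset.card_univ, Fintype.card_fin, NNReal.coe_one, mul_one, sub_zero]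
  rw [← Finset.sum_div, Finset.sum_neg_distrib, div_eq_mul_inv, mul_assoc, inv_pow]
  congr 2
  · congr 1
    rw [eq_comm, ← Real.sqrt_sq (pow_nonneg (Real.sqrt_nonneg _) p), ← pow_mul, mul_comm p 2,
      pow_mul, Real.sq_sqrt (by positivity)]
  · congr 1; ring

/-- A Gaussian measure becomes the standard one after an affine change of variables. -/
theorem measurePreserving_gaussian {S : Mat p} (hS : S.det ≠ 0) (m : Vec p) :
    MeasurePreserving (fun x : Vec p => S *ᵥ (x - m)) (gaussianMeasure m (Sᴴ * S))
      (Measure.pi fun _ => gaussianReal 0 1) := by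
  have hmeas : Measurable fun x : Vec p => S *ᵥ (x - m) :=
    (measurable_mulVec S).comp (by fun_prop)
  refine ⟨hmeas, ?_⟩
  rw [pi_gaussianReal_eq]
  have hpdf := measurable_gaussianPDFReal 0 1
  ext A hA
  rw [Measure.map_apply hmeas hA, gaussianMeasure, withDensity_apply _ (hmeas hA),
    withDensity_apply _ hA]
  have hvol := map_mulVec_sub_volume hS m
  have h1 : (volume : Measure (Vec p)) =
      ENNReal.ofReal |S.det| • Measure.map (fun x : Vec p => S *ᵥ (x - m)) volume := by
    rw [hvol, smul_smul, ← ENNReal.ofReal_mul (abs_nonneg _), ← abs_mul, mul_inv_cancel₀ hS]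
    simp
  conv_rhs => rw [h1]
  rw [Measure.restrict_smul, lintegral_smul_measure, smul_eq_mul,
    setLIntegral_map hA (by fun_prop) hmeas, ← lintegral_const_mul' _ _ (by simp)]
  refine lintegral_congr fun x => ?_
  rw [gaussianDensity_eq, ENNReal.ofReal_mul (abs_nonneg _)]

theorem exists_det_ne_zero_conjTranspose_mul_self {P : Mat p} (hP : P.PosDef) :
    ∃ S : Mat p, S.det ≠ 0 ∧ P = Sᴴ * S := by
  obtain ⟨S, hS⟩ := exists_conjTranspose_mul_self hP.posSemidef
  refine ⟨S, fun h => ?_, hS⟩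
  have := hP.det_pos
  rw [hS, Matrix.det_mul, h, mul_zero] at this
  exact lt_irrefl _ this

theorem isProbabilityMeasure_gaussian {P : Mat p} (hP : P.PosDef) (m : Vec p) :
    IsProbabilityMeasure (gaussianMeasure m P) := by
  obtain ⟨S, hS, rfl⟩ := exists_det_ne_zero_conjTranspose_mul_self hP
  have h := measurePreserving_gaussian hS m
  exact ⟨by rw [← Set.preimage_univ (f := fun x : Vec p => S *ᵥ (x - m)),
    h.measure_preimage MeasurableSet.univ.nullMeasurableSet, measure_univ]⟩

theorem integral_sq_gaussianReal : ∫ x, x ^ 2 ∂(gaussianReal 0 1) = 1 := by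
  have h := variance_fun_id_gaussianReal (μ := 0) (v := 1)
  rw [variance_eq_integral (by fun_prop)] at h
  simpa [integral_id_gaussianReal] using h

theorem integrable_sq_gaussianReal : Integrable (fun x : ℝ => x ^ 2) (gaussianReal 0 1) :=
  (memLp_id_gaussianReal' 2 (by simp)).integrable_sq

theorem integrable_id_gaussianReal' : Integrable (fun x : ℝ => x) (gaussianReal 0 1) :=
  (memLp_id_gaussianReal' 1 (by simp)).integrable le_rfl

theorem integrable_mul_pi_gaussian (j k : Fin p) :
    Integrable (fun u : Vec p => u j * u k) (Measure.pi fun _ => gaussianReal 0 1) := by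
  by_cases h : j = k
  · subst h
    simp only [← sq]
    exact integrable_comp_eval (μ := fun _ : Fin p => gaussianReal 0 1) (i := j)
      integrable_sq_gaussianReal
  · exact integrable_pi_mul_of_ne (m := fun _ : Fin p => gaussianReal 0 1) h measurable_id measurable_id integrable_id_gaussianReal'
      integrable_id_gaussianReal'

theorem integral_mul_pi_gaussian (j k : Fin p) :
    ∫ u : Vec p, u j * u k ∂(Measure.pi fun _ => gaussianReal 0 1) = (1 : Mat p) j k := by
  by_cases h : j = k
  · subst h
    simp only [← sq, Matrix.one_apply_eq]
    rw [integral_comp_eval (μ := fun _ : Fin p => gaussianReal 0 1) (i := j)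
      (f := fun x : ℝ => x ^ 2) (by fun_prop), integral_sq_gaussianReal]
  · rw [integral_pi_mul_of_ne (m := fun _ : Fin p => gaussianReal 0 1) h (f := fun x => x)
      (g := fun x => x) measurable_id measurable_id, integral_id_gaussianReal,
      Matrix.one_apply_ne h, zero_mul]

section Moments

variable {P : Mat p} (m : Vec p)

/-- Inverse of the standardizing map. It reduces the mean and the covariance S⁻¹ (S⁻¹)ᵀ = (Sᴴ S)⁻¹
to moments of independent standard normal variables. -/
theorem gaussian_coord {S : Mat p} (hS : S.det ≠ 0) (x : Vec p) (i : Fin p) :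
    x i = m i + ∑ j, S⁻¹ i j * (S *ᵥ (x - m)) j := by
  have : S⁻¹ *ᵥ (S *ᵥ (x - m)) = x - m := by
    rw [Matrix.mulVec_mulVec, Matrix.nonsing_inv_mul _ (isUnit_iff_ne_zero.2 hS),
      Matrix.one_mulVec]
  have h2 := congrFun this i
  simp only [Matrix.mulVec, dotProduct, Pi.sub_apply] at h2 ⊢
  rw [h2]; ring

theorem vecMean_gaussian (hP : P.PosDef) : vecMean (gaussianMeasure m P) = m := by
  have := isProbabilityMeasure_gaussian hP m
  obtain ⟨S, hS, rfl⟩ := exists_det_ne_zero_conjTranspose_mul_self hP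
  have h := measurePreserving_gaussian hS m
  ext i
  have hj : ∀ j, Integrable (fun x : Vec p => (S *ᵥ (x - m)) j) (gaussianMeasure m (Sᴴ * S)) :=
    fun j => h.integrable_comp_of_integrable (g := fun u : Vec p => u j)
      (integrable_comp_eval (μ := fun _ : Fin p => gaussianReal 0 1) (i := j)
        integrable_id_gaussianReal')
  have hint : ∀ j, ∫ x : Vec p, (S *ᵥ (x - m)) j ∂(gaussianMeasure m (Sᴴ * S)) = 0 := fun j => by
    have e := integral_map (μ := gaussianMeasure m (Sᴴ * S)) h.measurable.aemeasurable
      (f := fun u : Vec p => u j) (measurable_pi_apply j).aestronglyMeasurable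
    rw [← e, h.map_eq, integral_comp_eval (μ := fun _ : Fin p => gaussianReal 0 1) (i := j)
      (f := fun x : ℝ => x) (by fun_prop), integral_id_gaussianReal]
  simp only [vecMean]
  rw [integral_congr_ae (ae_of_all _ fun x => gaussian_coord m hS x i),
    integral_add (integrable_const _) (integrable_finsetSum _ fun j _ => (hj j).const_mul _),
    integral_finsetSum _ fun j _ => (hj j).const_mul _]
  simp_rw [integral_const_mul, hint]
  rw [integral_const, probReal_univ]
  simp

theorem gaussian_centered_mul {S : Mat p} (hS : S.det ≠ 0) (x : Vec p) (i j : Fin p) :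
    (x i - m i) * (x j - m j) =
      ∑ a, ∑ b, (S⁻¹ i a * S⁻¹ j b) * ((S *ᵥ (x - m)) a * (S *ᵥ (x - m)) b) := by
  rw [gaussian_coord m hS x i, gaussian_coord m hS x j, add_sub_cancel_left, add_sub_cancel_left,
    Finset.sum_mul_sum]
  refine Finset.sum_congr rfl fun a _ => Finset.sum_congr rfl fun b _ => by ring

theorem vecCov_gaussian (hP : P.PosDef) : vecCov (gaussianMeasure m P) = P⁻¹ := by
  have hmean := vecMean_gaussian m hP
  obtain ⟨S, hS, rfl⟩ := exists_det_ne_zero_conjTranspose_mul_self hP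
  have h := measurePreserving_gaussian hS m
  ext i j
  have hab : ∀ a b, Integrable (fun x : Vec p => (S *ᵥ (x - m)) a * (S *ᵥ (x - m)) b)
      (gaussianMeasure m (Sᴴ * S)) := fun a b =>
    h.integrable_comp_of_integrable (g := fun u : Vec p => u a * u b)
      (integrable_mul_pi_gaussian a b)
  have hint : ∀ a b, ∫ x : Vec p, (S *ᵥ (x - m)) a * (S *ᵥ (x - m)) b
      ∂(gaussianMeasure m (Sᴴ * S)) = (1 : Mat p) a b := fun a b => by
    have e := integral_map (μ := gaussianMeasure m (Sᴴ * S)) h.measurable.aemeasurable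
      (f := fun u : Vec p => u a * u b) (by fun_prop)
    rw [← e, h.map_eq, integral_mul_pi_gaussian]
  simp only [vecCov, hmean, Matrix.of_apply]
  rw [integral_congr_ae (ae_of_all _ fun x => gaussian_centered_mul m hS x i j),
    integral_finsetSum _ fun a _ => integrable_finsetSum _ fun b _ => (hab a b).const_mul _]
  simp_rw [integral_finsetSum _ fun b _ => (hab _ b).const_mul _, integral_const_mul, hint]
  rw [Matrix.mul_inv_rev, Matrix.mul_apply]
  simp only [Matrix.one_apply, mul_ite, mul_one, mul_zero, Finset.sum_ite_eq, Finset.mem_univ,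
    if_true]
  refine Finset.sum_congr rfl fun a _ => ?_
  rw [Matrix.conjTranspose_eq_transpose_of_trivial, ← Matrix.transpose_nonsing_inv,
    Matrix.transpose_apply]

end Moments

end Gaussian

/-- Serves two changes of variables: the exchange of coordinates on the simplex, and the passage
from the node vectors to their increments along the tree. -/
theorem lintegral_comp_linearMap_add {E : Type*} [NormedAddCommGroup E] [NormedSpace ℝ E]
    [MeasurableSpace E] [BorelSpace E] [FiniteDimensional ℝ E] (m : Measure E)
    [m.IsAddHaarMeasure] {A : E →ₗ[ℝ] E} (hA : Function.Injective A) (b : E) {F : E → ℝ≥0∞}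
    (hF : Measurable F) :
    ∫⁻ y, F (A y + b) ∂m = ENNReal.ofReal |(LinearMap.det A)⁻¹| * ∫⁻ y, F y ∂m := by
  have hdet : LinearMap.det A ≠ 0 := by
    intro h
    have := LinearMap.bot_lt_ker_of_det_eq_zero h
    rw [LinearMap.ker_eq_bot.2 hA] at this
    exact lt_irrefl _ this
  have hmap := Measure.map_linearMap_addHaar_eq_smul_addHaar m hdet
  have hAm : Measurable A := A.continuous_of_finiteDimensional.measurable
  rw [← lintegral_map (f := fun z => F (z + b)) (by fun_prop) hAm, hmap, lintegral_smul_measure,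
    smul_eq_mul, lintegral_add_right_eq_self]

/-! ### Dirichlet laws: normalization, conjugacy, logarithmic moments -/

section Dirichlet

theorem measurableSet_positive : MeasurableSet {v : Fin K → ℝ | ∀ k, 0 < v k} := by
  have : {v : Fin K → ℝ | ∀ k, 0 < v k} = ⋂ k, {v | 0 < v k} := by ext; simp
  rw [this]
  exact MeasurableSet.iInter fun k => measurableSet_lt measurable_const (measurable_pi_apply k)

/-- The function `t ^ β` on the unit interval. -/
def unitPow (β t : ℝ) : ℝ := Set.indicator (Set.Ioc 0 1) (fun t => t ^ β) t

theorem measurable_unitPow (β : ℝ) : Measurable (unitPow β) :=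
  Measurable.indicator (by fun_prop) measurableSet_Ioc

theorem integrable_unitPow {β : ℝ} (hβ : -1 < β) : Integrable (unitPow β) := by
  have h := intervalIntegral.intervalIntegrable_rpow' (a := 0) (b := 1) hβ
  rw [intervalIntegrable_iff_integrableOn_Ioc_of_le zero_le_one] at h
  exact h.integrable_indicator measurableSet_Ioc

theorem lintegral_prod_unitPow_lt_top {ι : Type*} [Fintype ι] {β : ι → ℝ} (hβ : ∀ j, -1 < β j) :
    ∫⁻ y : ι → ℝ, ENNReal.ofReal (∏ j, unitPow (β j) (y j)) < ∞ :=
  (Integrable.fintype_prod (f := fun j => unitPow (β j))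
    fun j => integrable_unitPow (hβ j)).lintegral_lt_top

theorem measurable_dirichletDensity (β : Fin K → ℝ) :
    Measurable (Set.indicator {v : Fin K → ℝ | ∀ k, 0 < v k}
      fun v => ENNReal.ofReal (∏ k, v k ^ β k)) :=
  Measurable.indicator (by fun_prop) measurableSet_positive

/-- Lebesgue measure on the hyperplane of vectors with sum one. -/
def simplexVolume (K : ℕ) [NeZero K] : Measure (Fin K → ℝ) := Measure.map simplexPoint volume

variable [NeZero K]

theorem continuous_simplexPoint : Continuous (simplexPoint (K := K)) := by
  refine continuous_pi fun k => ?_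
  by_cases h : k = 0
  · simp only [simplexPoint, h, dite_true]; fun_prop
  · simp only [simplexPoint, h, dite_false]; fun_prop

theorem sum_simplexPoint (y : {k : Fin K // k ≠ 0} → ℝ) : ∑ k, simplexPoint y k = 1 := by
  rw [Fintype.sum_eq_add_sum_subtype_ne _ (0 : Fin K)]
  have : ∀ k : {k : Fin K // k ≠ 0}, simplexPoint y k = y k := fun k => by
    simp [simplexPoint, k.2]
  simp only [this]
  simp [simplexPoint]

/-- The linear part of the exchange of the coordinate `k₀` with the dependent one. -/
def exchangeMap (k₀ : {k : Fin K // k ≠ 0}) :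
    ({k : Fin K // k ≠ 0} → ℝ) →ₗ[ℝ] ({k : Fin K // k ≠ 0} → ℝ) where
  toFun y j := if j = k₀ then -∑ i, y i else y j
  map_add' y z := by
    ext j
    by_cases h : j = k₀
    · simp [h, Finset.sum_add_distrib]; ring
    · simp [h]
  map_smul' c y := by
    ext j
    by_cases h : j = k₀ <;> simp [h, Finset.mul_sum]

theorem exchangeMap_injective (k₀ : {k : Fin K // k ≠ 0}) :
    Function.Injective (exchangeMap k₀) := by
  rw [← LinearMap.ker_eq_bot, LinearMap.ker_eq_bot']
  intro y hy
  have h1 : ∀ j, j ≠ k₀ → y j = 0 := fun j hj => by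
    have := congrFun hy j
    simpa [exchangeMap, hj] using this
  have h2 := congrFun hy k₀
  simp only [exchangeMap, LinearMap.coe_mk, AddHom.coe_mk, if_true, Pi.zero_apply] at h2
  rw [Finset.sum_eq_single k₀ (fun j _ hj => h1 j hj) (by simp)] at h2
  ext j
  by_cases h : j = k₀
  · subst h; simpa using h2
  · exact h1 j h

/-- Any K - 1 coordinates of the hyperplane can serve as Lebesgue coordinates up to a constant
Jacobian. In those other than k₀ the integrand is a product of integrable functions of one variable.
-/
theorem lintegral_simplex_excluding_lt_top {β : Fin K → ℝ} (hβ : ∀ k, -1 < β k) (k₀ : Fin K) :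
    ∫⁻ y : {k : Fin K // k ≠ 0} → ℝ, ENNReal.ofReal
      (∏ k : {k : Fin K // k ≠ k₀}, unitPow (β k) (simplexPoint y k)) < ∞ := by
  have hsp : ∀ (y : {k : Fin K // k ≠ 0} → ℝ) (k : {k : Fin K // k ≠ 0}),
      simplexPoint y k = y k := fun y k => by simp [simplexPoint, k.2]
  by_cases h0 : k₀ = 0
  · subst h0
    simp only [hsp]
    exact lintegral_prod_unitPow_lt_top fun j => hβ j
  · set j₀ : {k : Fin K // k ≠ 0} := ⟨k₀, h0⟩ with hj₀
    set e : {k : Fin K // k ≠ 0} → ℝ := fun j => if j = j₀ then 1 else 0 with he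
    set β' : {k : Fin K // k ≠ 0} → ℝ := fun j => if j = j₀ then β 0 else β j with hβ'
    have hβ'' : ∀ j, -1 < β' j := fun j => by
      by_cases h : j = j₀ <;> simp [hβ', h, hβ]
    have key : ∀ y : {k : Fin K // k ≠ 0} → ℝ,
        ∏ k : {k // k ≠ k₀}, unitPow (β k) (simplexPoint y k) =
          ∏ j, unitPow (β' j) ((exchangeMap j₀ y + e) j) := by
      intro y
      -- The index 0, whose coordinate is the dependent one, takes the place vacated by k₀.
      let σ : {k : Fin K // k ≠ k₀} ≃ {k : Fin K // k ≠ 0} :=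
        { toFun := fun k => if h : (k : Fin K) = 0 then j₀ else ⟨k, h⟩
          invFun := fun j => if h : (j : Fin K) = k₀ then ⟨0, Ne.symm h0⟩ else ⟨j, h⟩
          left_inv := by
            rintro ⟨k, hk⟩
            by_cases h : k = 0
            · subst h; simp [hj₀]
            · simp [h, hk]
          right_inv := by
            rintro ⟨j, hj⟩
            by_cases h : j = k₀
            · subst h; simp [hj₀]
            · simp [h, hj] }
      refine Fintype.prod_equiv σ _ _ ?_
      rintro ⟨k, hk⟩
      by_cases h : k = 0
      · subst h
        simp [σ, hβ', he, exchangeMap, simplexPoint]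
        ring_nf
      · have hne : (⟨k, h⟩ : {k : Fin K // k ≠ 0}) ≠ j₀ := fun h' => hk (congrArg Subtype.val h')
        simp [σ, hβ', he, exchangeMap, simplexPoint, h, hne]
    simp only [key]
    have hmeas : Measurable fun y : {k : Fin K // k ≠ 0} → ℝ =>
        ENNReal.ofReal (∏ j, unitPow (β' j) (y j)) := by
      have := measurable_unitPow
      fun_prop
    rw [lintegral_comp_linearMap_add volume (exchangeMap_injective j₀) e hmeas]
    exact ENNReal.mul_lt_top ENNReal.ofReal_lt_top (lintegral_prod_unitPow_lt_top hβ'')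

theorem exists_inv_card_le_simplexPoint (y : {k : Fin K // k ≠ 0} → ℝ) :
    ∃ k, (K : ℝ)⁻¹ ≤ simplexPoint y k := by
  by_contra! h
  have h1 : ∑ k, simplexPoint y k < ∑ _k : Fin K, (K : ℝ)⁻¹ :=
    Finset.sum_lt_sum_of_nonempty ⟨0, Finset.mem_univ _⟩ fun k _ => h k
  rw [sum_simplexPoint] at h1
  have : (K : ℝ) ≠ 0 := Nat.cast_ne_zero.2 (NeZero.ne K)
  simp [this] at h1

/-- At each point of the simplex some coordinate k₀ is at least 1/K. Its factor is bounded there,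
and the remaining factors are integrable in their own coordinates; summing over k₀ bounds the whole
integral. -/
theorem lintegral_simplex_lt_top {β : Fin K → ℝ} (hβ : ∀ k, -1 < β k) :
    ∫⁻ v, Set.indicator {v : Fin K → ℝ | ∀ k, 0 < v k}
      (fun v => ENNReal.ofReal (∏ k, v k ^ β k)) v ∂(simplexVolume K) < ∞ := by
  have hK : (0 : ℝ) < (K : ℝ)⁻¹ := by
    have : (0 : ℝ) < K := Nat.cast_pos.2 (Nat.pos_of_ne_zero (NeZero.ne K))
    positivity
  rw [simplexVolume, lintegral_map (Measurable.indicator (by fun_prop) measurableSet_positive)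
    continuous_simplexPoint.measurable]
  have hle : ∀ y : {k : Fin K // k ≠ 0} → ℝ, Set.indicator {v : Fin K → ℝ | ∀ k, 0 < v k}
      (fun v => ENNReal.ofReal (∏ k, v k ^ β k)) (simplexPoint y) ≤
      ∑ k₀, ENNReal.ofReal (1 + (K : ℝ)⁻¹ ^ β k₀) *
        ENNReal.ofReal (∏ k : {k // k ≠ k₀}, unitPow (β k) (simplexPoint y k)) := by
    intro y
    by_cases hy : simplexPoint y ∈ {v : Fin K → ℝ | ∀ k, 0 < v k}
    swap
    · rw [Set.indicator_of_notMem hy]; exact zero_le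
    rw [Set.indicator_of_mem hy]
    have hpos : ∀ k, 0 < simplexPoint y k := hy
    have hle1 : ∀ k, simplexPoint y k ≤ 1 := fun k => by
      rw [← sum_simplexPoint y]
      exact Finset.single_le_sum (fun i _ => (hpos i).le) (Finset.mem_univ k)
    obtain ⟨k₀, hk₀⟩ := exists_inv_card_le_simplexPoint y
    refine le_trans ?_ (Finset.single_le_sum (fun _ _ => zero_le) (Finset.mem_univ k₀))
    rw [← ENNReal.ofReal_mul (by positivity)]
    refine ENNReal.ofReal_le_ofReal ?_
    rw [Fintype.prod_eq_mul_prod_subtype_ne _ k₀]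
    have e : ∀ k : {k // k ≠ k₀}, unitPow (β k) (simplexPoint y k) = simplexPoint y k ^ β k :=
      fun k => Set.indicator_of_mem (show simplexPoint y k ∈ Set.Ioc (0 : ℝ) 1 from
        ⟨hpos k, hle1 k⟩) _
    simp only [e]
    refine mul_le_mul_of_nonneg_right ?_
      (Finset.prod_nonneg fun k _ => Real.rpow_nonneg (hpos k).le _)
    -- The constant 1 + K^(-β) covers both signs: t^β is at most 1 for β ≥ 0 and at most (1/K)^β for
    -- β ≤ 0.
    rcases le_total 0 (β k₀) with h | h
    · have := Real.rpow_le_one (hpos k₀).le (hle1 k₀) h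
      have h2 := Real.rpow_nonneg hK.le (β k₀)
      linarith
    · have := Real.rpow_le_rpow_of_nonpos hK hk₀ h
      linarith
  refine (lintegral_mono hle).trans_lt ?_
  rw [lintegral_finsetSum']
  · refine ENNReal.sum_lt_top.2 fun k₀ _ => ?_
    rw [lintegral_const_mul' _ _ ENNReal.ofReal_ne_top]
    exact ENNReal.mul_lt_top ENNReal.ofReal_lt_top (lintegral_simplex_excluding_lt_top hβ k₀)
  · intro k₀ _
    have h1 := measurable_unitPow
    have h2 := continuous_simplexPoint (K := K) |>.measurable
    have h3 : ∀ k, Measurable fun y : {k : Fin K // k ≠ 0} → ℝ => simplexPoint y k := fun k =>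
      (measurable_pi_apply k).comp h2
    exact Measurable.aemeasurable (by fun_prop)

theorem simplexVolume_positive_pos : 0 < simplexVolume K {v | ∀ k, 0 < v k} := by
  rw [simplexVolume, Measure.map_apply continuous_simplexPoint.measurable measurableSet_positive]
  have hopen : IsOpen {v : Fin K → ℝ | ∀ k, 0 < v k} := by
    have : {v : Fin K → ℝ | ∀ k, 0 < v k} = ⋂ k, {v | 0 < v k} := by ext; simp
    rw [this]
    exact isOpen_iInter_of_finite fun k => isOpen_lt continuous_const (continuous_apply k)
  refine (hopen.preimage continuous_simplexPoint).measure_pos volume ?_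
  have hK : (0 : ℝ) < (K : ℝ) := Nat.cast_pos.2 (Nat.pos_of_ne_zero (NeZero.ne K))
  -- The barycentre shows that the open set of positive points is nonempty.
  refine ⟨fun _ => (K : ℝ)⁻¹, fun k => ?_⟩
  by_cases h : k = 0
  · simp only [simplexPoint, h, dite_true, Finset.sum_const, nsmul_eq_mul, Finset.card_univ]
    have : (Fintype.card {k : Fin K // k ≠ 0} : ℝ) = K - 1 := by
      rw [Fintype.card_subtype_compl]
      simp [Nat.cast_sub (Nat.one_le_iff_ne_zero.2 (NeZero.ne K))]
    rw [this]
    have : 1 - ((K : ℝ) - 1) * (K : ℝ)⁻¹ = (K : ℝ)⁻¹ := by field_simp; ring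
    rw [this]; positivity
  · simp only [simplexPoint, h, dite_false]; positivity

theorem dirichlet_mass_ne_zero (β : Fin K → ℝ) :
    (simplexVolume K).withDensity (Set.indicator {v | ∀ k, 0 < v k}
      fun v => ENNReal.ofReal (∏ k, v k ^ β k)) Set.univ ≠ 0 := by
  rw [withDensity_apply _ MeasurableSet.univ, Measure.restrict_univ,
    lintegral_indicator measurableSet_positive]
  refine (setLIntegral_pos_iff (by fun_prop)).2 ?_ |>.ne'
  refine lt_of_lt_of_le simplexVolume_positive_pos (measure_mono fun v hv => ⟨?_, hv⟩)
  simp only [Function.mem_support, ne_eq, ENNReal.ofReal_eq_zero, not_le]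
  exact Finset.prod_pos fun k _ => Real.rpow_pos_of_pos (hv k) _

theorem dirichlet_mass_ne_top {β : Fin K → ℝ} (hβ : ∀ k, -1 < β k) :
    (simplexVolume K).withDensity (Set.indicator {v | ∀ k, 0 < v k}
      fun v => ENNReal.ofReal (∏ k, v k ^ β k)) Set.univ ≠ ∞ := by
  rw [withDensity_apply _ MeasurableSet.univ, Measure.restrict_univ]
  exact (lintegral_simplex_lt_top hβ).ne

theorem isProbabilityMeasure_dirichlet {α : Fin K → ℝ} (hα : ∀ k, 0 < α k) :
    IsProbabilityMeasure (dirichletMeasure α) :=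
  isProbabilityMeasure_normalized (dirichlet_mass_ne_zero _)
    (dirichlet_mass_ne_top fun k => by linarith [hα k])

theorem exists_dirichlet_eq {α : Fin K → ℝ} (hα : ∀ k, 0 < α k) :
    ∃ c : ℝ, dirichletMeasure α = (simplexVolume K).withDensity
      (Set.indicator {v | ∀ k, 0 < v k} fun v => ENNReal.ofReal (Real.exp
        (∑ k, (α k - 1) * Real.log (v k) - c))) := by
  set m := (simplexVolume K).withDensity (Set.indicator {v | ∀ k, 0 < v k}
      fun v => ENNReal.ofReal (∏ k, v k ^ (α k - 1))) with hm
  have h0 : m Set.univ ≠ 0 := dirichlet_mass_ne_zero _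
  have htop : m Set.univ ≠ ∞ := dirichlet_mass_ne_top fun k => by linarith [hα k]
  have hpos := ENNReal.toReal_pos h0 htop
  refine ⟨Real.log (m Set.univ).toReal, ?_⟩
  change normalized m = _
  rw [normalized]
  conv_lhs => rw [hm]
  rw [← withDensity_smul _ (measurable_dirichletDensity _)]
  congr 1
  ext v
  simp only [Pi.smul_apply, smul_eq_mul]
  by_cases hv : v ∈ {v : Fin K → ℝ | ∀ k, 0 < v k}
  swap
  · simp [hv]
  have hv' : ∀ k, 0 < v k := hv
  rw [Set.indicator_of_mem hv, Set.indicator_of_mem hv, Real.exp_sub, Real.exp_log hpos,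
    ENNReal.ofReal_div_of_pos hpos, ENNReal.ofReal_toReal htop, ENNReal.div_eq_inv_mul, ← hm,
    Real.exp_sum]
  congr 2
  refine Finset.prod_congr rfl fun k _ => ?_
  rw [Real.rpow_def_of_pos (hv' k), mul_comm]

theorem ae_positive_dirichlet {α : Fin K → ℝ} (hα : ∀ k, 0 < α k) :
    ∀ᵐ v ∂(dirichletMeasure α), ∀ k, 0 < v k := by
  obtain ⟨c, hc⟩ := exists_dirichlet_eq hα
  rw [hc, withDensity_indicator measurableSet_positive]
  exact (withDensity_absolutelyContinuous _ _).ae_le (ae_restrict_mem measurableSet_positive)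

theorem ae_sum_eq_one_dirichlet {α : Fin K → ℝ} (hα : ∀ k, 0 < α k) :
    ∀ᵐ v ∂(dirichletMeasure α), ∑ k, v k = 1 := by
  obtain ⟨c, hc⟩ := exists_dirichlet_eq hα
  rw [hc]
  refine (withDensity_absolutelyContinuous _ _).ae_le ?_
  change ∀ᵐ v ∂(simplexVolume K), ∑ k, v k = 1
  rw [simplexVolume, ae_map_iff continuous_simplexPoint.measurable.aemeasurable
    (measurableSet_eq_fun (by fun_prop) measurable_const)]
  exact ae_of_all _ sum_simplexPoint

theorem exists_dirichlet_tilt {α : Fin K → ℝ} (hα : ∀ k, 0 < α k) {N : Fin K → ℝ}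
    (hN : ∀ k, 0 < α k + N k) :
    ∃ c : ℝ, dirichletMeasure (fun k => α k + N k) = (dirichletMeasure α).withDensity fun v =>
      ENNReal.ofReal (Real.exp (∑ k, N k * Real.log (v k) - c)) := by
  obtain ⟨c₁, h₁⟩ := exists_dirichlet_eq hN
  obtain ⟨c₂, h₂⟩ := exists_dirichlet_eq hα
  refine ⟨c₁ - c₂, ?_⟩
  rw [h₁, h₂, ← withDensity_mul _ (Measurable.indicator (by fun_prop) measurableSet_positive)
    (by fun_prop)]
  congr 1
  ext v
  by_cases hv : v ∈ {v : Fin K → ℝ | ∀ k, 0 < v k}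
  swap
  · simp [hv]
  rw [Pi.mul_apply, Set.indicator_of_mem hv, Set.indicator_of_mem hv,
    ← ENNReal.ofReal_mul (Real.exp_pos _).le, ← Real.exp_add]
  congr 2
  have : ∑ k, (α k + N k - 1) * Real.log (v k) =
      ∑ k, (α k - 1) * Real.log (v k) + ∑ k, N k * Real.log (v k) := by
    rw [← Finset.sum_add_distrib]
    exact Finset.sum_congr rfl fun k _ => by ring
  rw [this]; ring

/-- The power v_k^δ is a multiple of the density of the Dirichlet law with α_k replaced by α_k + δ,
hence integrable while α_k + δ > 0. The choices δ = ± α_k / 2 control the logarithm. -/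
theorem integrable_log_dirichlet {α : Fin K → ℝ} (hα : ∀ k, 0 < α k) (k : Fin K) :
    Integrable (fun v => Real.log (v k)) (dirichletMeasure α) := by
  have hpow : ∀ δ : ℝ, 0 < α k + δ →
      Integrable (fun v : Fin K → ℝ => v k ^ δ) (dirichletMeasure α) := by
    intro δ hδ
    set N : Fin K → ℝ := fun j => if j = k then δ else 0 with hN
    have hNpos : ∀ j, 0 < α j + N j := fun j => by
      by_cases h : j = k
      · subst h; simpa [hN] using hδ
      · simpa [hN, h] using hα j
    obtain ⟨c, hc⟩ := exists_dirichlet_tilt hα hNpos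
    have hprob := isProbabilityMeasure_dirichlet hNpos
    have hmass := hprob.measure_univ
    rw [hc, withDensity_apply _ MeasurableSet.univ, Measure.restrict_univ] at hmass
    have hint : Integrable (fun v : Fin K → ℝ => Real.exp (∑ j, N j * Real.log (v j) - c))
        (dirichletMeasure α) := by
      refine ⟨(by fun_prop : Measurable _).aestronglyMeasurable, ?_⟩
      rw [hasFiniteIntegral_iff_enorm]
      simp_rw [Real.enorm_of_nonneg (Real.exp_pos _).le]
      rw [hmass]; exact ENNReal.one_lt_top
    refine (hint.const_mul (Real.exp c)).congr ?_
    filter_upwards [ae_positive_dirichlet hα] with v hv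
    rw [← Real.exp_add, Real.rpow_def_of_pos (hv k)]
    congr 1
    rw [Finset.sum_eq_single k (fun j _ hj => by simp [hN, hj]) (by simp)]
    simp [hN]; ring
  have hδ : 0 < α k / 2 := by linarith [hα k]
  refine (((hpow (α k / 2) (by linarith)).add (hpow (-(α k / 2)) (by linarith))).div_const
    (α k / 2)).mono' (by fun_prop : Measurable _).aestronglyMeasurable ?_
  filter_upwards [ae_positive_dirichlet hα] with v hv
  exact abs_log_le_rpow_add hδ (hv k)

end Dirichlet

/-! ### Conjugacy of Beta laws -/

section Beta

theorem ae_mem_Ioo_beta {a b : ℝ} : ∀ᵐ g ∂(betaMeasure a b), g ∈ Set.Ioo (0 : ℝ) 1 := by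
  have hm : Measurable (betaPDF a b) := by unfold betaPDF; fun_prop
  rw [betaMeasure, ae_withDensity_iff hm]
  refine ae_of_all _ fun g hg => ?_
  by_contra h
  refine hg ?_
  rw [betaPDF_eq, if_neg (by simpa using h)]
  simp

theorem exists_beta_tilt {a b κ₁ κ₂ : ℝ} (ha : 0 < a) (hb : 0 < b) (hκ₁ : 0 < a + κ₁)
    (hκ₂ : 0 < b + κ₂) :
    ∃ c : ℝ, betaMeasure (a + κ₁) (b + κ₂) = (betaMeasure a b).withDensity fun g =>
      ENNReal.ofReal (Real.exp (κ₁ * Real.log g + κ₂ * Real.log (1 - g) - c)) := by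
  have h1 := beta_pos ha hb
  have h2 := beta_pos hκ₁ hκ₂
  refine ⟨Real.log (beta (a + κ₁) (b + κ₂)) - Real.log (beta a b), ?_⟩
  have hm : Measurable (betaPDF a b) := by unfold betaPDF; fun_prop
  rw [betaMeasure, betaMeasure, ← withDensity_mul _ hm (by fun_prop)]
  congr 1
  ext g
  rw [Pi.mul_apply, betaPDF_eq, betaPDF_eq]
  by_cases hg : 0 < g ∧ g < 1
  swap
  · rw [if_neg hg, if_neg hg]; simp
  have hg1 : 0 < 1 - g := by linarith [hg.2]
  rw [if_pos hg, if_pos hg]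
  have hg0 := hg.1
  have p1 := Real.rpow_pos_of_pos hg0 (a - 1)
  have p2 := Real.rpow_pos_of_pos hg1 (b - 1)
  rw [← ENNReal.ofReal_mul (by positivity)]
  congr 1
  rw [Real.exp_sub, Real.exp_add, Real.exp_sub, Real.exp_log h1, Real.exp_log h2]
  have e1 : g ^ (a + κ₁ - 1) = g ^ (a - 1) * Real.exp (κ₁ * Real.log g) := by
    rw [show a + κ₁ - 1 = (a - 1) + κ₁ by ring, Real.rpow_add hg0, Real.rpow_def_of_pos hg0 κ₁,
      mul_comm κ₁]
  have e2 : (1 - g) ^ (b + κ₂ - 1) = (1 - g) ^ (b - 1) * Real.exp (κ₂ * Real.log (1 - g)) := by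
    rw [show b + κ₂ - 1 = (b - 1) + κ₂ by ring, Real.rpow_add hg1, Real.rpow_def_of_pos hg1 κ₂,
      mul_comm κ₂]
  rw [e1, e2]
  field_simp

theorem exists_pi_beta_tilt {ι : Type*} [Fintype ι] {a b κ₁ κ₂ : ι → ℝ} (ha : ∀ s, 0 < a s)
    (hb : ∀ s, 0 < b s) (hκ₁ : ∀ s, 0 < a s + κ₁ s) (hκ₂ : ∀ s, 0 < b s + κ₂ s) :
    ∃ c : ℝ, Measure.pi (fun s => betaMeasure (a s + κ₁ s) (b s + κ₂ s)) =
      (Measure.pi fun s => betaMeasure (a s) (b s)).withDensity fun g => ENNReal.ofReal (Real.exp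
        (∑ s, (κ₁ s * Real.log (g s) + κ₂ s * Real.log (1 - g s)) - c)) := by
  choose c hc using fun s => exists_beta_tilt (ha s) (hb s) (hκ₁ s) (hκ₂ s)
  have := fun s => isProbabilityMeasureBeta (ha s) (hb s)
  refine ⟨∑ s, c s, ?_⟩
  simp_rw [hc]
  rw [pi_withDensity_ofReal (fun s => betaMeasure (a s) (b s)) (f := fun s g =>
    Real.exp (κ₁ s * Real.log g + κ₂ s * Real.log (1 - g) - c s)) (fun s g => (Real.exp_pos _).le)]
  · simp_rw [← Real.exp_sum, Finset.sum_sub_distrib]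
  · intro s
    have hmass := (isProbabilityMeasureBeta (hκ₁ s) (hκ₂ s)).measure_univ
    rw [hc, withDensity_apply _ MeasurableSet.univ, Measure.restrict_univ] at hmass
    refine ⟨(by fun_prop : Measurable _).aestronglyMeasurable, ?_⟩
    rw [hasFiniteIntegral_iff_enorm]
    simp_rw [Real.enorm_of_nonneg (Real.exp_pos _).le]
    rw [hmass]; exact ENNReal.one_lt_top

end Beta

/-! ### The logarithm of the joint density -/

section LogDensity

open Classical in
/-- The indicator of `s ⪯ s(z)`. -/
def pathInd (s : Node K D) (z : TreePath K D) : ℝ := if OnPath s z then 1 else 0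

open Classical in
/-- The indicator of `s ∈ 𝓛(T)`. -/
def leafInd (s : Node K D) (T : Subtree K D) : ℝ := if T.IsLeaf s then 1 else 0

open Classical in
/-- The indicator of `s ∈ 𝓘(T)`. -/
def innerInd (s : Node K D) (T : Subtree K D) : ℝ := if T.IsInner s then 1 else 0

/-- The logarithm of the Gaussian density, for a positive definite precision matrix. -/
def logGauss (m : Vec p) (P : Mat p) (x : Vec p) : ℝ :=
  1 / 2 * Real.log P.det - p / 2 * Real.log (2 * Real.pi) - 1 / 2 * ((x - m) ⬝ᵥ (P *ᵥ (x - m)))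

def logPath (π : Inner K D → Fin K → ℝ) (z : TreePath K D) : ℝ :=
  ∑ s, ∑ k, pathInd (child s k) z * Real.log (π s k)

/-- The leaves of the perfect tree are omitted: they are never inner nodes of T, and as leaves of T
they contribute log(1 - 0) = 0. -/
def logTree (g : Inner K D → ℝ) (T : Subtree K D) : ℝ :=
  ∑ s : Inner K D, (innerInd s.toNode T * Real.log (g s) +
    leafInd s.toNode T * Real.log (1 - g s))

def logMean (m₀ : Vec p) (L : Mat p) (μ : Node K D → Vec p) : ℝ :=
  ∑ s, logGauss (parentVec m₀ μ s) L (μ s)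

def logData (z : TreePath K D) (T : Subtree K D) (μ : Node K D → Vec p) (Λ : Node K D → Mat p)
    (x : Vec p) : ℝ :=
  ∑ s, leafInd s T * pathInd s z * logGauss (μ s) (Λ s) x

def logJoint (M : Hyper K D p) (x : Fin n → Vec p) (ω : Latent K D p n) : ℝ :=
  (∑ i, logPath ω.2.2.1 (ω.1 i)) + (∑ i, logTree ω.2.2.2.1 (ω.2.1 i)) +
    logMean M.m₀ ω.2.2.2.2.2.2 ω.2.2.2.2.1 +
    ∑ i, logData (ω.1 i) (ω.2.1 i) ω.2.2.2.2.1 ω.2.2.2.2.2.1 (x i)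

/-- The density of the joint measure with respect to its base measure. -/
def jointDensity (M : Hyper K D p) (x : Fin n → Vec p) (ω : Latent K D p n) : ℝ :=
  (∏ i, pathProb ω.2.2.1 (ω.1 i)) * (∏ i, treeProb ω.2.2.2.1 (ω.2.1 i)) *
    meanDensity M.m₀ ω.2.2.2.2.2.2 ω.2.2.2.2.1 *
    ∏ i, dataDensity (ω.1 i) (ω.2.1 i) ω.2.2.2.2.1 ω.2.2.2.2.2.1 (x i)

/-- The base measure of the joint measure. -/
def jointBase [NeZero K] (n : ℕ) (M : Hyper K D p) : Measure (Latent K D p n) :=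
  latentProd (fun _ => Measure.count) (fun _ => Measure.count) (fun s => dirichletMeasure (M.α s))
    (Measure.pi fun s => betaMeasure (M.a s) (M.b s)) (fun _ => volume)
    (fun s => wishartMeasure (M.ν s) (M.W s)) (wishartMeasure M.u M.V)

theorem jointMeasure_eq [NeZero K] (M : Hyper K D p) (x : Fin n → Vec p) :
    jointMeasure M x =
      (jointBase n M).withDensity fun ω => ENNReal.ofReal (jointDensity M x ω) := rfl

theorem toNode_injective : Function.Injective (Inner.toNode (K := K) (D := D)) := fun s t h => by
  have := congrArg Subtype.val h
  exact Subtype.ext this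

theorem exists_toNode {s : Node K D} (h : s.1.length < D) : ∃ t : Inner K D, t.toNode = s :=
  ⟨⟨s.1, h⟩, rfl⟩

theorem edgeProb_toNode (g : Inner K D → ℝ) (s : Inner K D) : edgeProb g s.toNode = g s := by
  have : s.toNode.1.length < D := s.2
  simp only [edgeProb, this, dite_true]
  rfl

theorem exp_logGauss {P : Mat p} (hP : P.PosDef) (m x : Vec p) :
    Real.exp (logGauss m P x) = gaussianDensity m P x := by
  have h2 : 0 < (2 * Real.pi) ^ p := by positivity
  have h1 : 0 < P.det / (2 * Real.pi) ^ p := div_pos hP.det_pos h2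
  rw [gaussianDensity, Real.sqrt_eq_rpow, Real.rpow_def_of_pos h1, ← Real.exp_add,
    Real.log_div hP.det_pos.ne' h2.ne', Real.log_pow, logGauss]
  congr 1
  ring

theorem log_gaussianDensity {P : Mat p} (hP : P.PosDef) (m x : Vec p) :
    Real.log (gaussianDensity m P x) = logGauss m P x := by
  rw [← exp_logGauss hP, Real.log_exp]

theorem exp_logPath {π : Inner K D → Fin K → ℝ} (hπ : ∀ s k, 0 < π s k) (z : TreePath K D) :
    Real.exp (logPath π z) = pathProb π z := by
  simp only [logPath, pathProb, Real.exp_sum]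
  refine Finset.prod_congr rfl fun s _ => Finset.prod_congr rfl fun k _ => ?_
  by_cases h : OnPath (child s k) z
  · simp [pathInd, h, Real.exp_log (hπ s k)]
  · simp [pathInd, h]

theorem exp_logTree {g : Inner K D → ℝ} (hg : ∀ s, g s ∈ Set.Ioo 0 1) (T : Subtree K D) :
    Real.exp (logTree g T) = treeProb g T := by
  simp only [logTree, treeProb, Real.exp_sum, Real.exp_add, Finset.prod_mul_distrib,
    Finset.prod_filter]
  congr 1
  · refine Fintype.prod_of_injective _ toNode_injective _ _ (fun s hs => ?_) fun s => ?_
    · rw [if_neg]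
      rintro ⟨_, h, _⟩
      exact hs (exists_toNode h)
    · rw [edgeProb_toNode, innerInd]
      split_ifs with h
      · rw [one_mul, Real.exp_log (hg s).1]
      · simp
  · refine Fintype.prod_of_injective _ toNode_injective _ _ (fun s hs => ?_) fun s => ?_
    · have : ¬ s.1.length < D := fun h => hs (exists_toNode h)
      simp [edgeProb, this]
    · rw [edgeProb_toNode, leafInd]
      split_ifs with h
      · rw [one_mul, Real.exp_log (sub_pos.2 (hg s).2)]
      · simp

theorem exp_logMean {L : Mat p} (hL : L.PosDef) (m₀ : Vec p) (μ : Node K D → Vec p) :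
    Real.exp (logMean m₀ L μ) = meanDensity m₀ L μ := by
  simp only [logMean, meanDensity, Real.exp_sum, exp_logGauss hL]

theorem exp_logData {Λ : Node K D → Mat p} (hΛ : ∀ s, (Λ s).PosDef) (z : TreePath K D)
    (T : Subtree K D) (μ : Node K D → Vec p) (x : Vec p) :
    Real.exp (logData z T μ Λ x) = dataDensity z T μ Λ x := by
  simp only [logData, dataDensity, Real.exp_sum, Finset.prod_filter]
  refine Finset.prod_congr rfl fun s _ => ?_
  simp only [leafInd, pathInd]
  split_ifs <;> simp [exp_logGauss (hΛ s)]

/-- The points at which the logarithm of the joint density is the one computed formally. -/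
def IsGood (ω : Latent K D p n) : Prop :=
  (∀ s k, ω.2.2.1 s k ∈ Set.Ioc 0 1) ∧ (∀ s, ω.2.2.2.1 s ∈ Set.Ioo 0 1) ∧
    (∀ s, (ω.2.2.2.2.2.1 s).PosDef) ∧ ω.2.2.2.2.2.2.PosDef

theorem exp_logJoint (M : Hyper K D p) (x : Fin n → Vec p) {ω : Latent K D p n} (h : IsGood ω) :
    Real.exp (logJoint M x ω) = jointDensity M x ω := by
  obtain ⟨h1, h2, h3, h4⟩ := h
  simp only [logJoint, jointDensity, Real.exp_add, Real.exp_sum, exp_logPath (fun s k => (h1 s k).1), exp_logTree h2,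
    exp_logMean h4, exp_logData h3]

section Instances

variable [NeZero K] (M : Hyper K D p)

instance (s : Inner K D) : IsProbabilityMeasure (dirichletMeasure (M.α s)) :=
  isProbabilityMeasure_dirichlet (M.α_pos s)

instance (s : Inner K D) : IsProbabilityMeasure (betaMeasure (M.a s) (M.b s)) :=
  isProbabilityMeasureBeta (M.a_pos s) (M.b_pos s)

instance (s : Node K D) : IsProbabilityMeasure (wishartMeasure (M.ν s) (M.W s)) :=
  isProbabilityMeasure_wishart (M.ν_gt s) (M.W_posDef s)

instance : IsProbabilityMeasure (wishartMeasure M.u M.V) :=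
  isProbabilityMeasure_wishart M.u_gt M.V_posDef

end Instances

theorem ae_pi_of_forall {ι : Type*} [Fintype ι] {X : ι → Type*} [∀ i, MeasurableSpace (X i)]
    {m : ∀ i, Measure (X i)} [∀ i, SigmaFinite (m i)] {P : ∀ i, X i → Prop}
    (h : ∀ i, ∀ᵐ x ∂m i, P i x) : ∀ᵐ f ∂Measure.pi m, ∀ i, P i (f i) :=
  ae_all_iff.2 fun i => (Measure.quasiMeasurePreserving_eval m i).ae (h i)

theorem ae_isGood [NeZero K] (M : Hyper K D p) : ∀ᵐ ω ∂jointBase n M, IsGood ω := by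
  unfold jointBase latentProd IsGood
  -- Positive coordinates with sum one are at most one; this upper bound later gives `pathProb` ≤ 1.
  have q1 (s : Inner K D) : ∀ᵐ v ∂dirichletMeasure (M.α s), ∀ k, v k ∈ Set.Ioc 0 1 := by
    filter_upwards [ae_positive_dirichlet (M.α_pos s), ae_sum_eq_one_dirichlet (M.α_pos s)]
      with v h0 h1 k
    refine ⟨h0 k, ?_⟩
    rw [← h1]
    exact Finset.single_le_sum (fun j _ => (h0 j).le) (Finset.mem_univ k)
  have q2 := fun (s : Inner K D) => ae_mem_Ioo_beta (a := M.a s) (b := M.b s)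
  have q3 := fun (s : Node K D) => ae_posDef_wishart (M.ν_gt s) (M.W_posDef s)
  have q4 := ae_posDef_wishart M.u_gt M.V_posDef
  simp only [Filter.eventually_and]
  refine ⟨?_, ?_, ?_, ?_⟩
  · refine Measure.quasiMeasurePreserving_snd.ae (Measure.quasiMeasurePreserving_snd.ae
      (Measure.quasiMeasurePreserving_fst.ae (p := fun f : Inner K D → Fin K → ℝ => ∀ s k, f s k ∈ Set.Ioc 0 1) ?_))
    exact ae_pi_of_forall q1
  · refine Measure.quasiMeasurePreserving_snd.ae (Measure.quasiMeasurePreserving_snd.ae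
      (Measure.quasiMeasurePreserving_snd.ae (Measure.quasiMeasurePreserving_fst.ae
        (p := fun f : Inner K D → ℝ => ∀ s, f s ∈ Set.Ioo 0 1) ?_)))
    exact ae_pi_of_forall q2
  · refine Measure.quasiMeasurePreserving_snd.ae (Measure.quasiMeasurePreserving_snd.ae
      (Measure.quasiMeasurePreserving_snd.ae (Measure.quasiMeasurePreserving_snd.ae
        (Measure.quasiMeasurePreserving_snd.ae (Measure.quasiMeasurePreserving_fst.ae
        (p := fun f : Node K D → Mat p => ∀ s, (f s).PosDef) ?_)))))
    exact ae_pi_of_forall q3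
  · exact Measure.quasiMeasurePreserving_snd.ae (Measure.quasiMeasurePreserving_snd.ae
      (Measure.quasiMeasurePreserving_snd.ae (Measure.quasiMeasurePreserving_snd.ae
        (Measure.quasiMeasurePreserving_snd.ae (Measure.quasiMeasurePreserving_snd.ae
        (p := fun f : Mat p => f.PosDef) q4)))))

@[fun_prop]
theorem measurable_pathInd (s : Node K D) : Measurable (pathInd s) := .of_discrete

instance : DiscreteMeasurableSpace (Subtree K D) := ⟨fun _ => trivial⟩

@[fun_prop]
theorem measurable_leafInd (s : Node K D) : Measurable (leafInd s) := .of_discrete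

@[fun_prop]
theorem measurable_innerInd (s : Node K D) : Measurable (innerInd s) := .of_discrete

@[fun_prop]
theorem measurable_logGauss {Ω : Type*} [MeasurableSpace Ω] {m x : Ω → Vec p} {P : Ω → Mat p}
    (hm : Measurable m) (hP : Measurable P) (hx : Measurable x) :
    Measurable fun ω => logGauss (m ω) (P ω) (x ω) := by
  have h1 : Measurable fun ω => (P ω).det := measurable_det.comp hP
  have h2 : ∀ i j, Measurable fun ω => P ω i j := fun i j => (measurable_entry i j).comp hP
  simp only [logGauss, dotProduct, Matrix.mulVec]
  fun_prop

@[fun_prop]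
theorem measurable_parentVec (m₀ : Vec p) (s : Node K D) :
    Measurable fun μ : Node K D → Vec p => parentVec m₀ μ s := by
  unfold parentVec
  split_ifs <;> fun_prop

theorem measurable_logJoint (M : Hyper K D p) (x : Fin n → Vec p) : Measurable (logJoint M x) := by
  have h (s : Node K D) : Measurable fun ω : Latent K D p n => parentVec M.m₀ ω.2.2.2.2.1 s :=
    (measurable_parentVec _ s).comp (by fun_prop)
  unfold logJoint logPath logTree logMean logData
  fun_prop

/-- Allows the everywhere defined function `logJoint` to be used in place of the logarithm of the
density; the values at points that are not good do not matter. -/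
theorem jointDensity_ae_eq [NeZero K] (M : Hyper K D p) (x : Fin n → Vec p) :
    (fun ω => ENNReal.ofReal (jointDensity M x ω)) =ᵐ[jointBase n M]
      fun ω => ENNReal.ofReal (Real.exp (logJoint M x ω)) := by
  filter_upwards [ae_isGood M] with ω hω
  rw [exp_logJoint M x hω]

end LogDensity

/-! ### The optimality criterion on the latent space -/

section Optimality

variable [NeZero K]

/-- Characterization of an optimal factor of a mean-field distribution by the expectation of the
logarithm of the joint density. -/
theorem minimizes_iff_of_splits {X Y : Type*} [MeasurableSpace X] [MeasurableSpace Y]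
    {M : Hyper K D p} {x : Fin n → Vec p} {e : X × Y ≃ᵐ Latent K D p n}
    {F G : Measure X → Measure (Latent K D p n)} {q₂ ρ₂ : Measure Y} (hF : Splits e F q₂)
    (hG : Splits e G ρ₂) {ρ₁ : Measure X} [SigmaFinite ρ₁] (hρ : G ρ₁ = jointBase n M)
    {Q : Measure (Latent K D p n)} [IsProbabilityMeasure Q] (q₁ : ProbabilityMeasure X)
    (hQ : F q₁ = Q) (hKL : klDiv Q (posterior M x) ≠ ∞)
    {upd : X → Latent K D p n → Latent K D p n} (hupd : ∀ x x' y, upd x (e (x', y)) = e (x, y))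
    (x₀ : X) (c : ℝ) {Ψ : X → ℝ} (hΨ : Measurable Ψ) {rs : Measure X}
    (hrs : rs = ρ₁.withDensity fun x => ENNReal.ofReal (Real.exp (Ψ x)))
    (hprob : IsProbabilityMeasure rs)
    (hφ : ∀ᵐ v ∂ρ₁, Integrable (fun ω => logJoint M x (upd v ω) - logJoint M x (upd x₀ ω)) Q ∧
      ∫ ω, (logJoint M x (upd v ω) - logJoint M x (upd x₀ ω)) ∂Q = Ψ v + c)
    (r : ProbabilityMeasure X) :
    Minimizes (fun r : ProbabilityMeasure X => klDiv (F r) (posterior M x)) r ↔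
      (r : Measure X) = rs := by
  have := hF.1
  have := hG.1
  -- The total mass of Q is the product of the masses of q₁ and q₂, so the complement of a
  -- probability factor has mass one.
  have hq₂ : IsProbabilityMeasure q₂ := by
    have h1 : ((q₁ : Measure X).prod q₂).map e Set.univ = 1 := by
      rw [hF.2 q₁ inferInstance, hQ, measure_univ]
    rw [e.map_apply, Set.preimage_univ, ← Set.univ_prod_univ, Measure.prod_prod, measure_univ,
      one_mul] at h1
    exact ⟨h1⟩
  refine minimizes_klDiv_iff_of_equiv e ((hG.2 ρ₁ inferInstance).trans hρ)
    (measurable_logJoint M x) (jointDensity_ae_eq M x) (fun r => hF.2 r inferInstance) q₁ ?_ hupd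
    x₀ c hΨ hrs hprob (by rwa [hQ]) r
  rw [hQ]
  exact hKL

end Optimality

/-! ### Pointwise bounds on the joint density and Gaussian exponential moments -/

section ExponentialMoments

/-- The quadratic form of a matrix. -/
def quadForm (P : Mat p) (y : Vec p) : ℝ := y ⬝ᵥ (P *ᵥ y)

theorem quadForm_nonneg {P : Mat p} (hP : P.PosDef) (y : Vec p) : 0 ≤ quadForm P y :=
  (posSemidef_iff_real.1 hP.posSemidef).2 y

theorem quadForm_eq_sum (P : Mat p) (y : Vec p) :
    quadForm P y = ∑ i, ∑ j, y i * P i j * y j := by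
  simp only [quadForm, dotProduct, Matrix.mulVec, Finset.mul_sum, mul_assoc]

@[fun_prop]
theorem measurable_quadForm {Ω : Type*} [MeasurableSpace Ω] {P : Ω → Mat p} {y : Ω → Vec p}
    (hP : Measurable P) (hy : Measurable y) : Measurable fun ω => quadForm (P ω) (y ω) := by
  have h2 : ∀ i j, Measurable fun ω => P ω i j := fun i j => (measurable_entry i j).comp hP
  simp only [quadForm_eq_sum]
  fun_prop

theorem gaussianDensity_nonneg (m : Vec p) (P : Mat p) (x : Vec p) : 0 ≤ gaussianDensity m P x := by
  unfold gaussianDensity; positivity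

@[fun_prop]
theorem measurable_gaussianDensity {Ω : Type*} [MeasurableSpace Ω] {m x : Ω → Vec p}
    {P : Ω → Mat p} (hm : Measurable m) (hP : Measurable P) (hx : Measurable x) :
    Measurable fun ω => gaussianDensity (m ω) (P ω) (x ω) := by
  have h1 : Measurable fun ω => (P ω).det := measurable_det.comp hP
  have h3 : Measurable fun ω => quadForm (P ω) (x ω - m ω) := by fun_prop
  change Measurable fun ω => Real.sqrt ((P ω).det / (2 * Real.pi) ^ p) *
    Real.exp (-(1 / 2) * quadForm (P ω) (x ω - m ω))
  fun_prop

/-- A quarter of the quadratic form removes half of the Gaussian exponent. What is left is the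
Gaussian with precision L/2, off by a normalization that does not depend on L. -/
theorem gaussianDensity_mul_exp (m : Vec p) (L : Mat p) (x : Vec p) :
    gaussianDensity m L x * Real.exp (1 / 4 * quadForm L (x - m)) =
      Real.sqrt (2 ^ p) * gaussianDensity 0 ((1 / 2 : ℝ) • L) (x - m) := by
  simp only [gaussianDensity, Matrix.det_smul, Fintype.card_fin, sub_zero, Matrix.smul_mulVec,
    dotProduct_smul, smul_eq_mul]
  rw [mul_assoc, ← Real.exp_add, ← mul_assoc, ← Real.sqrt_mul (by positivity)]
  congr 2
  · rw [one_div, inv_pow]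
    field_simp
  · simp only [quadForm]; ring

/-- The increments of a family of vectors along the edges of the tree. -/
def incr (μ : Node K D → Vec p) (s : Node K D) : Vec p :=
  if s = root then μ s else μ s - μ (parent s)

def incrLinear (K D p : ℕ) : (Node K D → Vec p) →ₗ[ℝ] (Node K D → Vec p) where
  toFun := incr
  map_add' μ μ' := by
    ext s j; simp only [incr, Pi.add_apply]; split_ifs <;> simp; ring
  map_smul' c μ := by
    ext s j; simp only [incr, Pi.smul_apply, RingHom.id_apply]; split_ifs <;> simp; ring

theorem length_parent_lt {s : Node K D} (hs : s ≠ root) : (parent s).1.length < s.1.length := by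
  have : s.1 ≠ [] := fun h => hs (Subtype.ext h)
  have := List.length_pos_of_ne_nil this
  simp only [parent, List.length_dropLast]
  omega

/-- Induction from the root of the tree to its leaves. -/
theorem node_induction {P : Node K D → Prop} (h0 : P root)
    (h : ∀ s, s ≠ root → P (parent s) → P s) (s : Node K D) : P s := by
  induction hn : s.1.length using Nat.strong_induction_on generalizing s with
  | _ N ih =>
    by_cases hs : s = root
    · rw [hs]; exact h0
    · exact h s hs (ih _ (hn ▸ length_parent_lt hs) _ rfl)

theorem incrLinear_injective : Function.Injective (incrLinear K D p) := by
  refine LinearMap.ker_eq_bot.1 (LinearMap.ker_eq_bot'.2 fun μ hμ => ?_)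
  have h (s) : incr μ s = 0 := congrFun hμ s
  ext1 s
  induction s using node_induction with
  | h0 => simpa [incr] using h root
  | h s hs ih => simpa [incr, hs, ih] using h s

theorem sub_parentVec (m₀ : Vec p) (μ : Node K D → Vec p) (s : Node K D) :
    μ s - parentVec m₀ μ s = (incrLinear K D p μ + fun t => if t = root then -m₀ else 0 : Node K D → Vec p) s := by
  change _ = incr μ s + _
  simp only [parentVec, incr]
  split_ifs
  · rw [sub_eq_add_neg]
  · simp

theorem pi_gaussian_univ {P : Mat p} (hP : P.PosDef) :
    ∫⁻ y : Node K D → Vec p, ENNReal.ofReal (∏ s, gaussianDensity 0 P (y s)) = 1 := by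
  have hprob := isProbabilityMeasure_gaussian hP 0
  have hint : Integrable (gaussianDensity 0 P) := by
    refine ⟨by fun_prop, ?_⟩
    rw [hasFiniteIntegral_iff_ofReal (.of_forall (gaussianDensity_nonneg 0 P))]
    have := hprob.measure_univ
    rw [gaussianMeasure, withDensity_apply _ .univ, Measure.restrict_univ] at this
    rw [this]; simp
  have h := pi_withDensity_ofReal (fun _ : Node K D => (volume : Measure (Vec p)))
    (f := fun _ => gaussianDensity 0 P) (fun _ => gaussianDensity_nonneg 0 P) fun _ => hint
  have h2 : Measure.pi (fun _ : Node K D => gaussianMeasure 0 P) Set.univ = 1 := measure_univ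
  simp only [gaussianMeasure] at h2
  rw [h, withDensity_apply _ .univ, Measure.restrict_univ] at h2
  exact h2

/-- In the increments the integrand is a product of Gaussian densities of precision L/2. Neither the
Jacobian nor the factor 2^(p/2) per node involves L, so one constant serves every L and the integral
over L can be taken afterwards. -/
theorem exists_lintegral_meanDensity (m₀ : Vec p) : ∃ C : ℝ≥0∞, C ≠ ∞ ∧ ∀ L : Mat p, L.PosDef →
    ∫⁻ μ : Node K D → Vec p, ENNReal.ofReal (meanDensity m₀ L μ *
      Real.exp (∑ s, 1 / 4 * quadForm L (μ s - parentVec m₀ μ s))) = C := by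
  refine ⟨ENNReal.ofReal (Real.sqrt (2 ^ p) ^ Fintype.card (Node K D)) *
    ENNReal.ofReal |(LinearMap.det (incrLinear K D p))⁻¹|, by finiteness, fun L hL => ?_⟩
  have hL2 : ((1 / 2 : ℝ) • L).PosDef := hL.smul (by norm_num)
  have hF : Measurable fun y : Node K D → Vec p =>
      ENNReal.ofReal (∏ s, gaussianDensity 0 ((1 / 2 : ℝ) • L) (y s)) := by fun_prop
  have h := lintegral_comp_linearMap_add (volume : Measure (Node K D → Vec p))
    (incrLinear_injective (K := K) (D := D) (p := p)) (fun t => if t = root then -m₀ else 0) hF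
  rw [pi_gaussian_univ hL2, mul_one] at h
  rw [← h, ← lintegral_const_mul' _ _ (by finiteness)]
  refine lintegral_congr fun μ => ?_
  rw [← ENNReal.ofReal_mul (by positivity), meanDensity, Real.exp_sum, ← Finset.prod_mul_distrib]
  simp_rw [gaussianDensity_mul_exp, Finset.prod_mul_distrib, sub_parentVec]
  simp

theorem pathProb_mem_Icc {π : Inner K D → Fin K → ℝ} (hπ : ∀ s k, π s k ∈ Set.Ioc 0 1)
    (z : TreePath K D) : pathProb π z ∈ Set.Icc 0 1 :=
  ⟨Finset.prod_nonneg fun s _ => Finset.prod_nonneg fun k _ => pow_nonneg (hπ s k).1.le _,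
    Finset.prod_le_one (fun s _ => Finset.prod_nonneg fun k _ => pow_nonneg (hπ s k).1.le _)
      fun s _ => Finset.prod_le_one (fun k _ => pow_nonneg (hπ s k).1.le _)
        fun k _ => pow_le_one₀ (hπ s k).1.le (hπ s k).2⟩

theorem edgeProb_mem_Icc {g : Inner K D → ℝ} (hg : ∀ s, g s ∈ Set.Ioo 0 1) (s : Node K D) :
    edgeProb g s ∈ Set.Icc 0 1 := by
  unfold edgeProb
  split_ifs with h
  · exact Set.Ioo_subset_Icc_self (hg _)
  · simp

theorem treeProb_mem_Icc {g : Inner K D → ℝ} (hg : ∀ s, g s ∈ Set.Ioo 0 1) (T : Subtree K D) :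
    treeProb g T ∈ Set.Icc 0 1 := by
  have h := edgeProb_mem_Icc hg
  have h1 (s) : 0 ≤ 1 - edgeProb g s := sub_nonneg.2 (h s).2
  have h2 (s) : 1 - edgeProb g s ≤ 1 := sub_le_self _ (h s).1
  exact ⟨mul_nonneg (Finset.prod_nonneg fun s _ => (h s).1) (Finset.prod_nonneg fun s _ => h1 s),
    mul_le_one₀ (Finset.prod_le_one (fun s _ => (h s).1) fun s _ => (h s).2)
      (Finset.prod_nonneg fun s _ => h1 s) (Finset.prod_le_one (fun s _ => h1 s) fun s _ => h2 s)⟩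

theorem gaussianDensity_le {P : Mat p} (hP : P.PosDef) (m x : Vec p) :
    gaussianDensity m P x ≤ Real.sqrt P.det := by
  have h := quadForm_nonneg hP (x - m)
  have h1 : Real.exp (-(1 / 2) * ((x - m) ⬝ᵥ (P *ᵥ (x - m)))) ≤ 1 := by
    rw [Real.exp_le_one_iff]; unfold quadForm at h; linarith
  refine (mul_le_of_le_one_right (Real.sqrt_nonneg _) h1).trans (Real.sqrt_le_sqrt ?_)
  refine div_le_self hP.det_pos.le (one_le_pow₀ ?_)
  linarith [Real.pi_gt_three]

theorem dataDensity_nonneg (z : TreePath K D) (T : Subtree K D) (μ : Node K D → Vec p)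
    (Λ : Node K D → Mat p) (x : Vec p) : 0 ≤ dataDensity z T μ Λ x :=
  Finset.prod_nonneg fun _ _ => pow_nonneg (gaussianDensity_nonneg _ _ _) _

/-- The factor 1 + √det covers both cases of a node: absent from the product, or present with a
Gaussian density bounded by √det. -/
theorem dataDensity_le {Λ : Node K D → Mat p} (hΛ : ∀ s, (Λ s).PosDef) (z : TreePath K D)
    (T : Subtree K D) (μ : Node K D → Vec p) (x : Vec p) :
    dataDensity z T μ Λ x ≤ ∏ s, (1 + Real.sqrt (Λ s).det) := by
  simp only [dataDensity, Finset.prod_filter]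
  have h (s) := gaussianDensity_le (hΛ s) (μ s) x
  have h0 (s) := gaussianDensity_nonneg (μ s) (Λ s) x
  refine Finset.prod_le_prod (fun s _ => ?_) fun s _ => ?_
  · split_ifs <;> simp [h0]
  · have := Real.sqrt_nonneg (Λ s).det
    split_ifs <;> simp
    linarith [h s]

theorem jointDensity_le (M : Hyper K D p) (x : Fin n → Vec p) {ω : Latent K D p n}
    (h : IsGood ω) : jointDensity M x ω ≤ meanDensity M.m₀ ω.2.2.2.2.2.2 ω.2.2.2.2.1 *
      ∏ s, (1 + Real.sqrt (ω.2.2.2.2.2.1 s).det) ^ n := by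
  obtain ⟨h1, h2, h3, h4⟩ := h
  have e1 : 0 ≤ meanDensity M.m₀ ω.2.2.2.2.2.2 ω.2.2.2.2.1 :=
    Finset.prod_nonneg fun _ _ => gaussianDensity_nonneg _ _ _
  have e2 : ∏ i, dataDensity (ω.1 i) (ω.2.1 i) ω.2.2.2.2.1 ω.2.2.2.2.2.1 (x i) ≤
      ∏ s, (1 + Real.sqrt (ω.2.2.2.2.2.1 s).det) ^ n := by
    rw [Finset.prod_pow]
    refine (Finset.prod_le_prod (fun i _ => dataDensity_nonneg _ _ _ _ _)
      fun i _ => dataDensity_le h3 _ _ _ _).trans ?_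
    simp
  have e3 : (∏ i, pathProb ω.2.2.1 (ω.1 i)) * (∏ i, treeProb ω.2.2.2.1 (ω.2.1 i)) ≤ 1 :=
    mul_le_one₀ (Finset.prod_le_one (fun i _ => (pathProb_mem_Icc h1 _).1)
      fun i _ => (pathProb_mem_Icc h1 _).2)
      (Finset.prod_nonneg fun i _ => (treeProb_mem_Icc h2 _).1)
      (Finset.prod_le_one (fun i _ => (treeProb_mem_Icc h2 _).1)
      fun i _ => (treeProb_mem_Icc h2 _).2)
  have e4 : 0 ≤ ∏ i, dataDensity (ω.1 i) (ω.2.1 i) ω.2.2.2.2.1 ω.2.2.2.2.2.1 (x i) :=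
    Finset.prod_nonneg fun _ _ => dataDensity_nonneg _ _ _ _ _
  unfold jointDensity
  calc _ ≤ 1 * meanDensity M.m₀ ω.2.2.2.2.2.2 ω.2.2.2.2.1 * _ := by gcongr
    _ ≤ _ := by rw [one_mul]; gcongr

end ExponentialMoments

/-! ### Integrability under q deduced from the finite divergence -/

section FiniteMoments

@[fun_prop]
theorem measurable_trace {Ω : Type*} [MeasurableSpace Ω] {P : Ω → Mat p} (hP : Measurable P) :
    Measurable fun ω => (P ω).trace := by
  simp only [Matrix.trace, Matrix.diag]
  exact Finset.measurable_sum _ fun i _ => (measurable_entry i i).comp hP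

/-- The n-th power is at most 2^(n-1) (1 + det^(n/2)), and a small multiple of the trace is absorbed
because W⁻¹ - c I stays positive definite for some c > 0. -/
theorem exists_integrable_wishart {ν : ℝ} {W : Mat p} (hν : (p : ℝ) - 1 < ν) (hW : W.PosDef)
    (n : ℕ) : ∃ ε > 0, Integrable (fun Λ : Mat p => (1 + Real.sqrt Λ.det) ^ n *
      Real.exp (ε * Λ.trace)) (wishartMeasure ν W) := by
  obtain ⟨c, hc, h⟩ := exists_sub_smul_one_posDef hW.inv
  have hdet := measurable_det (p := p)
  have key (k : ℝ) (hk : 0 ≤ k) : Integrable (fun Λ : Mat p => Λ.det ^ k *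
      Real.exp (c / 2 * Λ.trace)) (wishartMeasure ν W) := by
    refine ⟨by fun_prop, ?_⟩
    rw [hasFiniteIntegral_iff_ofReal]
    · have := lintegral_wishart_lt_top (ν := ν) (k := k) (by linarith) h
      convert this using 6
      simp only [Matrix.smul_mul, one_mul, Matrix.trace_smul, smul_eq_mul]; ring
    · filter_upwards [ae_posDef_wishart hν hW] with Λ hΛ
      have := hΛ.det_pos.le
      simp only [Pi.zero_apply]
      positivity
  refine ⟨c / 2, by positivity,
    (((key 0 le_rfl).add (key (n / 2) (by positivity))).const_mul (2 ^ (n - 1))).mono'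
      (by fun_prop) ?_⟩
  filter_upwards [ae_posDef_wishart hν hW] with Λ hΛ
  have h0 := hΛ.det_pos.le
  rw [Real.norm_of_nonneg (by positivity)]
  have h1 := add_pow_le zero_le_one (Real.sqrt_nonneg Λ.det) n
  have h2 : Real.sqrt Λ.det ^ n = Λ.det ^ ((n : ℝ) / 2) := by
    rw [Real.sqrt_eq_rpow, ← Real.rpow_mul_natCast h0]; congr 1; ring
  rw [one_pow, h2] at h1
  simp only [Pi.add_apply, Real.rpow_zero]
  rw [← add_mul, ← mul_assoc]
  gcongr

theorem lintegral_comp_snd_lt_top {A B : Type*} [MeasurableSpace A] [MeasurableSpace B]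
    {a : Measure A} [IsFiniteMeasure a] {b : Measure B} [SFinite b] {f : B → ℝ≥0∞}
    (hf : Measurable f) (h : ∫⁻ y, f y ∂b < ∞) : ∫⁻ z, f z.2 ∂(a.prod b) < ∞ := by
  rw [← lintegral_map hf measurable_snd, Measure.map_snd_prod, lintegral_smul_measure]
  exact ENNReal.mul_lt_top (measure_lt_top _ _) h

/-- Disposes of the components z, T, π, g, whose base measures are finite. -/
theorem lintegral_comp_snd₄_lt_top {A₁ A₂ A₃ A₄ B : Type*} [MeasurableSpace A₁]
    [MeasurableSpace A₂] [MeasurableSpace A₃] [MeasurableSpace A₄] [MeasurableSpace B]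
    {a₁ : Measure A₁} {a₂ : Measure A₂} {a₃ : Measure A₃} {a₄ : Measure A₄} [IsFiniteMeasure a₁]
    [IsFiniteMeasure a₂] [IsFiniteMeasure a₃] [IsFiniteMeasure a₄] {b : Measure B} [SFinite b]
    {f : B → ℝ≥0∞} (hf : Measurable f) (h : ∫⁻ y, f y ∂b < ∞) :
    ∫⁻ z, f z.2.2.2.2 ∂(a₁.prod (a₂.prod (a₃.prod (a₄.prod b)))) < ∞ :=
  lintegral_comp_snd_lt_top (by fun_prop) <| lintegral_comp_snd_lt_top (by fun_prop) <|
    lintegral_comp_snd_lt_top (by fun_prop) <| lintegral_comp_snd_lt_top hf h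

/-- The exponent whose exponential moment controls the variational distributions. -/
def momentFun (m₀ : Vec p) (ε : Node K D → ℝ) (δ : ℝ)
    (v : (Node K D → Vec p) × (Node K D → Mat p) × Mat p) : ℝ :=
  (∑ s, ε s * (v.2.1 s).trace) + δ * v.2.2.trace +
    ∑ s, 1 / 4 * quadForm v.2.2 (v.1 s - parentVec m₀ v.1 s)

@[fun_prop]
theorem measurable_momentFun (m₀ : Vec p) (ε : Node K D → ℝ) (δ : ℝ) :
    Measurable (momentFun m₀ ε δ) := by
  have h (s : Node K D) : Measurable fun v : (Node K D → Vec p) × (Node K D → Mat p) × Mat p =>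
      parentVec m₀ v.1 s := (measurable_parentVec _ s).comp (by fun_prop)
  unfold momentFun
  fun_prop

theorem lintegral_jointBase_lt_top [NeZero K] {M : Hyper K D p}
    {f : (Node K D → Vec p) × (Node K D → Mat p) × Mat p → ℝ≥0∞} (hf : Measurable f)
    (h : ∫⁻ v, f v ∂((Measure.pi fun _ : Node K D => (volume : Measure (Vec p))).prod
      ((Measure.pi fun s => wishartMeasure (M.ν s) (M.W s)).prod (wishartMeasure M.u M.V))) < ∞) :
    ∫⁻ ω, f ω.2.2.2.2 ∂(jointBase n M) < ∞ :=
  lintegral_comp_snd₄_lt_top hf h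

theorem exists_lintegral_exp_momentFun_lt_top [NeZero K] (M : Hyper K D p) (x : Fin n → Vec p) :
    ∃ (ε : Node K D → ℝ) (δ : ℝ), (∀ s, 0 < ε s) ∧ 0 < δ ∧
      ∫⁻ ω, ENNReal.ofReal (Real.exp (momentFun M.m₀ ε δ ω.2.2.2.2)) *
        ENNReal.ofReal (jointDensity M x ω) ∂(jointBase n M) < ∞ := by
  choose ε hε hεi using fun s => exists_integrable_wishart (M.ν_gt s) (M.W_posDef s) n
  obtain ⟨δ, hδ, hδi⟩ := exists_integrable_wishart M.u_gt M.V_posDef 0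
  simp only [pow_zero, one_mul] at hδi
  obtain ⟨C, hC, hCL⟩ := exists_lintegral_meanDensity (K := K) (D := D) M.m₀
  refine ⟨ε, δ, hε, hδ, ?_⟩
  set F : (Node K D → Mat p) → ℝ := fun Λ =>
    ∏ s, ((1 + Real.sqrt (Λ s).det) ^ n * Real.exp (ε s * (Λ s).trace)) with hF
  have hFi : Integrable F (Measure.pi fun s => wishartMeasure (M.ν s) (M.W s)) :=
    Integrable.fintype_prod_dep hεi
  set f : (Node K D → Vec p) × (Node K D → Mat p) × Mat p → ℝ≥0∞ := fun v =>
    ENNReal.ofReal (F v.2.1 * Real.exp (δ * v.2.2.trace)) *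
      ENNReal.ofReal (meanDensity M.m₀ v.2.2 v.1 *
        Real.exp (∑ s, 1 / 4 * quadForm v.2.2 (v.1 s - parentVec M.m₀ v.1 s))) with hf
  have hfm : Measurable f := by
    have h (s : Node K D) : Measurable fun v : (Node K D → Vec p) × (Node K D → Mat p) × Mat p =>
        parentVec M.m₀ v.1 s := (measurable_parentVec _ s).comp (by fun_prop)
    have h2 (s : Node K D) : Measurable fun v : (Node K D → Vec p) × (Node K D → Mat p) × Mat p =>
        (v.2.1 s).det := measurable_det.comp (by fun_prop)
    simp only [hf, hF, meanDensity]
    fun_prop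
  have hfi : ∫⁻ v, f v ∂((Measure.pi fun _ : Node K D => (volume : Measure (Vec p))).prod
      ((Measure.pi fun s => wishartMeasure (M.ν s) (M.W s)).prod (wishartMeasure M.u M.V))) < ∞ := by
    rw [lintegral_prod_symm' _ hfm]
    -- Integrating μ first leaves the constant C for every positive definite L; the rest is a
    -- product of Wishart moments.
    have h1 : ∀ᵐ y ∂((Measure.pi fun s => wishartMeasure (M.ν s) (M.W s)).prod
        (wishartMeasure M.u M.V)), ∫⁻ μ, f (μ, y) ∂(Measure.pi fun _ => volume) =
          ENNReal.ofReal (F y.1 * Real.exp (δ * y.2.trace)) * C := by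
      filter_upwards [Measure.quasiMeasurePreserving_snd.ae (p := fun f : Mat p => f.PosDef)
        (ae_posDef_wishart M.u_gt M.V_posDef)] with y hy
      simp only [hf]
      rw [lintegral_const_mul' _ _ (by finiteness)]
      congr 1
      exact hCL _ hy
    rw [lintegral_congr_ae h1, lintegral_mul_const' _ _ hC]
    refine ENNReal.mul_lt_top ?_ hC.lt_top
    exact (Integrable.mul_prod hFi hδi).lintegral_lt_top
  have hfω := lintegral_jointBase_lt_top (n := n) hfm hfi
  refine lt_of_le_of_lt (lintegral_mono_ae ?_) hfω
  filter_upwards [ae_isGood M] with ω hω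
  have hle := jointDensity_le M x hω
  simp only [hf, hF]
  rw [← ENNReal.ofReal_mul (by positivity), ← ENNReal.ofReal_mul (by positivity)]
  refine ENNReal.ofReal_le_ofReal ?_
  refine (mul_le_mul_of_nonneg_left hle (Real.exp_pos _).le).trans (le_of_eq ?_)
  rw [momentFun, Real.exp_add, Real.exp_add, Real.exp_sum, Finset.prod_mul_distrib]
  ring

instance (q : MeanField K D p n) : IsProbabilityMeasure q.toMeasure := by
  unfold MeanField.toMeasure; infer_instance

variable [NeZero K] {M : Hyper K D p} {x : Fin n → Vec p} {q : MeanField K D p n}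

theorem mass_of_KL_ne_top (hq : KL M x q ≠ ∞) :
    jointMeasure M x Set.univ ≠ 0 ∧ jointMeasure M x Set.univ ≠ ∞ := by
  have hne : posterior M x ≠ 0 := by
    intro h
    rw [KL, h] at hq
    exact hq klDiv_zero_right
  exact ⟨fun h => hne (normalized_eq_zero_of_univ_eq_zero h),
    fun h => hne (normalized_eq_zero_of_univ_eq_top h)⟩

theorem posterior_ac : posterior M x ≪ jointBase n M :=
  (Measure.smul_absolutelyContinuous).trans (withDensity_absolutelyContinuous _ _)

theorem ac_posterior (hq : KL M x q ≠ ∞) : q.toMeasure ≪ posterior M x := by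
  by_contra h
  exact hq (klDiv_of_not_ac h)

theorem ae_isGood_meanField (hq : KL M x q ≠ ∞) : ∀ᵐ ω ∂q.toMeasure, IsGood ω :=
  ((ac_posterior hq).trans posterior_ac).ae_le (ae_isGood M)

/-- Young's inequality transfers the exponential moment under the posterior to a first moment under
q. As the function is nonnegative at good points, this is integrability. -/
theorem exists_integrable_momentFun (hq : KL M x q ≠ ∞) :
    ∃ (ε : Node K D → ℝ) (δ : ℝ), (∀ s, 0 < ε s) ∧ 0 < δ ∧
      Integrable (fun ω => momentFun M.m₀ ε δ ω.2.2.2.2) q.toMeasure := by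
  obtain ⟨ε, δ, hε, hδ, h⟩ := exists_lintegral_exp_momentFun_lt_top M x
  obtain ⟨h0, htop⟩ := mass_of_KL_ne_top hq
  have hprob : IsProbabilityMeasure (posterior M x) := isProbabilityMeasure_normalized h0 htop
  have hm : Measurable fun ω : Latent K D p n => momentFun M.m₀ ε δ ω.2.2.2.2 := by fun_prop
  refine ⟨ε, δ, hε, hδ, hm.aestronglyMeasurable, ?_⟩
  rw [hasFiniteIntegral_iff_ofReal]
  · refine (lintegral_le_klDiv_add_lintegral_exp (ac_posterior hq) hm).trans_lt ?_
    refine ENNReal.add_lt_top.2 ⟨Ne.lt_top hq, ?_⟩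
    rw [posterior, normalized, lintegral_smul_measure]
    refine ENNReal.mul_lt_top (by simpa [pos_iff_ne_zero] using h0) ?_
    rw [jointMeasure_eq, withDensity_congr_ae (jointDensity_ae_eq M x),
      lintegral_withDensity_eq_lintegral_mul _
        (by have := measurable_logJoint M x; fun_prop) (by fun_prop)]
    refine lt_of_eq_of_lt (lintegral_congr_ae ?_) h
    filter_upwards [jointDensity_ae_eq M x] with ω hω
    rw [Pi.mul_apply, hω, mul_comm]
  · filter_upwards [ae_isGood_meanField hq] with ω hω
    refine add_nonneg (add_nonneg (Finset.sum_nonneg fun s _ => ?_) ?_)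
      (Finset.sum_nonneg fun s _ => ?_)
    · exact mul_nonneg (hε s).le (hω.2.2.1 s).posSemidef.trace_nonneg
    · exact mul_nonneg hδ.le hω.2.2.2.posSemidef.trace_nonneg
    · exact mul_nonneg (by norm_num) (quadForm_nonneg hω.2.2.2 _)

theorem integrable_traces (hq : KL M x q ≠ ∞) :
    (∀ s, Integrable (fun ω => (ω.2.2.2.2.2.1 s).trace) q.toMeasure) ∧
    Integrable (fun ω => ω.2.2.2.2.2.2.trace) q.toMeasure ∧
    ∀ s, Integrable (fun ω => quadForm ω.2.2.2.2.2.2 (ω.2.2.2.2.1 s -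
      parentVec M.m₀ ω.2.2.2.2.1 s)) q.toMeasure := by
  obtain ⟨ε, δ, hε, hδ, h⟩ := exists_integrable_momentFun hq
  have hgood := ae_isGood_meanField hq
  have hp (s : Node K D) : Measurable fun ω : Latent K D p n => parentVec M.m₀ ω.2.2.2.2.1 s :=
    (measurable_parentVec _ s).comp (by fun_prop)
  -- All summands of `momentFun` are nonnegative at good points, so each is dominated by the whole.
  have key : ∀ᵐ ω ∂q.toMeasure, (∀ s, ‖(ω.2.2.2.2.2.1 s).trace‖ ≤
        (ε s)⁻¹ * momentFun M.m₀ ε δ ω.2.2.2.2) ∧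
      ‖ω.2.2.2.2.2.2.trace‖ ≤ δ⁻¹ * momentFun M.m₀ ε δ ω.2.2.2.2 ∧
      ∀ s, ‖quadForm ω.2.2.2.2.2.2 (ω.2.2.2.2.1 s - parentVec M.m₀ ω.2.2.2.2.1 s)‖ ≤
        4 * momentFun M.m₀ ε δ ω.2.2.2.2 := by
    filter_upwards [hgood] with ω hω
    have h1 (s) : 0 ≤ ε s * (ω.2.2.2.2.2.1 s).trace :=
      mul_nonneg (hε s).le (hω.2.2.1 s).posSemidef.trace_nonneg
    have h2 : 0 ≤ δ * ω.2.2.2.2.2.2.trace :=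
      mul_nonneg hδ.le hω.2.2.2.posSemidef.trace_nonneg
    have h3 (s) : 0 ≤ 1 / 4 * quadForm ω.2.2.2.2.2.2 (ω.2.2.2.2.1 s -
        parentVec M.m₀ ω.2.2.2.2.1 s) := mul_nonneg (by norm_num) (quadForm_nonneg hω.2.2.2 _)
    have s1 := Finset.sum_nonneg fun s (_ : s ∈ Finset.univ) => h1 s
    have s3 := Finset.sum_nonneg fun s (_ : s ∈ Finset.univ) => h3 s
    refine ⟨fun s => ?_, ?_, fun s => ?_⟩
    · rw [Real.norm_of_nonneg (hω.2.2.1 s).posSemidef.trace_nonneg, ← div_eq_inv_mul,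
        le_div_iff₀ (hε s), mul_comm]
      have := Finset.single_le_sum (fun s _ => h1 s) (Finset.mem_univ s)
      unfold momentFun; linarith
    · rw [Real.norm_of_nonneg hω.2.2.2.posSemidef.trace_nonneg, ← div_eq_inv_mul,
        le_div_iff₀ hδ, mul_comm]
      unfold momentFun; linarith
    · rw [Real.norm_of_nonneg (quadForm_nonneg hω.2.2.2 _)]
      have := Finset.single_le_sum (fun s _ => h3 s) (Finset.mem_univ s)
      unfold momentFun; linarith
  refine ⟨fun s => (h.const_mul _).mono' (Measurable.aestronglyMeasurable (by fun_prop)) (key.mono fun ω hω => hω.1 s),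
    (h.const_mul _).mono' (Measurable.aestronglyMeasurable (by fun_prop)) (key.mono fun ω hω => hω.2.1),
    fun s => (h.const_mul _).mono' (Measurable.aestronglyMeasurable (by fun_prop)) (key.mono fun ω hω => hω.2.2 s)⟩

end FiniteMoments

/-! ### Entries and mean of a random positive definite matrix -/

section MatrixMoments

/-- Testing the quadratic form on e_i + e_j and e_i - e_j gives 2 |A_ij| ≤ A_ii + A_jj. -/
theorem abs_entry_le_trace {A : Mat p} (hA : A.PosDef) (i j : Fin p) : |A i j| ≤ A.trace := by
  have h := (posSemidef_iff_real.1 hA.posSemidef).2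
  have hs : A j i = A i j := by simpa using hA.isHermitian.apply i j
  have h1 := h (Pi.single i 1 + Pi.single j 1)
  have h2 := h (Pi.single i 1 - Pi.single j 1)
  have hd (k : Fin p) : 0 ≤ A k k := by simpa using h (Pi.single k 1)
  have ht (k : Fin p) : A k k ≤ A.trace :=
    Finset.single_le_sum (f := fun k => A k k) (fun k _ => hd k) (Finset.mem_univ k)
  simp only [Matrix.mulVec_add, Matrix.mulVec_sub, Matrix.mulVec_single_one, dotProduct_add,
    add_dotProduct, dotProduct_sub, sub_dotProduct, single_dotProduct, Matrix.col_apply, hs,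
    one_mul] at h1 h2
  rw [abs_le]
  constructor <;> linarith [ht i, ht j]

variable {m : Measure (Mat p)}

theorem integrable_entry_of_trace (hm : ∀ᵐ A ∂m, A.PosDef)
    (ht : Integrable (fun A : Mat p => A.trace) m) (i j : Fin p) :
    Integrable (fun A : Mat p => A i j) m :=
  ht.mono' (measurable_entry i j).aestronglyMeasurable
    (hm.mono fun _ hA => abs_entry_le_trace hA i j)

/-- The quadratic form of the mean at x ≠ 0 is the integral of an almost everywhere strictly
positive function. -/
theorem posDef_matMean [IsProbabilityMeasure m] (hm : ∀ᵐ A ∂m, A.PosDef)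
    (hi : ∀ i j, Integrable (fun A : Mat p => A i j) m) : (matMean m).PosDef := by
  refine Matrix.posDef_iff_dotProduct_mulVec.2 ⟨?_, fun {x} hx => ?_⟩
  · ext i j
    simp only [Matrix.conjTranspose_apply, matMean, Matrix.of_apply, star_trivial]
    refine integral_congr_ae (hm.mono fun A hA => ?_)
    simpa using hA.isHermitian.apply i j
  · have hint : Integrable (fun A : Mat p => quadForm A x) m := by
      simp only [quadForm_eq_sum]
      exact integrable_finsetSum _ fun i _ => integrable_finsetSum _ fun j _ =>
        ((hi i j).const_mul _).mul_const _
    have e : star x ⬝ᵥ (matMean m *ᵥ x) = ∫ A, quadForm A x ∂m := by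
      rw [star_trivial]
      change quadForm (matMean m) x = _
      simp only [quadForm_eq_sum]
      rw [integral_finsetSum _ fun i _ => integrable_finsetSum _ fun j _ =>
        ((hi i j).const_mul _).mul_const _]
      refine Finset.sum_congr rfl fun i _ => ?_
      rw [integral_finsetSum _ fun j _ => ((hi i j).const_mul _).mul_const _]
      refine Finset.sum_congr rfl fun j _ => ?_
      rw [integral_mul_const, integral_const_mul]
      rfl
    rw [e, integral_pos_iff_support_of_nonneg_ae (hm.mono fun A hA => quadForm_nonneg hA x) hint]
    have : (Function.support fun A : Mat p => quadForm A x) =ᵐ[m] Set.univ := by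
      refine Filter.eventuallyEq_univ.2 ?_
      filter_upwards [hm] with A hA
      have := (Matrix.posDef_iff_dotProduct_mulVec.1 hA).2 hx
      exact ne_of_gt (by simpa [quadForm] using this)
    rw [measure_congr this, measure_univ]
    exact zero_lt_one

end MatrixMoments

/-! ### Marginals of a mean-field distribution -/

section Marginals

variable (q : MeanField K D p n)

theorem measurePreserving_z (i : Fin n) :
    MeasurePreserving (fun ω : Latent K D p n => ω.1 i) q.toMeasure (q.z i) :=
  (measurePreserving_eval (fun i => (q.z i : Measure (TreePath K D))) i).comp
    measurePreserving_fst

theorem measurePreserving_rest : MeasurePreserving (fun ω : Latent K D p n => ω.2.2.2.2) q.toMeasure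
    ((Measure.pi fun s => (q.μ s : Measure (Vec p))).prod <|
      (Measure.pi fun s => (q.Λ s : Measure (Mat p))).prod (q.L : Measure (Mat p))) :=
  measurePreserving_snd.comp <| measurePreserving_snd.comp <| measurePreserving_snd.comp <|
    measurePreserving_snd

theorem measurePreserving_T (i : Fin n) :
    MeasurePreserving (fun ω : Latent K D p n => ω.2.1 i) q.toMeasure (q.T i) :=
  (measurePreserving_eval (fun i => (q.T i : Measure (Subtree K D))) i).comp <|
    measurePreserving_fst.comp measurePreserving_snd

theorem measurePreserving_pi (s : Inner K D) :
    MeasurePreserving (fun ω : Latent K D p n => ω.2.2.1 s) q.toMeasure (q.π s) :=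
  (measurePreserving_eval (fun s => (q.π s : Measure (Fin K → ℝ))) s).comp <|
    measurePreserving_fst.comp <| measurePreserving_snd.comp measurePreserving_snd

theorem measurePreserving_lambda (s : Node K D) :
    MeasurePreserving (fun ω : Latent K D p n => ω.2.2.2.2.2.1 s) q.toMeasure (q.Λ s) :=
  (measurePreserving_eval (fun s => (q.Λ s : Measure (Mat p))) s).comp <|
    measurePreserving_fst.comp <| measurePreserving_snd.comp (measurePreserving_rest q)

theorem measurePreserving_L :
    MeasurePreserving (fun ω : Latent K D p n => ω.2.2.2.2.2.2) q.toMeasure q.L :=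
  measurePreserving_snd.comp <| measurePreserving_snd.comp (measurePreserving_rest q)

theorem measurePreserving_mu_L :
    MeasurePreserving (fun ω : Latent K D p n => (ω.2.2.2.2.1, ω.2.2.2.2.2.2)) q.toMeasure
      ((Measure.pi fun s => (q.μ s : Measure (Vec p))).prod (q.L : Measure (Mat p))) :=
  ((MeasurePreserving.id _).prod measurePreserving_snd).comp (measurePreserving_rest q)

end Marginals

/-! ### Moments of the individual factors -/

section FactorMoments

variable [NeZero K] {M : Hyper K D p} {x : Fin n → Vec p} {q : MeanField K D p n}

theorem ae_posDef_lambda (hq : KL M x q ≠ ∞) (s : Node K D) :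
    ∀ᵐ A ∂(q.Λ s : Measure (Mat p)), A.PosDef := by
  rw [← (measurePreserving_lambda q s).map_eq,
    ae_map_iff (measurePreserving_lambda q s).aemeasurable measurableSet_posDef]
  exact (ae_isGood_meanField hq).mono fun ω hω => hω.2.2.1 s

theorem ae_posDef_L (hq : KL M x q ≠ ∞) : ∀ᵐ A ∂(q.L : Measure (Mat p)), A.PosDef := by
  rw [← (measurePreserving_L q).map_eq,
    ae_map_iff (measurePreserving_L q).aemeasurable measurableSet_posDef]
  exact (ae_isGood_meanField hq).mono fun ω hω => hω.2.2.2

theorem integrable_lambda_entry (hq : KL M x q ≠ ∞) (s : Node K D) (i j : Fin p) :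
    Integrable (fun A : Mat p => A i j) (q.Λ s : Measure (Mat p)) :=
  integrable_entry_of_trace (ae_posDef_lambda hq s)
    (((measurePreserving_lambda q s).integrable_comp
      (g := fun A : Mat p => A.trace) (Measurable.aestronglyMeasurable (by fun_prop))).1
      ((integrable_traces hq).1 s)) i j

theorem integrable_L_entry (hq : KL M x q ≠ ∞) (i j : Fin p) :
    Integrable (fun A : Mat p => A i j) (q.L : Measure (Mat p)) :=
  integrable_entry_of_trace (ae_posDef_L hq)
    (((measurePreserving_L q).integrable_comp
      (g := fun A : Mat p => A.trace) (Measurable.aestronglyMeasurable (by fun_prop))).1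
      (integrable_traces hq).2.1) i j

theorem integrable_quadForm_mu_L (hq : KL M x q ≠ ∞) (s : Node K D) :
    Integrable (fun v : (Node K D → Vec p) × Mat p => quadForm v.2 (v.1 s - parentVec M.m₀ v.1 s))
      ((Measure.pi fun s => (q.μ s : Measure (Vec p))).prod (q.L : Measure (Mat p))) := by
  have hpL : Measurable fun v : (Node K D → Vec p) × Mat p => parentVec M.m₀ v.1 s :=
    (measurable_parentVec M.m₀ s).comp measurable_fst
  have hm : Measurable fun v : (Node K D → Vec p) × Mat p =>
    quadForm v.2 (v.1 s - parentVec M.m₀ v.1 s) := by fun_prop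
  exact ((measurePreserving_mu_L q).integrable_comp hm.aestronglyMeasurable).1
    ((integrable_traces hq).2.2 s)

theorem memLp_two_of_integrable_quadForm {Ω : Type*} [MeasurableSpace Ω] {m : Measure Ω}
    {L : Mat p} (hL : L.PosDef) {y : Ω → Vec p} (hy : Measurable y)
    (h : Integrable (fun ω => quadForm L (y ω)) m) (j : Fin p) : MemLp (fun ω => y ω j) 2 m := by
  obtain ⟨c, hc, hcL⟩ := exists_pos_mul_dotProduct_le hL
  have hm : Measurable fun ω => y ω j := by fun_prop
  refine (memLp_two_iff_integrable_sq hm.aestronglyMeasurable).2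
    ((h.const_mul c⁻¹).mono' (hm.pow_const 2).aestronglyMeasurable (.of_forall fun ω => ?_))
  rw [Real.norm_of_nonneg (sq_nonneg _), ← div_eq_inv_mul, le_div_iff₀ hc, mul_comm]
  refine le_trans ?_ (hcL (y ω))
  refine mul_le_mul_of_nonneg_left ?_ hc.le
  rw [sq]
  exact Finset.single_le_sum (f := fun j => y ω j * y ω j) (fun j _ => mul_self_nonneg _)
    (Finset.mem_univ j)

/-- By Fubini the quadratic form in the increment is integrable over μ for almost every L. A single
such positive definite L suffices, since its form dominates a multiple of the squared norm. -/
theorem memLp_incr (hq : KL M x q ≠ ∞) (s : Node K D) (j : Fin p) :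
    MemLp (fun μ : Node K D → Vec p => (μ s - parentVec M.m₀ μ s) j) 2
      (Measure.pi fun s => (q.μ s : Measure (Vec p))) := by
  have hp := measurable_parentVec M.m₀ s
  obtain ⟨L, h2, hL⟩ := ((integrable_quadForm_mu_L hq s).prod_left_ae.and (ae_posDef_L hq)).exists
  exact memLp_two_of_integrable_quadForm hL (by fun_prop) h2 j

/-- The increment at the root is taken from a constant vector; each further node adds a square
integrable increment to its parent. -/
theorem memLp_mu_pi (hq : KL M x q ≠ ∞) (s : Node K D) (j : Fin p) :
    MemLp (fun μ : Node K D → Vec p => μ s j) 2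
      (Measure.pi fun s => (q.μ s : Measure (Vec p))) := by
  induction s using node_induction with
  | h0 =>
    have h := (memLp_incr hq root j).add (memLp_const (M.m₀ j))
    refine h.ae_eq (.of_forall fun μ => ?_)
    simp [parentVec]
  | h s hs ih =>
    refine ((memLp_incr hq s j).add ih).ae_eq (.of_forall fun μ => ?_)
    simp [parentVec, hs]

theorem memLp_mu (hq : KL M x q ≠ ∞) (s : Node K D) (j : Fin p) :
    MemLp (fun v : Vec p => v j) 2 (q.μ s : Measure (Vec p)) := by
  have h := measurePreserving_eval (fun s => (q.μ s : Measure (Vec p))) s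
  rw [← h.map_eq, memLp_map_measure_iff (measurable_pi_apply j).aestronglyMeasurable h.aemeasurable]
  exact memLp_mu_pi hq s j

theorem integrable_mu (hq : KL M x q ≠ ∞) (s : Node K D) (j : Fin p) :
    Integrable (fun v : Vec p => v j) (q.μ s : Measure (Vec p)) :=
  (memLp_mu hq s j).integrable (by norm_num)

end FactorMoments

/-! ### A calculus of integrability with known expectation -/

section Expectations

/-- `f` is integrable with expectation `c`. -/
def HasExp {Ω : Type*} [MeasurableSpace Ω] (m : Measure Ω) (f : Ω → ℝ) (c : ℝ) : Prop :=
  Integrable f m ∧ ∫ ω, f ω ∂m = c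

namespace HasExp

variable {A B ι : Type*} [MeasurableSpace A] [MeasurableSpace B] {a : Measure A} {b : Measure B}
  {f g : A → ℝ} {c d : ℝ}

theorem add (hf : HasExp a f c) (hg : HasExp a g d) : HasExp a (fun x => f x + g x) (c + d) :=
  ⟨hf.1.add hg.1, by rw [integral_add hf.1 hg.1, hf.2, hg.2]⟩

theorem sub (hf : HasExp a f c) (hg : HasExp a g d) : HasExp a (fun x => f x - g x) (c - d) :=
  ⟨hf.1.sub hg.1, by rw [integral_sub hf.1 hg.1, hf.2, hg.2]⟩

theorem const_mul (hf : HasExp a f c) (k : ℝ) : HasExp a (fun x => k * f x) (k * c) :=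
  ⟨hf.1.const_mul k, by rw [integral_const_mul, hf.2]⟩

theorem mul_const (hf : HasExp a f c) (k : ℝ) : HasExp a (fun x => f x * k) (c * k) :=
  ⟨hf.1.mul_const k, by rw [integral_mul_const, hf.2]⟩

theorem sum {s : Finset ι} {f : ι → A → ℝ} {c : ι → ℝ} (hf : ∀ i, HasExp a (f i) (c i)) :
    HasExp a (fun x => ∑ i ∈ s, f i x) (∑ i ∈ s, c i) :=
  ⟨integrable_finsetSum _ fun i _ => (hf i).1, by
    rw [integral_finsetSum _ fun i _ => (hf i).1]
    exact Finset.sum_congr rfl fun i _ => (hf i).2⟩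

theorem const [IsProbabilityMeasure a] (k : ℝ) : HasExp a (fun _ => k) k :=
  ⟨integrable_const k, by simp⟩

theorem comp {g : B → ℝ} (hg : HasExp b g c) {φ : A → B} (h : MeasurePreserving φ a b) :
    HasExp a (fun x => g (φ x)) c :=
  ⟨h.integrable_comp_of_integrable hg.1, by
    rw [← hg.2, ← h.map_eq, integral_map h.aemeasurable (by rw [h.map_eq]; exact hg.1.1)]⟩

theorem mul_prod [SFinite a] [SFinite b] {g : B → ℝ} (hf : HasExp a f c) (hg : HasExp b g d) :
    HasExp (a.prod b) (fun x => f x.1 * g x.2) (c * d) :=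
  ⟨hf.1.mul_prod hg.1, by rw [integral_prod_mul, hf.2, hg.2]⟩

theorem of_eq (hf : HasExp a f c) (hfg : ∀ x, f x = g x) (hcd : c = d) : HasExp a g d := by
  rwa [← funext hfg, ← hcd]

theorem congr_ae (hf : HasExp a f c) (hfg : f =ᵐ[a] g) : HasExp a g c :=
  ⟨hf.1.congr hfg, by rw [← integral_congr_ae hfg, hf.2]⟩

end HasExp

theorem hasExp_of_integrable {A : Type*} [MeasurableSpace A] {a : Measure A} {f : A → ℝ}
    (hf : Integrable f a) : HasExp a f (∫ x, f x ∂a) := ⟨hf, rfl⟩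

variable (q : MeanField K D p n)

/-- The law of `(μ, Λ, L)`. -/
def MeanField.gaussianPart : Measure ((Node K D → Vec p) × (Node K D → Mat p) × Mat p) :=
  (Measure.pi fun s => (q.μ s : Measure (Vec p))).prod <|
    (Measure.pi fun s => (q.Λ s : Measure (Mat p))).prod (q.L : Measure (Mat p))

instance : IsProbabilityMeasure q.gaussianPart := by
  unfold MeanField.gaussianPart; infer_instance

theorem measurePreserving_gaussianPart_mu (s : Node K D) :
    MeasurePreserving (fun v => v.1 s) q.gaussianPart (q.μ s) :=
  (measurePreserving_eval (fun s => (q.μ s : Measure (Vec p))) s).comp measurePreserving_fst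

theorem measurePreserving_gaussianPart_lambda (s : Node K D) :
    MeasurePreserving (fun v => v.2.1 s) q.gaussianPart (q.Λ s) :=
  (measurePreserving_eval (fun s => (q.Λ s : Measure (Mat p))) s).comp <|
    measurePreserving_fst.comp measurePreserving_snd

theorem measurePreserving_gaussianPart_mu_lambda (s : Node K D) :
    MeasurePreserving (fun v => (v.1 s, v.2.1 s)) q.gaussianPart
      ((q.μ s : Measure (Vec p)).prod (q.Λ s : Measure (Mat p))) :=
  (measurePreserving_eval (fun s => (q.μ s : Measure (Vec p))) s).prod <|
    (measurePreserving_eval (fun s => (q.Λ s : Measure (Mat p))) s).comp measurePreserving_fst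

theorem measurePreserving_data (i : Fin n) :
    MeasurePreserving (fun ω : Latent K D p n => (ω.1 i, ω.2.1 i, ω.2.2.2.2)) q.toMeasure
      ((q.z i : Measure (TreePath K D)).prod ((q.T i : Measure (Subtree K D)).prod
        q.gaussianPart)) :=
  (measurePreserving_eval (fun i => (q.z i : Measure (TreePath K D))) i).prod <|
    (measurePreserving_eval (fun i => (q.T i : Measure (Subtree K D))) i).prod <|
      measurePreserving_snd.comp measurePreserving_snd

theorem integral_pathInd (i : Fin n) (s : Node K D) :
    ∫ z, pathInd s z ∂(q.z i : Measure (TreePath K D)) = probOnPath q i s := by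
  classical
  have : pathInd s = Set.indicator {z : TreePath K D | OnPath s z} 1 := by
    ext z; simp [pathInd, Set.indicator_apply]
  rw [this, integral_indicator_one .of_discrete, probOnPath]

theorem integral_leafInd (i : Fin n) (s : Node K D) :
    ∫ T, leafInd s T ∂(q.T i : Measure (Subtree K D)) = probLeaf q i s := by
  classical
  have : leafInd s = Set.indicator {T : Subtree K D | T.IsLeaf s} 1 := by
    ext z; simp [leafInd, Set.indicator_apply]
  rw [this, integral_indicator_one .of_discrete, probLeaf]

theorem integral_innerInd (i : Fin n) (s : Node K D) :
    ∫ T, innerInd s T ∂(q.T i : Measure (Subtree K D)) = probInner q i s := by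
  classical
  have : innerInd s = Set.indicator {T : Subtree K D | T.IsInner s} 1 := by
    ext z; simp [innerInd, Set.indicator_apply]
  rw [this, integral_indicator_one .of_discrete, probInner]

theorem hasExp_pathInd_factor (i : Fin n) (s : Node K D) :
    HasExp (q.z i : Measure (TreePath K D)) (pathInd s) (probOnPath q i s) :=
  ⟨.of_finite, integral_pathInd q i s⟩

theorem hasExp_leafInd_factor (i : Fin n) (s : Node K D) :
    HasExp (q.T i : Measure (Subtree K D)) (leafInd s) (probLeaf q i s) :=
  ⟨.of_finite, integral_leafInd q i s⟩

theorem hasExp_pathInd (i : Fin n) (s : Node K D) :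
    HasExp q.toMeasure (fun ω => pathInd s (ω.1 i)) (probOnPath q i s) :=
  (hasExp_pathInd_factor q i s).comp (measurePreserving_z q i)

theorem hasExp_leafInd (i : Fin n) (s : Node K D) :
    HasExp q.toMeasure (fun ω => leafInd s (ω.2.1 i)) (probLeaf q i s) :=
  (hasExp_leafInd_factor q i s).comp (measurePreserving_T q i)

theorem hasExp_innerInd (i : Fin n) (s : Node K D) :
    HasExp q.toMeasure (fun ω => innerInd s (ω.2.1 i)) (probInner q i s) := by
  have : HasExp (q.T i : Measure (Subtree K D)) (innerInd s) (probInner q i s) :=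
    ⟨.of_finite, integral_innerInd q i s⟩
  exact this.comp (measurePreserving_T q i)

/-- Under q the variables z_i, T_i and (μ, Λ, L) are independent; this is where the weights ω_{i,s}
come from. -/
theorem hasExp_data {F : (Node K D → Vec p) × (Node K D → Mat p) × Mat p → ℝ} {c : ℝ}
    (hF : HasExp q.gaussianPart F c) (i : Fin n) (s : Node K D) :
    HasExp q.toMeasure (fun ω => leafInd s (ω.2.1 i) * pathInd s (ω.1 i) * F ω.2.2.2.2)
      (probLeaf q i s * probOnPath q i s * c) :=
  (((hasExp_pathInd_factor q i s).mul_prod ((hasExp_leafInd_factor q i s).mul_prod hF)).comp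
    (measurePreserving_data q i)).of_eq (fun ω => by ring) (by ring)

end Expectations

/-! ### The update of q(π_s) -/

section UpdatePi

theorem logPath_update_sub (π : Inner K D → Fin K → ℝ) (s : Inner K D) (v v' : Fin K → ℝ)
    (z : TreePath K D) : logPath (Function.update π s v) z - logPath (Function.update π s v') z =
      ∑ k, pathInd (child s k) z * (Real.log (v k) - Real.log (v' k)) := by
  simp only [logPath]
  rw [← Finset.sum_sub_distrib, Finset.sum_eq_single s]
  · simp only [Function.update_self, mul_sub, Finset.sum_sub_distrib]
  · intro t _ ht
    simp [Function.update_of_ne ht]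
  · simp

theorem probOnPath_nonneg (q : MeanField K D p n) (i : Fin n) (s : Node K D) :
    0 ≤ probOnPath q i s := measureReal_nonneg

theorem probLeaf_nonneg (q : MeanField K D p n) (i : Fin n) (s : Node K D) :
    0 ≤ probLeaf q i s := measureReal_nonneg

theorem probInner_nonneg (q : MeanField K D p n) (i : Fin n) (s : Node K D) :
    0 ≤ probInner q i s := measureReal_nonneg

theorem count_nonneg (q : MeanField K D p n) (s : Node K D) : 0 ≤ count q s :=
  Finset.sum_nonneg fun i _ => probOnPath_nonneg q i s

theorem toMeasure_eq (q : MeanField K D p n) : q.toMeasure =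
    latentProd (fun i => (q.z i : Measure (TreePath K D)))
      (fun i => (q.T i : Measure (Subtree K D))) (fun s => (q.π s : Measure (Fin K → ℝ))) q.g
      (fun s => (q.μ s : Measure (Vec p))) (fun s => (q.Λ s : Measure (Mat p))) q.L := rfl

theorem coe_update {ι X : Type*} [DecidableEq ι] [MeasurableSpace X] (f : ι → ProbabilityMeasure X)
    (s : ι) (r : ProbabilityMeasure X) : (fun t => (Function.update f s r t : Measure X)) =
      Function.update (fun t => (f t : Measure X)) s r :=
  funext fun t => Function.apply_update (fun _ (r : ProbabilityMeasure X) => (r : Measure X)) f s r t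

theorem alphaHat_pos (M : Hyper K D p) (q : MeanField K D p n) (s : Inner K D) (k : Fin K) :
    0 < alphaHat M q s k := add_pos_of_pos_of_nonneg (M.α_pos s k) (count_nonneg q _)

variable [NeZero K] {M : Hyper K D p} {x : Fin n → Vec p} {q : MeanField K D p n}

/-- Only the path terms contain π_s. Against the all-ones reference vector, whose logarithms vanish,
the expected difference at v is the sum over k of the expected counts times log v_k, which is
exactly a Dirichlet tilt of the prior. -/
theorem optimalPi_iff (hq : KL M x q ≠ ∞) (s : Inner K D) (r : ProbabilityMeasure (Fin K → ℝ)) :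
    OptimalPi M x q s r ↔ (r : Measure (Fin K → ℝ)) = dirichletMeasure (alphaHat M q s) := by
  obtain ⟨c, hc⟩ := exists_dirichlet_tilt (M.α_pos s) (alphaHat_pos M q s)
  obtain ⟨q₂, hF⟩ := splits_pi (mz := fun i => (q.z i : Measure (TreePath K D)))
    (mT := fun i => (q.T i : Measure (Subtree K D)))
    (mπ := fun s => (q.π s : Measure (Fin K → ℝ))) (mg := q.g)
    (mμ := fun s => (q.μ s : Measure (Vec p))) (mΛ := fun s => (q.Λ s : Measure (Mat p)))
    (mL := q.L) s
  obtain ⟨ρ₂, hG⟩ := splits_pi (mz := fun _ : Fin n => (Measure.count : Measure (TreePath K D)))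
    (mT := fun _ => Measure.count) (mπ := fun s => dirichletMeasure (M.α s))
    (mg := Measure.pi fun s => betaMeasure (M.a s) (M.b s)) (mμ := fun _ => volume)
    (mΛ := fun s => wishartMeasure (M.ν s) (M.W s)) (mL := wishartMeasure M.u M.V) s
  have key := minimizes_iff_of_splits (M := M) (x := x) hF hG (ρ₁ := dirichletMeasure (M.α s))
    (by rw [Function.update_eq_self (f := fun s => dirichletMeasure (M.α s))]; rfl)
    (Q := q.toMeasure) (q.π s)
    (by rw [Function.update_eq_self (f := fun s => (q.π s : Measure (Fin K → ℝ)))]; rfl) hq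
    (upd := fun v ω => (ω.1, ω.2.1, Function.update ω.2.2.1 s v, ω.2.2.2))
    (fun v v' y => by
      obtain ⟨z, T, y, w⟩ := y
      simp [piFactorSlot, update_piSlot])
    (fun _ => 1) c (Ψ := fun v => ∑ k, count q (child s k) * Real.log (v k) - c) (by fun_prop) hc
    (isProbabilityMeasure_dirichlet (alphaHat_pos M q s)) (.of_forall fun v => ?_) r
  · refine Iff.trans (Iff.of_eq ?_) key
    simp only [OptimalPi, KL, toMeasure_eq, coe_update]
  · have hdiff : (fun ω : Latent K D p n =>
        logJoint M x (ω.1, ω.2.1, Function.update ω.2.2.1 s v, ω.2.2.2) -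
          logJoint M x (ω.1, ω.2.1, Function.update ω.2.2.1 s (fun _ => 1), ω.2.2.2)) =
        fun ω => ∑ i, ∑ k, pathInd (child s k) (ω.1 i) * Real.log (v k) := by
      ext ω
      have := fun i => logPath_update_sub ω.2.2.1 s v (fun _ => 1) (ω.1 i)
      simp only [Real.log_one, sub_zero] at this
      simp only [logJoint, ← this, Finset.sum_sub_distrib]
      ring
    rw [hdiff]
    refine (HasExp.sum fun i => HasExp.sum fun k =>
      (hasExp_pathInd q i (child s k)).mul_const (Real.log (v k))).of_eq (fun _ => rfl) ?_
    rw [Finset.sum_comm]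
    simp [count, Finset.sum_mul]

end UpdatePi

/-! ### The update of q(g) -/

section UpdateG

theorem aHat_pos (M : Hyper K D p) (q : MeanField K D p n) (s : Inner K D) : 0 < aHat M q s :=
  add_pos_of_pos_of_nonneg (M.a_pos s) (Finset.sum_nonneg fun i _ => probInner_nonneg q i _)

theorem bHat_pos (M : Hyper K D p) (q : MeanField K D p n) (s : Inner K D) : 0 < bHat M q s :=
  add_pos_of_pos_of_nonneg (M.b_pos s) (Finset.sum_nonneg fun i _ => probLeaf_nonneg q i _)

variable [NeZero K] {M : Hyper K D p} {x : Fin n → Vec p} {q : MeanField K D p n}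

theorem optimalG_iff (hq : KL M x q ≠ ∞) (r : ProbabilityMeasure (Inner K D → ℝ)) :
    OptimalG M x q r ↔ (r : Measure (Inner K D → ℝ)) =
      Measure.pi fun s => betaMeasure (aHat M q s) (bHat M q s) := by
  obtain ⟨c, hc⟩ := exists_pi_beta_tilt M.a_pos M.b_pos
    (κ₁ := fun s : Inner K D => ∑ i, probInner q i s.toNode)
    (κ₂ := fun s : Inner K D => ∑ i, probLeaf q i s.toNode)
    (aHat_pos M q) (bHat_pos M q)
  obtain ⟨q₂, hF⟩ := splits_g (mz := fun i => (q.z i : Measure (TreePath K D)))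
    (mT := fun i => (q.T i : Measure (Subtree K D)))
    (mπ := fun s => (q.π s : Measure (Fin K → ℝ)))
    (mμ := fun s => (q.μ s : Measure (Vec p))) (mΛ := fun s => (q.Λ s : Measure (Mat p)))
    (mL := q.L)
  obtain ⟨ρ₂, hG⟩ := splits_g (mz := fun _ : Fin n => (Measure.count : Measure (TreePath K D)))
    (mT := fun _ => Measure.count) (mπ := fun s => dirichletMeasure (M.α s)) (mμ := fun _ => volume)
    (mΛ := fun s => wishartMeasure (M.ν s) (M.W s)) (mL := wishartMeasure M.u M.V)
  have hprob : IsProbabilityMeasure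
      (Measure.pi fun s => betaMeasure (aHat M q s) (bHat M q s)) := by
    have (s : Inner K D) := isProbabilityMeasureBeta (aHat_pos M q s) (bHat_pos M q s)
    infer_instance
  have key := minimizes_iff_of_splits (M := M) (x := x) hF hG
    (ρ₁ := Measure.pi fun s => betaMeasure (M.a s) (M.b s)) rfl (Q := q.toMeasure) q.g rfl hq
    (upd := fun v ω => (ω.1, ω.2.1, ω.2.2.1, v, ω.2.2.2.2)) (fun v v' y => rfl) (fun _ => 0) c
    (Ψ := fun g => ∑ s : Inner K D, ((∑ i, probInner q i s.toNode) * Real.log (g s) +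
      (∑ i, probLeaf q i s.toNode) * Real.log (1 - g s)) - c) (by fun_prop) hc hprob
    (.of_forall fun v => ?_) r
  · exact key
  -- The reference g = 0 contributes nothing: log 0 is 0 by convention and log(1 - 0) = 0.
  · have hdiff : (fun ω : Latent K D p n => logJoint M x (ω.1, ω.2.1, ω.2.2.1, v, ω.2.2.2.2) -
          logJoint M x (ω.1, ω.2.1, ω.2.2.1, (fun _ => 0), ω.2.2.2.2)) =
        fun ω => ∑ i, ∑ s : Inner K D, (innerInd s.toNode (ω.2.1 i) * Real.log (v s) +
          leafInd s.toNode (ω.2.1 i) * Real.log (1 - v s)) := by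
      ext ω
      simp [logJoint, logTree]
    rw [hdiff]
    refine (HasExp.sum fun i => HasExp.sum fun s : Inner K D =>
      ((hasExp_innerInd q i s.toNode).mul_const (Real.log (v s))).add
        ((hasExp_leafInd q i s.toNode).mul_const (Real.log (1 - v s)))).of_eq (fun _ => rfl) ?_
    rw [Finset.sum_comm, sub_add_cancel]
    refine Finset.sum_congr rfl fun s _ => ?_
    rw [Finset.sum_mul, Finset.sum_mul, ← Finset.sum_add_distrib]

end UpdateG

/-! ### Expectations of quadratic and bilinear forms -/

section SecondMoments

variable {Ω : Type*} [MeasurableSpace Ω] {m : Measure Ω}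

theorem hasExp_quadForm {y : Ω → Vec p} {E : Mat p}
    (h : ∀ j k, HasExp m (fun ω => y ω j * y ω k) (E j k)) (P : Mat p) :
    HasExp m (fun ω => quadForm P (y ω)) (E * P).trace := by
  refine (HasExp.sum (s := Finset.univ) fun j => HasExp.sum (s := Finset.univ) fun k =>
    (h j k).mul_const (P k j)).of_eq (fun ω => ?_) ?_
  · rw [quadForm_eq_sum, Finset.sum_comm]
    exact Finset.sum_congr rfl fun j _ => Finset.sum_congr rfl fun k _ => by ring
  · simp only [Matrix.trace, Matrix.diag, Matrix.mul_apply]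

/-- The quadratic form of E at v is the expectation of (y ⬝ v)². -/
theorem posSemidef_of_hasExp {y : Ω → Vec p} {E : Mat p}
    (h : ∀ j k, HasExp m (fun ω => y ω j * y ω k) (E j k)) : E.PosSemidef := by
  refine posSemidef_iff_real.2 ⟨?_, fun v => ?_⟩
  · ext j k
    rw [Matrix.conjTranspose_apply, star_trivial, ← (h j k).2, ← (h k j).2]
    simp only [mul_comm]
  · have h1 : HasExp m (fun ω => (y ω ⬝ᵥ v) ^ 2) (v ⬝ᵥ (E *ᵥ v)) := by
      refine (HasExp.sum (s := Finset.univ) fun j => HasExp.sum (s := Finset.univ) fun k =>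
        ((h j k).const_mul (v j)).mul_const (v k)).of_eq (fun ω => ?_) ?_
      · rw [sq, dotProduct, Finset.sum_mul_sum]
        exact Finset.sum_congr rfl fun j _ => Finset.sum_congr rfl fun k _ => by ring
      · exact (quadForm_eq_sum E v).symm
    rw [← h1.2]
    exact integral_nonneg fun ω => sq_nonneg _

theorem hasExp_bilin {P : Ω → Mat p} {e : Ω → Vec p} {EP : Mat p} {Ee : Vec p}
    (h : ∀ j k i, HasExp m (fun ω => P ω j k * e ω i) (EP j k * Ee i)) (v : Vec p) :
    HasExp m (fun ω => v ⬝ᵥ (P ω *ᵥ e ω)) (v ⬝ᵥ (EP *ᵥ Ee)) ∧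
    HasExp m (fun ω => e ω ⬝ᵥ (P ω *ᵥ v)) (Ee ⬝ᵥ (EP *ᵥ v)) := by
  simp only [dotProduct, Matrix.mulVec, Finset.mul_sum]
  exact ⟨HasExp.sum fun j => HasExp.sum fun k => (h j k k).const_mul (v j),
    HasExp.sum fun j => HasExp.sum fun k => ((h j k j).mul_const (v k)).of_eq
      (fun ω => by ring) (by ring)⟩

theorem hasExp_quadForm_left {P : Ω → Mat p} {EP : Mat p}
    (h : ∀ j k, HasExp m (fun ω => P ω j k) (EP j k)) (v : Vec p) :
    HasExp m (fun ω => quadForm (P ω) v) (quadForm EP v) := by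
  simp only [quadForm_eq_sum]
  exact HasExp.sum fun j => HasExp.sum fun k => ((h j k).const_mul (v j)).mul_const (v k)

theorem quadForm_add_smul (P : Mat p) (e v : Vec p) (σ : ℝ) :
    quadForm P (e + σ • v) - quadForm P e =
      σ ^ 2 * quadForm P v + σ * (v ⬝ᵥ (P *ᵥ e) + e ⬝ᵥ (P *ᵥ v)) := by
  simp only [quadForm, Matrix.mulVec_add, Matrix.mulVec_smul, dotProduct_add, add_dotProduct,
    dotProduct_smul, smul_dotProduct, smul_eq_mul]
  ring

end SecondMoments

/-! ### Second moments of the μ_s, of their increments and of the residuals -/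

section MeanMoments

/-- The second moments of the increment at `s`. -/
def incrMoment (m₀ : Vec p) (m : Node K D → Vec p) (C : Node K D → Mat p) (s : Node K D) : Mat p :=
  if s = root then C s + Matrix.vecMulVec (m s - m₀) (m s - m₀)
  else C s + C (parent s) + Matrix.vecMulVec (m s - m (parent s)) (m s - m (parent s))

theorem VHatInv_eq (M : Hyper K D p) (m : Node K D → Vec p) (C : Node K D → Mat p) :
    VHatInv M m C = M.V⁻¹ + ∑ s, incrMoment M.m₀ m C s := by
  rw [VHatInv, ← Finset.add_sum_erase _ _ (Finset.mem_univ root), Finset.filter_ne']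
  simp only [incrMoment, if_true, add_assoc]
  congr 3
  refine Finset.sum_congr rfl fun s hs => ?_
  rw [if_neg (Finset.ne_of_mem_erase hs)]

theorem uHat_gt (M : Hyper K D p) : (p : ℝ) - 1 < uHat M := by
  have := M.u_gt
  have h : (0 : ℝ) ≤ Fintype.card (Node K D) := Nat.cast_nonneg _
  unfold uHat; linarith

/-- The zero matrix is the reference point for L and Λ_s: its quadratic form vanishes, and its log
determinant only shifts the additive constant. -/
theorem logGauss_sub_zero (m : Vec p) (P : Mat p) (y : Vec p) :
    logGauss m P y - logGauss m 0 y = 1 / 2 * (Real.log P.det - Real.log (0 : Mat p).det) -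
      1 / 2 * quadForm P (y - m) := by
  simp only [logGauss, quadForm, Matrix.zero_mulVec, dotProduct_zero]
  ring

theorem wcount_nonneg (q : MeanField K D p n) (s : Node K D) : 0 ≤ wcount q s :=
  Finset.sum_nonneg fun i _ => mul_nonneg (probLeaf_nonneg q i s) (probOnPath_nonneg q i s)

/-- Weighted averages times the total weight, valid also for zero total weight. -/
theorem wcount_smul_inv_smul {E : Type*} [AddCommGroup E] [Module ℝ E] (q : MeanField K D p n)
    (s : Node K D) (f : Fin n → E) :
    wcount q s • (1 / wcount q s) • ∑ i, (probLeaf q i s * probOnPath q i s) • f i =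
      ∑ i, (probLeaf q i s * probOnPath q i s) • f i := by
  by_cases h : wcount q s = 0
  · have h0 := (Finset.sum_eq_zero_iff_of_nonneg fun i _ =>
      mul_nonneg (probLeaf_nonneg q i s) (probOnPath_nonneg q i s)).1 h
    rw [h, zero_smul, Finset.sum_eq_zero fun i hi => by rw [h0 i hi, zero_smul]]
  · rw [smul_smul, mul_one_div_cancel h, one_smul]

/-- Undoing the division by Ñ_s turns the scatter and covariance into a weighted sum of second
moments of μ_s about the data points, which is what the expected log density produces. -/
theorem wcount_smul_scatter (x : Fin n → Vec p) (q : MeanField K D p n) (s : Node K D) (m : Vec p)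
    (C : Mat p) : wcount q s • (wscatter x q s m + C) =
      ∑ i, (probLeaf q i s * probOnPath q i s) • (C + Matrix.vecMulVec (m - x i) (m - x i)) := by
  rw [smul_add, wscatter, wcount_smul_inv_smul]
  simp only [smul_add, Finset.sum_add_distrib]
  rw [add_comm, ← Finset.sum_smul, wcount]
  congr 1
  refine Finset.sum_congr rfl fun i _ => ?_
  rw [← neg_sub m (x i), Matrix.neg_vecMulVec, Matrix.vecMulVec_neg, neg_neg]

theorem nuHat_gt (M : Hyper K D p) (q : MeanField K D p n) (s : Node K D) :
    (p : ℝ) - 1 < nuHat M q s := by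
  have := M.ν_gt s
  have h := wcount_nonneg q s
  unfold nuHat; linarith

theorem logData_update_lambda_sub (z : TreePath K D) (T : Subtree K D) (μ : Node K D → Vec p)
    (Λ : Node K D → Mat p) (s : Node K D) (v v' : Mat p) (y : Vec p) :
    logData z T μ (Function.update Λ s v) y - logData z T μ (Function.update Λ s v') y =
      leafInd s T * pathInd s z * (logGauss (μ s) v y - logGauss (μ s) v' y) := by
  simp only [logData]
  rw [← Finset.sum_sub_distrib, Finset.sum_eq_single s]
  · simp only [Function.update_self, mul_sub]
  · intro t _ ht
    simp [Function.update_of_ne ht]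
  · simp

theorem quadForm_neg (P : Mat p) (y : Vec p) : quadForm P (-y) = quadForm P y := by
  simp [quadForm, Matrix.mulVec_neg]

theorem hasExp_pi_mul {q : MeanField K D p n} {s t : Node K D} (hst : s ≠ t) {f g : Vec p → ℝ} (hf : Measurable f)
    (hg : Measurable g) {c d : ℝ} (hfc : HasExp (q.μ s : Measure (Vec p)) f c)
    (hgd : HasExp (q.μ t : Measure (Vec p)) g d) :
    HasExp (Measure.pi fun s => (q.μ s : Measure (Vec p))) (fun μ => f (μ s) * g (μ t)) (c * d) :=
  ⟨integrable_pi_mul_of_ne (m := fun s => (q.μ s : Measure (Vec p))) hst hf hg hfc.1 hgd.1, by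
    rw [integral_pi_mul_of_ne (m := fun s => (q.μ s : Measure (Vec p))) hst hf hg, hfc.2, hgd.2]⟩

theorem hasExp_pi_eval {q : MeanField K D p n} {f : Vec p → ℝ} {c : ℝ} (s : Node K D)
    (h : HasExp (q.μ s : Measure (Vec p)) f c) :
    HasExp (Measure.pi fun s => (q.μ s : Measure (Vec p))) (fun μ => f (μ s)) c :=
  h.comp (measurePreserving_eval (fun s => (q.μ s : Measure (Vec p))) s)

variable [NeZero K] {M : Hyper K D p} {x : Fin n → Vec p} {q : MeanField K D p n}

theorem hasExp_mu (hq : KL M x q ≠ ∞) (s : Node K D) (j : Fin p) :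
    HasExp (q.μ s : Measure (Vec p)) (fun v => v j) (vecMean (q.μ s) j) :=
  hasExp_of_integrable (integrable_mu hq s j)

theorem hasExp_centered (hq : KL M x q ≠ ∞) (s : Node K D) (j : Fin p) :
    HasExp (q.μ s : Measure (Vec p)) (fun v => v j - vecMean (q.μ s) j) 0 :=
  ((hasExp_mu hq s j).sub (HasExp.const (vecMean (q.μ s) j))).of_eq (fun _ => rfl) (sub_self _)

theorem hasExp_centered_mul (hq : KL M x q ≠ ∞) (s : Node K D) (j k : Fin p) :
    HasExp (q.μ s : Measure (Vec p))
      (fun v => (v j - vecMean (q.μ s) j) * (v k - vecMean (q.μ s) k)) (vecCov (q.μ s) j k) :=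
  hasExp_of_integrable (((memLp_mu hq s j).sub (memLp_const (vecMean (q.μ s) j))).integrable_mul
    ((memLp_mu hq s k).sub (memLp_const (vecMean (q.μ s) k))))

theorem hasExp_mu_sub_mul (hq : KL M x q ≠ ∞) (s : Node K D) (y : Vec p) (j k : Fin p) :
    HasExp (q.μ s : Measure (Vec p)) (fun v => (v - y) j * (v - y) k)
      ((vecCov (q.μ s) + Matrix.vecMulVec (vecMean (q.μ s) - y) (vecMean (q.μ s) - y) : Mat p)
        j k) := by
  refine (((hasExp_centered_mul hq s j k).add
    ((hasExp_centered hq s j).mul_const (vecMean (q.μ s) k - y k))).add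
    (((hasExp_centered hq s k).mul_const (vecMean (q.μ s) j - y j)).add
      (HasExp.const ((vecMean (q.μ s) j - y j) * (vecMean (q.μ s) k - y k))))).of_eq
    (fun v => ?_) ?_
  · simp only [Pi.sub_apply]; ring
  · simp [Matrix.vecMulVec_apply]

theorem hasExp_incr_mul (hq : KL M x q ≠ ∞) (s : Node K D) (j k : Fin p) :
    HasExp (Measure.pi fun s => (q.μ s : Measure (Vec p)))
      (fun μ => (μ s - parentVec M.m₀ μ s) j * (μ s - parentVec M.m₀ μ s) k)
      (incrMoment M.m₀ (fun t => vecMean (q.μ t)) (fun t => vecCov (q.μ t)) s j k) := by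
  unfold incrMoment parentVec
  split_ifs with hs
  · exact hasExp_pi_eval s (hasExp_mu_sub_mul hq s M.m₀ j k)
  · have hst : s ≠ parent s := fun h => by
      have := length_parent_lt hs
      rw [← h] at this
      exact lt_irrefl _ this
    have hm (i : Fin p) (c : ℝ) : Measurable fun v : Vec p => v i - c := by fun_prop
    have a (i) := hasExp_pi_eval s (hasExp_centered hq s i)
    have b (i) := hasExp_pi_eval (parent s) (hasExp_centered hq (parent s) i)
    have aa := hasExp_pi_eval s (hasExp_centered_mul hq s j k)
    have bb := hasExp_pi_eval (parent s) (hasExp_centered_mul hq (parent s) j k)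
    -- The centred μ_s and μ_pa are independent, so the cross terms vanish and the covariances add.
    have ab (i l) := hasExp_pi_mul hst (hm i _) (hm l _) (hasExp_centered hq s i)
      (hasExp_centered hq (parent s) l)
    set e : Vec p := vecMean (q.μ s) - vecMean (q.μ (parent s)) with he
    refine ((((aa.add bb).sub ((ab j k).add (ab k j))).add (((a j).sub (b j)).mul_const (e k))).add
      ((((a k).sub (b k)).mul_const (e j)).add (HasExp.const (e j * e k)))).of_eq (fun μ => ?_) ?_
    · simp only [he, Pi.sub_apply]; ring
    · simp [Matrix.vecMulVec_apply]

end MeanMoments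

/-! ### The update of q(L) -/

section UpdateL

variable [NeZero K] {M : Hyper K D p} {x : Fin n → Vec p} {q : MeanField K D p n}

theorem posSemidef_sum_incrMoment (hq : KL M x q ≠ ∞) :
    (∑ s, incrMoment M.m₀ (fun t => vecMean (q.μ t)) (fun t => vecCov (q.μ t)) s).PosSemidef :=
  Matrix.posSemidef_sum _ fun s _ => posSemidef_of_hasExp fun j k => hasExp_incr_mul hq s j k

theorem posDef_VHatInv (hq : KL M x q ≠ ∞) :
    (VHatInv M (fun s => vecMean (q.μ s)) (fun s => vecCov (q.μ s))).PosDef := by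
  rw [VHatInv_eq]
  exact M.V_posDef.inv.add_posSemidef (posSemidef_sum_incrMoment hq)

/-- Every node contributes half of log det L minus half of the form of L in its increment. In
expectation this is a Wishart tilt with |𝒮_max| additional degrees of freedom and the summed second
moments of the increments. -/
theorem optimalL_iff (hq : KL M x q ≠ ∞) (r : ProbabilityMeasure (Mat p)) :
    OptimalL M x q r ↔ (r : Measure (Mat p)) = wishartMeasure (uHat M)
      (VHatInv M (fun s => vecMean (q.μ s)) (fun s => vecCov (q.μ s)))⁻¹ := by
  set Δ := ∑ s, incrMoment M.m₀ (fun t => vecMean (q.μ t)) (fun t => vecCov (q.μ t)) s with hΔ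
  have hprob := isProbabilityMeasure_wishart (uHat_gt M) (posDef_VHatInv hq).inv
  rw [VHatInv_eq] at hprob ⊢
  obtain ⟨c, hc⟩ := exists_wishart_tilt M.u_gt M.V_posDef
    (Nat.cast_nonneg (Fintype.card (Node K D))) (posSemidef_sum_incrMoment hq)
  obtain ⟨q₂, hF⟩ := splits_L (mz := fun i => (q.z i : Measure (TreePath K D)))
    (mT := fun i => (q.T i : Measure (Subtree K D)))
    (mπ := fun s => (q.π s : Measure (Fin K → ℝ))) (mg := q.g)
    (mμ := fun s => (q.μ s : Measure (Vec p))) (mΛ := fun s => (q.Λ s : Measure (Mat p)))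
  obtain ⟨ρ₂, hG⟩ := splits_L (mz := fun _ : Fin n => (Measure.count : Measure (TreePath K D)))
    (mT := fun _ => Measure.count) (mπ := fun s => dirichletMeasure (M.α s))
    (mg := Measure.pi fun s => betaMeasure (M.a s) (M.b s)) (mμ := fun _ => volume)
    (mΛ := fun s => wishartMeasure (M.ν s) (M.W s))
  have key := minimizes_iff_of_splits (M := M) (x := x) hF hG (ρ₁ := wishartMeasure M.u M.V) rfl
    (Q := q.toMeasure) q.L rfl hq
    (upd := fun v ω => (ω.1, ω.2.1, ω.2.2.1, ω.2.2.2.1, ω.2.2.2.2.1, ω.2.2.2.2.2.1, v))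
    (fun v v' y => rfl) 0
    (c - Fintype.card (Node K D) / 2 * Real.log (0 : Mat p).det)
    (Ψ := fun L => (Fintype.card (Node K D) : ℝ) / 2 * Real.log L.det - 1 / 2 * (Δ * L).trace - c)
    (by have := measurable_det (p := p); have := measurable_trace_mul (p := p) Δ; fun_prop) hc
    hprob (.of_forall fun L => ?_) r
  · exact key
  · refine (HasExp.sum (s := Finset.univ) fun s =>
      (HasExp.const (1 / 2 * (Real.log L.det - Real.log (0 : Mat p).det))).sub
      ((((hasExp_quadForm (hasExp_incr_mul hq s) L).comp measurePreserving_fst).comp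
        (measurePreserving_rest q)).const_mul (1 / 2))).of_eq (fun ω => ?_) ?_
    · simp only [← logGauss_sub_zero, logJoint, logMean, Finset.sum_sub_distrib]
      ring
    · rw [hΔ, Finset.sum_mul, Matrix.trace_sum, Finset.mul_sum, Finset.sum_sub_distrib]
      simp only [Finset.sum_const, Finset.card_univ, nsmul_eq_mul]
      ring

end UpdateL

/-! ### The update of q(Λ_s) -/

section UpdateLambda

variable [NeZero K] {M : Hyper K D p} {x : Fin n → Vec p} {q : MeanField K D p n}

theorem posSemidef_wscatter (hq : KL M x q ≠ ∞) (s : Node K D) :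
    (wcount q s • (wscatter x q s (vecMean (q.μ s)) + vecCov (q.μ s))).PosSemidef := by
  rw [wcount_smul_scatter]
  exact Matrix.posSemidef_sum _ fun i _ =>
    (posSemidef_of_hasExp fun j k => hasExp_mu_sub_mul hq s (x i) j k).smul
      (mul_nonneg (probLeaf_nonneg q i s) (probOnPath_nonneg q i s))

theorem posDef_WHatInv (hq : KL M x q ≠ ∞) (s : Node K D) :
    (WHatInv M x q (vecMean (q.μ s)) (vecCov (q.μ s)) s).PosDef :=
  (M.W_posDef s).inv.add_posSemidef (posSemidef_wscatter hq s)

/-- The data terms at s form a Wishart tilt: the weights add up to Ñ_s degrees of freedom, and the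
weighted second moments of μ_s about the data are added to W_s⁻¹. -/
theorem optimalLambda_iff (hq : KL M x q ≠ ∞) (s : Node K D) (r : ProbabilityMeasure (Mat p)) :
    OptimalLambda M x q s r ↔ (r : Measure (Mat p)) = wishartMeasure (nuHat M q s)
      (WHatInv M x q (vecMean (q.μ s)) (vecCov (q.μ s)) s)⁻¹ := by
  set Δ := wcount q s • (wscatter x q s (vecMean (q.μ s)) + vecCov (q.μ s)) with hΔ
  have hprob := isProbabilityMeasure_wishart (nuHat_gt M q s) (posDef_WHatInv hq s).inv
  obtain ⟨c, hc⟩ := exists_wishart_tilt (M.ν_gt s) (M.W_posDef s) (wcount_nonneg q s)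
    (posSemidef_wscatter hq s)
  obtain ⟨q₂, hF⟩ := splits_lambda (mz := fun i => (q.z i : Measure (TreePath K D)))
    (mT := fun i => (q.T i : Measure (Subtree K D)))
    (mπ := fun s => (q.π s : Measure (Fin K → ℝ))) (mg := q.g)
    (mμ := fun s => (q.μ s : Measure (Vec p))) (mΛ := fun s => (q.Λ s : Measure (Mat p)))
    (mL := q.L) s
  obtain ⟨ρ₂, hG⟩ := splits_lambda
    (mz := fun _ : Fin n => (Measure.count : Measure (TreePath K D)))
    (mT := fun _ => Measure.count) (mπ := fun s => dirichletMeasure (M.α s))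
    (mg := Measure.pi fun s => betaMeasure (M.a s) (M.b s)) (mμ := fun _ => volume)
    (mΛ := fun s => wishartMeasure (M.ν s) (M.W s)) (mL := wishartMeasure M.u M.V) s
  have key := minimizes_iff_of_splits (M := M) (x := x) hF hG
    (ρ₁ := wishartMeasure (M.ν s) (M.W s))
    (by rw [Function.update_eq_self (f := fun s => wishartMeasure (M.ν s) (M.W s))]; rfl)
    (Q := q.toMeasure) (q.Λ s)
    (by rw [Function.update_eq_self (f := fun s => (q.Λ s : Measure (Mat p)))]; rfl) hq
    (upd := fun v ω => (ω.1, ω.2.1, ω.2.2.1, ω.2.2.2.1, ω.2.2.2.2.1,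
      Function.update ω.2.2.2.2.2.1 s v, ω.2.2.2.2.2.2))
    (fun v v' y => by
      obtain ⟨z, T, π, g, μ, y, w⟩ := y
      simp [lambdaSlot, update_piSlot]) 0
    (c - wcount q s / 2 * Real.log (0 : Mat p).det)
    (Ψ := fun Λ => wcount q s / 2 * Real.log Λ.det - 1 / 2 * (Δ * Λ).trace - c)
    (by have := measurable_det (p := p); have := measurable_trace_mul (p := p) Δ; fun_prop) hc
    hprob (.of_forall fun Λ => ?_) r
  · refine Iff.trans (Iff.of_eq ?_) key
    simp only [OptimalLambda, KL, toMeasure_eq, coe_update]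
  · refine (HasExp.sum (s := Finset.univ) fun i => hasExp_data q
      ((HasExp.const (1 / 2 * (Real.log Λ.det - Real.log (0 : Mat p).det))).sub
      (((hasExp_quadForm (hasExp_mu_sub_mul hq s (x i)) Λ).comp
        (measurePreserving_gaussianPart_mu q s)).const_mul (1 / 2))) i s).of_eq (fun ω => ?_) ?_
    · simp only [← quadForm_neg Λ (_ - x _), neg_sub, ← logGauss_sub_zero]
      have := fun i => logData_update_lambda_sub (ω.1 i) (ω.2.1 i) ω.2.2.2.2.1 ω.2.2.2.2.2.1 s Λ 0
        (x i)
      simp only [logJoint, ← this, Finset.sum_sub_distrib]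
      ring
    · rw [hΔ, wcount_smul_scatter, Finset.sum_mul, Matrix.trace_sum]
      simp only [Matrix.smul_mul, Matrix.trace_smul, smul_eq_mul]
      rw [sub_add_sub_cancel]
      simp only [wcount, Finset.sum_div, Finset.sum_mul, Finset.mul_sum, ← Finset.sum_sub_distrib]
      exact Finset.sum_congr rfl fun i _ => by ring

end UpdateLambda

/-! ### The update of q(μ_s) -/

section UpdateMu

theorem parent_child (s : Inner K D) (k : Fin K) : parent (child s k) = s.toNode :=
  Subtype.ext (by simp [parent, child, Inner.toNode])

theorem child_ne_root (s : Inner K D) (k : Fin K) : child s k ≠ root := fun h => by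
  have := congrArg Subtype.val h
  simp [child, root] at this

theorem child_injective (s : Inner K D) : Function.Injective (child s) := fun k k' h => by
  have := congrArg Subtype.val h
  simpa [child] using this

theorem exists_child {t : Node K D} (ht : t ≠ root) :
    ∃ (h : (parent t).1.length < D) (k : Fin K), child ⟨(parent t).1, h⟩ k = t := by
  have hne : t.1 ≠ [] := fun h => ht (Subtype.ext h)
  refine ⟨(length_parent_lt ht).trans_le t.2, t.1.getLast hne, Subtype.ext ?_⟩
  simp [child, parent, List.dropLast_append_getLast]

/-- The coefficient of `μ_s` in the increment at `t`. -/
def incrCoeff (s t : Node K D) : ℝ :=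
  if t = s then 1 else if t ≠ root ∧ parent t = s then -1 else 0

/-- The part of the increment at `t` that does not depend on `μ_s`. -/
def restIncr (m₀ : Vec p) (μ : Node K D → Vec p) (s t : Node K D) : Vec p :=
  Function.update μ s 0 t - parentVec m₀ (Function.update μ s 0) t

theorem parent_ne {t : Node K D} (ht : t ≠ root) : parent t ≠ t := fun h => by
  have := length_parent_lt ht
  rw [h] at this
  exact lt_irrefl _ this

/-- All increments are affine in μ_s, which treats the prior term at s and those at its children
uniformly. -/
theorem incr_update (m₀ : Vec p) (μ : Node K D → Vec p) (s t : Node K D) (v : Vec p) :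
    Function.update μ s v t - parentVec m₀ (Function.update μ s v) t =
      restIncr m₀ μ s t + incrCoeff s t • v := by
  unfold restIncr incrCoeff parentVec
  by_cases hts : t = s
  · subst hts
    by_cases ht : t = root
    · simp [ht]; abel
    · simp [ht, Function.update_of_ne (parent_ne ht)]; abel
  · by_cases ht : t = root
    · subst ht
      simp [hts]
    · by_cases hp : parent t = s
      · simp [hts, ht, hp]; abel
      · simp [hts, ht, hp, Function.update_of_ne]

/-- Only s and its children have nonzero coefficients. Squaring as f yields the factor K + 1, the
identity yields the sum of the neighbouring means. -/
theorem sum_incrCoeff {E : Type*} [AddCommGroup E] [Module ℝ E] (s : Node K D) (f : ℝ → ℝ)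
    (hf : f 0 = 0) (G : Node K D → E) : ∑ t, f (incrCoeff s t) • G t = f 1 • G s +
      f (-1) • if h : s.1.length < D then ∑ k, G (child ⟨s.1, h⟩ k) else 0 := by
  have hsplit (t : Node K D) : f (incrCoeff s t) • G t = (if t = s then f 1 • G t else 0) +
      if t ≠ root ∧ parent t = s then f (-1) • G t else 0 := by
    unfold incrCoeff
    by_cases hts : t = s
    · have : ¬ (t ≠ root ∧ parent t = s) := fun h => parent_ne h.1 (h.2.trans hts.symm)
      rw [if_pos hts, if_pos hts, if_neg this, add_zero]
    · rw [if_neg hts, if_neg hts, zero_add]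
      split_ifs
      · rfl
      · rw [hf, zero_smul]
  simp only [hsplit, Finset.sum_add_distrib, Finset.sum_ite_eq', Finset.mem_univ, if_true]
  congr 1
  split_ifs with h
  · rw [Finset.smul_sum]
    refine (Fintype.sum_of_injective _ (child_injective ⟨s.1, h⟩) _ _ (fun t ht => ?_)
      fun k => ?_).symm
    · rw [if_neg]
      rintro ⟨h1, h2⟩
      obtain ⟨h3, k, hk⟩ := exists_child h1
      subst h2
      exact ht ⟨k, hk⟩
    · rw [if_pos ⟨child_ne_root _ _, parent_child _ _⟩]
  · rw [smul_zero]
    refine Finset.sum_eq_zero fun t _ => if_neg ?_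
    rintro ⟨h1, h2⟩
    exact h (h2 ▸ (exists_child h1).1)

theorem logData_update_mu_sub (z : TreePath K D) (T : Subtree K D) (μ : Node K D → Vec p)
    (Λ : Node K D → Mat p) (s : Node K D) (v v' : Vec p) (y : Vec p) :
    logData z T (Function.update μ s v) Λ y - logData z T (Function.update μ s v') Λ y =
      leafInd s T * pathInd s z * (logGauss v (Λ s) y - logGauss v' (Λ s) y) := by
  simp only [logData]
  rw [← Finset.sum_sub_distrib, Finset.sum_eq_single s]
  · simp only [Function.update_self, mul_sub]
  · intro t _ ht
    simp [Function.update_of_ne ht]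
  · simp

theorem logGauss_sub_zero_mean (P : Mat p) (v y : Vec p) :
    logGauss v P y - logGauss 0 P y =
      -(1 / 2) * (quadForm P v - (v ⬝ᵥ (P *ᵥ y) + y ⬝ᵥ (P *ᵥ v))) := by
  have h := quadForm_add_smul P y v (-1)
  have e : y + (-1 : ℝ) • v = y - v := by simp [sub_eq_add_neg]
  rw [e] at h
  have h1 : logGauss v P y - logGauss 0 P y = -(1 / 2) * (quadForm P (y - v) - quadForm P y) := by
    simp only [logGauss, quadForm, sub_zero]; ring
  rw [h1, h]; ring

theorem logMean_update_sub (m₀ : Vec p) (L : Mat p) (μ : Node K D → Vec p) (s : Node K D)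
    (v : Vec p) : logMean m₀ L (Function.update μ s v) - logMean m₀ L (Function.update μ s 0) =
      ∑ t, -(1 / 2) * (incrCoeff s t ^ 2 * quadForm L v + incrCoeff s t *
        (v ⬝ᵥ (L *ᵥ restIncr m₀ μ s t) +
        restIncr m₀ μ s t ⬝ᵥ (L *ᵥ v))) := by
  simp only [logMean]
  rw [← Finset.sum_sub_distrib]
  refine Finset.sum_congr rfl fun t _ => ?_
  rw [← quadForm_add_smul, ← incr_update]
  simp only [restIncr, logGauss, quadForm]
  ring

theorem quadForm_precHat (q : MeanField K D p n) (s : Node K D) (v : Vec p) :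
    quadForm (precHat q s) v = wcount q s * quadForm (matMean (q.Λ s)) v +
      (if s.1.length < D then (K : ℝ) + 1 else 1) * quadForm (matMean q.L) v := by
  simp only [precHat, quadForm, Matrix.add_mulVec, Matrix.smul_mulVec, dotProduct_add,
    dotProduct_smul, smul_eq_mul]

theorem sum_incrCoeff_sq (s : Node K D) :
    ∑ t, incrCoeff s t ^ 2 = if s.1.length < D then (K : ℝ) + 1 else 1 := by
  have h := sum_incrCoeff s (fun c => c ^ 2) (by simp) fun _ : Node K D => (1 : ℝ)
  simp only [smul_eq_mul, mul_one] at h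
  rw [h]
  split_ifs <;> simp [add_comm]

theorem sum_incrCoeff_smul (m₀ : Vec p) (m : Node K D → Vec p) (s : Node K D) :
    ∑ t, incrCoeff s t • restIncr m₀ m s t =
      -(parentVec m₀ m s + if h : s.1.length < D then ∑ k, m (child ⟨s.1, h⟩ k) else 0) := by
  rw [sum_incrCoeff s (fun c => c) rfl, neg_add]
  congr 1
  · simp only [restIncr, one_smul, Function.update_self, zero_sub, parentVec]
    congr 1
    split_ifs with hs
    · rfl
    · rw [Function.update_of_ne (parent_ne hs)]
  · rw [neg_one_smul]
    congr 1
    split_ifs with h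
    · refine Finset.sum_congr rfl fun k _ => ?_
      have h1 : child ⟨s.1, h⟩ k ≠ s := fun e => by
        have := congrArg (fun t : Node K D => t.1.length) e
        simp [child] at this
      rw [restIncr, Function.update_of_ne h1, parentVec, if_neg (child_ne_root _ _), parent_child]
      simp [Inner.toNode]
    · rfl

theorem dotProduct_mulVec_comm {P : Mat p} (hP : P.IsHermitian) (u v : Vec p) :
    u ⬝ᵥ (P *ᵥ v) = v ⬝ᵥ (P *ᵥ u) := by
  have h : Pᵀ = P := by rw [← Matrix.conjTranspose_eq_transpose_of_trivial]; exact hP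
  rw [Matrix.dotProduct_mulVec, ← Matrix.mulVec_transpose, h, dotProduct_comm]

/-- Completing the square: the linear term h is recovered from the mean P⁻¹ h. -/
theorem logGauss_sub_at_zero {P : Mat p} (hP : P.PosDef) (h v : Vec p) :
    logGauss (P⁻¹ *ᵥ h) P v - logGauss (P⁻¹ *ᵥ h) P 0 = -(1 / 2) * quadForm P v + v ⬝ᵥ h := by
  have e : P *ᵥ (P⁻¹ *ᵥ h) = h := by
    rw [Matrix.mulVec_mulVec, Matrix.mul_nonsing_inv _ (isUnit_iff_ne_zero.2 hP.det_pos.ne'),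
      Matrix.one_mulVec]
  have h1 := quadForm_add_smul P (0 - P⁻¹ *ᵥ h) v 1
  rw [one_smul, zero_sub, neg_add_eq_sub] at h1
  have h2 : logGauss (P⁻¹ *ᵥ h) P v - logGauss (P⁻¹ *ᵥ h) P 0 =
      -(1 / 2) * (quadForm P (v - P⁻¹ *ᵥ h) - quadForm P (-(P⁻¹ *ᵥ h))) := by
    simp only [logGauss, quadForm, zero_sub]; ring
  rw [h2, h1, dotProduct_mulVec_comm hP.isHermitian _ v, Matrix.mulVec_neg, e, dotProduct_neg]
  ring

theorem gaussianMeasure_eq {P : Mat p} (hP : P.PosDef) (m : Vec p) : gaussianMeasure m P =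
    volume.withDensity fun v => ENNReal.ofReal (Real.exp (logGauss m P v)) := by
  simp only [gaussianMeasure, exp_logGauss hP]

variable [NeZero K] {M : Hyper K D p} {x : Fin n → Vec p} {q : MeanField K D p n}

theorem hasExp_restIncr (hq : KL M x q ≠ ∞) (s t : Node K D) (j : Fin p) :
    HasExp (Measure.pi fun s => (q.μ s : Measure (Vec p)))
      (fun μ => restIncr M.m₀ μ s t j)
      (restIncr M.m₀ (fun t => vecMean (q.μ t)) s t j) := by
  unfold restIncr
  have h (t : Node K D) : HasExp (Measure.pi fun s => (q.μ s : Measure (Vec p)))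
      (fun μ => Function.update μ s 0 t j) (Function.update (fun t => vecMean (q.μ t)) s 0 t j) := by
    by_cases hts : t = s
    · subst hts
      simpa using HasExp.const (a := Measure.pi fun s => (q.μ s : Measure (Vec p))) (0 : ℝ)
    · simpa [Function.update_of_ne hts] using hasExp_pi_eval t (hasExp_mu hq t j)
  refine (h t).sub ?_
  unfold parentVec
  split_ifs
  · exact HasExp.const _
  · exact h _

theorem hasExp_L_mul_incr (hq : KL M x q ≠ ∞) (s t : Node K D) (j k i : Fin p) :
    HasExp q.toMeasure (fun ω => ω.2.2.2.2.2.2 j k *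
      restIncr M.m₀ ω.2.2.2.2.1 s t i)
      (matMean q.L j k * restIncr M.m₀ (fun t => vecMean (q.μ t)) s t i) :=
  (((hasExp_restIncr hq s t i).mul_prod (hasExp_of_integrable (integrable_L_entry hq j k))).comp
    (measurePreserving_mu_L q)).of_eq (fun _ => mul_comm _ _) (mul_comm _ _)

theorem hasExp_L (hq : KL M x q ≠ ∞) (j k : Fin p) :
    HasExp q.toMeasure (fun ω => ω.2.2.2.2.2.2 j k) (matMean q.L j k) :=
  (hasExp_of_integrable (integrable_L_entry hq j k)).comp (measurePreserving_L q)

theorem hasExp_lambda (hq : KL M x q ≠ ∞) (s : Node K D) (j k : Fin p) :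
    HasExp q.gaussianPart (fun v => v.2.1 s j k) (matMean (q.Λ s) j k) :=
  (hasExp_of_integrable (integrable_lambda_entry hq s j k)).comp
    (measurePreserving_gaussianPart_lambda q s)

theorem posDef_matMean_L (hq : KL M x q ≠ ∞) : (matMean (q.L : Measure (Mat p))).PosDef :=
  posDef_matMean (ae_posDef_L hq) (integrable_L_entry hq)

theorem posDef_matMean_lambda (hq : KL M x q ≠ ∞) (s : Node K D) :
    (matMean (q.Λ s : Measure (Mat p))).PosDef :=
  posDef_matMean (ae_posDef_lambda hq s) (integrable_lambda_entry hq s)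

/-- The summand with E[L] has a positive coefficient, so definiteness survives Ñ_s = 0. -/
theorem posDef_precHat (hq : KL M x q ≠ ∞) (s : Node K D) : (precHat q s).PosDef := by
  unfold precHat
  refine Matrix.PosDef.posSemidef_add
    ((posDef_matMean_lambda hq s).posSemidef.smul (wcount_nonneg q s))
    ((posDef_matMean_L hq).smul ?_)
  split_ifs <;> positivity

theorem optimalMu_iff (hq : KL M x q ≠ ∞) (s : Node K D) (r : ProbabilityMeasure (Vec p)) :
    OptimalMu M x q s r ↔ (r : Measure (Vec p)) =
      gaussianMeasure (meanHat M x q (fun t => vecMean (q.μ t)) s) (precHat q s) := by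
  have hP := posDef_precHat hq s
  have hprob := isProbabilityMeasure_gaussian hP (meanHat M x q (fun t => vecMean (q.μ t)) s)
  obtain ⟨q₂, hF⟩ := splits_mu (mz := fun i => (q.z i : Measure (TreePath K D)))
    (mT := fun i => (q.T i : Measure (Subtree K D)))
    (mπ := fun s => (q.π s : Measure (Fin K → ℝ))) (mg := q.g)
    (mμ := fun s => (q.μ s : Measure (Vec p))) (mΛ := fun s => (q.Λ s : Measure (Mat p)))
    (mL := q.L) s
  obtain ⟨ρ₂, hG⟩ := splits_mu
    (mz := fun _ : Fin n => (Measure.count : Measure (TreePath K D)))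
    (mT := fun _ => Measure.count) (mπ := fun s => dirichletMeasure (M.α s))
    (mg := Measure.pi fun s => betaMeasure (M.a s) (M.b s)) (mμ := fun _ => volume)
    (mΛ := fun s => wishartMeasure (M.ν s) (M.W s)) (mL := wishartMeasure M.u M.V) s
  set mhat := meanHat M x q (fun t => vecMean (q.μ t)) s with hm
  have key := minimizes_iff_of_splits (M := M) (x := x) hF hG (ρ₁ := volume)
    (by rw [Function.update_eq_self (f := fun _ : Node K D => (volume : Measure (Vec p)))]; rfl)
    (Q := q.toMeasure) (q.μ s)
    (by rw [Function.update_eq_self (f := fun s => (q.μ s : Measure (Vec p)))]; rfl) hq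
    (upd := fun v ω => (ω.1, ω.2.1, ω.2.2.1, ω.2.2.2.1,
      Function.update ω.2.2.2.2.1 s v, ω.2.2.2.2.2))
    (fun v v' y => by
      obtain ⟨z, T, π, g, y, w⟩ := y
      simp [muSlot, update_piSlot]) 0
    (-logGauss mhat (precHat q s) 0) (Ψ := fun v => logGauss mhat (precHat q s) v)
    (by fun_prop) (gaussianMeasure_eq hP mhat) hprob (.of_forall fun v => ?_) r
  · refine Iff.trans (Iff.of_eq ?_) key
    simp only [OptimalMu, KL, toMeasure_eq, coe_update]
  · have hdata (i : Fin n) := hasExp_data q (((hasExp_quadForm_left (hasExp_lambda hq s) v).sub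
      (((hasExp_bilin (e := fun _ => x i) (Ee := x i) (fun j k l =>
        (hasExp_lambda hq s j k).mul_const (x i l)) v).1).add
        ((hasExp_bilin (e := fun _ => x i) (Ee := x i) (fun j k l =>
        (hasExp_lambda hq s j k).mul_const (x i l)) v).2))).const_mul (-(1 / 2))) i s
    have hmean (t : Node K D) := (((hasExp_quadForm_left (hasExp_L hq) v).const_mul
      (incrCoeff s t ^ 2)).add (((hasExp_bilin (hasExp_L_mul_incr hq s t) v).1.add
        (hasExp_bilin (hasExp_L_mul_incr hq s t) v).2).const_mul (incrCoeff s t))).const_mul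
          (-(1 / 2))
    refine ((HasExp.sum (s := Finset.univ) hmean).add
      (HasExp.sum (s := Finset.univ) hdata)).of_eq (fun ω => ?_) ?_
    · have h1 := fun i => logData_update_mu_sub (ω.1 i) (ω.2.1 i) ω.2.2.2.2.1 ω.2.2.2.2.2.1 s v 0
        (x i)
      simp only [logJoint, ← logMean_update_sub, ← logGauss_sub_zero_mean, ← h1,
        Finset.sum_sub_distrib]
      ring
    · rw [← sub_eq_add_neg, hm, meanHat, logGauss_sub_at_zero hP, quadForm_precHat,
        ← sum_incrCoeff_sq]
      have hΛ := (posDef_matMean_lambda hq s).isHermitian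
      have hL := (posDef_matMean_L hq).isHermitian
      have e1 : wcount q s • (matMean (q.Λ s) *ᵥ wmean x q s) =
          matMean (q.Λ s) *ᵥ ∑ i, (probLeaf q i s * probOnPath q i s) • x i := by
        rw [← Matrix.mulVec_smul, wmean, wcount_smul_inv_smul]
      have e2 := sum_incrCoeff_smul M.m₀ (fun t => vecMean (q.μ t)) s
      -- Solved for the sum of the neighbouring means, so that both sides become sums over all
      -- increments.
      rw [eq_neg_iff_add_eq_zero, add_comm, ← eq_neg_iff_add_eq_zero] at e2
      rw [e1, e2, dotProduct_add, Matrix.mulVec_neg, dotProduct_neg, Matrix.mulVec_sum,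
        Matrix.mulVec_sum, dotProduct_sum, dotProduct_sum]
      simp only [Matrix.mulVec_smul, dotProduct_smul, smul_eq_mul]
      -- Symmetry of E[L], and below of E[Λ_s], merges the two bilinear terms and cancels the factor
      -- 1/2.
      have A (e : Node K D → Vec p) : ∑ t, -(1 / 2) * (incrCoeff s t ^ 2 * quadForm (matMean q.L) v +
          incrCoeff s t * (v ⬝ᵥ (matMean q.L *ᵥ e t) + e t ⬝ᵥ (matMean q.L *ᵥ v))) =
          -(1 / 2) * ((∑ t, incrCoeff s t ^ 2) * quadForm (matMean q.L) v) -
            ∑ t, incrCoeff s t * (v ⬝ᵥ (matMean q.L *ᵥ e t)) := by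
        rw [Finset.sum_mul, Finset.mul_sum, ← Finset.sum_sub_distrib]
        refine Finset.sum_congr rfl fun t _ => ?_
        rw [dotProduct_mulVec_comm hL (e t) v]
        ring
      have B : ∑ i, probLeaf q i s * probOnPath q i s * (-(1 / 2) * (quadForm (matMean (q.Λ s)) v -
          (v ⬝ᵥ (matMean (q.Λ s) *ᵥ x i) + x i ⬝ᵥ (matMean (q.Λ s) *ᵥ v)))) =
          -(1 / 2) * (wcount q s * quadForm (matMean (q.Λ s)) v) +
            ∑ i, probLeaf q i s * probOnPath q i s * (v ⬝ᵥ (matMean (q.Λ s) *ᵥ x i)) := by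
        rw [wcount, Finset.sum_mul, Finset.mul_sum, ← Finset.sum_add_distrib]
        refine Finset.sum_congr rfl fun i _ => ?_
        rw [dotProduct_mulVec_comm hΛ (x i) v]
        ring
      rw [A, B]
      ring

end UpdateMu

/-! ### Sums along a path and over all paths -/

section Paths

/-- The inner node of depth `j` on the path `z`. -/
def pathNode (z : TreePath K D) (j : Fin D) : Inner K D :=
  ⟨(List.ofFn z).take j, by simp⟩

theorem length_pathNode (z : TreePath K D) (j : Fin D) : (pathNode z j).1.length = j := by
  simp [pathNode, j.2.le]

theorem pathNode_injective (z : TreePath K D) : Function.Injective (pathNode z) := fun j j' h => by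
  have := congrArg (fun s : Inner K D => s.1.length) h
  simp only [length_pathNode] at this
  exact Fin.ext this

theorem pathNode_append (z : TreePath K D) (j : Fin D) :
    (pathNode z j).1 ++ [z j] = (List.ofFn z).take (j + 1) := by
  have : (j : ℕ) < (List.ofFn z).length := by simp
  rw [List.take_succ_eq_append_getElem this]
  simp [pathNode]

theorem onPath_child_iff (s : Inner K D) (k : Fin K) (z : TreePath K D) :
    OnPath (child s k) z ↔ ∃ j : Fin D, pathNode z j = s ∧ z j = k := by
  constructor
  · rintro ⟨t, ht⟩
    simp only [child] at ht
    refine ⟨⟨s.1.length, s.2⟩, Subtype.ext ?_, ?_⟩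
    · simp [pathNode, ← ht]
    · have h1 : (List.ofFn z)[s.1.length]? = some k := by rw [← ht]; simp
      rw [List.getElem?_ofFn] at h1
      simpa [s.2] using h1
  · rintro ⟨j, rfl, rfl⟩
    change (pathNode z j).1 ++ [z j] <+: _
    rw [pathNode_append]
    exact List.take_prefix _ _

/-- A path uses exactly one edge at each depth. -/
theorem sum_pathInd_child (z : TreePath K D) (F : Inner K D → Fin K → ℝ) :
    ∑ s, ∑ k, pathInd (child s k) z * F s k = ∑ j, F (pathNode z j) (z j) := by
  refine (Fintype.sum_of_injective _ (pathNode_injective z) _ _ (fun s hs => ?_) fun j => ?_).symm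
  · refine Finset.sum_eq_zero fun k _ => ?_
    rw [pathInd, if_neg, zero_mul]
    rw [onPath_child_iff]
    rintro ⟨j, hj, _⟩
    exact hs ⟨j, hj⟩
  · rw [Finset.sum_eq_single (z j)]
    · rw [pathInd, if_pos ((onPath_child_iff _ _ _).2 ⟨j, rfl, rfl⟩), one_mul]
    · intro k _ hk
      rw [pathInd, if_neg, zero_mul]
      rw [onPath_child_iff]
      rintro ⟨j', hj, rfl⟩
      exact hk (by rw [pathNode_injective z hj])
    · simp

theorem sum_node (f : Node K D → ℝ) : ∑ t, f t = f root + ∑ s, ∑ k, f (child s k) := by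
  let φ : Option (Inner K D × Fin K) → Node K D := fun o => o.elim root fun c => child c.1 c.2
  have hφ : Function.Bijective φ := by
    constructor
    · rintro (_ | ⟨s, k⟩) (_ | ⟨s', k'⟩) h
      · rfl
      · exact absurd h.symm (child_ne_root s' k')
      · exact absurd h (child_ne_root s k)
      · have h1 : child s k = child s' k' := h
        have h2 : s = s' := toNode_injective (by rw [← parent_child s k, h1, parent_child])
        subst h2
        rw [child_injective s h1]
    · intro t
      by_cases ht : t = root
      · exact ⟨none, ht.symm⟩
      · obtain ⟨h, k, hk⟩ := exists_child ht
        exact ⟨some (⟨_, h⟩, k), hk⟩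
  rw [← hφ.sum_comp, Fintype.sum_option, Fintype.sum_prod_type]
  rfl

theorem pathInd_root (z : TreePath K D) : pathInd root z = 1 :=
  if_pos (List.nil_prefix)

theorem sum_pathInd (z : TreePath K D) (G : Node K D → ℝ) :
    ∑ s, pathInd s z * G s = G root + ∑ j, G (child (pathNode z j) (z j)) := by
  rw [sum_node, pathInd_root, one_mul, sum_pathInd_child z fun s k => G (child s k)]

/-- Splitting off the first step k leaves a path of length m for the transition family l ↦ f (k ::
l), whose total is one by induction. -/
theorem sum_prod_path (m : ℕ) (f : List (Fin K) → Fin K → ℝ)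
    (hf : ∀ l, l.length < m → ∑ k, f l k = 1) :
    ∑ z : Fin m → Fin K, ∏ j : Fin m, f ((List.ofFn z).take j) (z j) = 1 := by
  induction m generalizing f with
  | zero => simp
  | succ m ih =>
    rw [← (Fin.consEquiv fun _ => Fin K).sum_comp, Fintype.sum_prod_type, ← hf [] (by simp)]
    refine Finset.sum_congr rfl fun k _ => ?_
    have h := ih (fun l => f (k :: l)) fun l hl => hf _ (by simpa using hl)
    rw [← mul_one (f [] k), ← h, Finset.mul_sum]
    refine Finset.sum_congr rfl fun z _ => ?_
    rw [Fin.prod_univ_succ]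
    simp [Fin.consEquiv, List.ofFn_succ]

theorem logPath_eq (π : Inner K D → Fin K → ℝ) (z : TreePath K D) :
    logPath π z = ∑ j, Real.log (π (pathNode z j) (z j)) :=
  sum_pathInd_child z fun s k => Real.log (π s k)

theorem sum_pathProb {π : Inner K D → Fin K → ℝ} (hπ : ∀ s k, 0 < π s k)
    (h1 : ∀ s, ∑ k, π s k = 1) : ∑ z, pathProb π z = 1 := by
  rw [← sum_prod_path D (fun l k => if h : l.length < D then π ⟨l, h⟩ k else 0)
    fun l hl => by simp only [hl, dite_true]; exact h1 _]
  refine Finset.sum_congr rfl fun z _ => ?_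
  rw [← exp_logPath hπ, logPath_eq, Real.exp_sum]
  refine Finset.prod_congr rfl fun j _ => ?_
  rw [Real.exp_log (hπ _ _)]
  have h : (List.take j (List.ofFn z)).length < D := (pathNode z j).2
  rw [dif_pos h]
  rfl

end Paths

/-! ### The recursion for ξ and the path distribution -/

section PiHat

theorem xi_eq (x : Fin n → Vec p) (q : MeanField K D p n) (i : Fin n) (s : Inner K D) (k : Fin K) :
    xi x q i s k = Real.exp (expLogPi q s k + logZeta x q i (child s k) +
      if h : s.1.length + 1 < D then
        Real.log (∑ k', xi x q i ⟨s.1 ++ [k], by simpa using h⟩ k') else 0) := by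
  rw [xi]
  split_ifs with h
  · rfl
  · rw [add_zero]

theorem xi_pos (x : Fin n → Vec p) (q : MeanField K D p n) (i : Fin n) (s : Inner K D)
    (k : Fin K) : 0 < xi x q i s k := by
  rw [xi_eq]; exact Real.exp_pos _

variable [NeZero K]

theorem sum_xi_pos (x : Fin n → Vec p) (q : MeanField K D p n) (i : Fin n) (s : Inner K D) :
    0 < ∑ k, xi x q i s k := Finset.sum_pos (fun k _ => xi_pos x q i s k) Finset.univ_nonempty

theorem piHat_pos (x : Fin n → Vec p) (q : MeanField K D p n) (i : Fin n) (s : Inner K D)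
    (k : Fin K) : 0 < piHat x q i s k := div_pos (xi_pos x q i s k) (sum_xi_pos x q i s)

theorem sum_piHat (x : Fin n → Vec p) (q : MeanField K D p n) (i : Fin n) (s : Inner K D) :
    ∑ k, piHat x q i s k = 1 := by
  simp only [piHat, ← Finset.sum_div]
  exact div_self (sum_xi_pos x q i s).ne'

/-- The expectation of the logarithm of the joint density as a function of `z_i`, up to an additive
constant. -/
def pathScore (x : Fin n → Vec p) (q : MeanField K D p n) (i : Fin n) (z : TreePath K D) : ℝ :=
  ∑ s, ∑ k, pathInd (child s k) z * expLogPi q s k + ∑ s, pathInd s z * logZeta x q i s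

/-- The logarithm of π̂ is log ξ minus the log normalizer at the current node, and log ξ contains
the log normalizer at the next node. Along a path the normalizers telescope to that of the root,
which does not depend on z. -/
theorem exists_logPath_piHat (x : Fin n → Vec p) (q : MeanField K D p n) (i : Fin n) :
    ∃ c, ∀ z, logPath (piHat x q i) z = pathScore x q i z - c := by
  let Y : TreePath K D → ℕ → ℝ := fun z j =>
    if h : j < D then Real.log (∑ k, xi x q i (pathNode z ⟨j, h⟩) k) else 0
  -- The root lies on every path but is nobody's child, so its ζ enters no ξ and goes into the
  -- constant; at depth D the normalizer Y is 0.
  refine ⟨logZeta x q i root + Y (fun _ => 0) 0, fun z => ?_⟩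
  have hY0 : Y z 0 = Y (fun _ => 0) 0 := by
    simp only [Y]
    split_ifs with h
    · congr 3
    · rfl
  have hstep (j : Fin D) : Real.log (piHat x q i (pathNode z j) (z j)) =
      expLogPi q (pathNode z j) (z j) + logZeta x q i (child (pathNode z j) (z j)) +
        (Y z (j + 1) - Y z j) := by
    rw [piHat, Real.log_div (xi_pos x q i _ _).ne' (sum_xi_pos x q i _).ne', xi_eq, Real.log_exp]
    have e1 : Y z j = Real.log (∑ k, xi x q i (pathNode z j) k) := by simp [Y]
    have e2 : Y z (j + 1) = if h : (pathNode z j).1.length + 1 < D then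
        Real.log (∑ k', xi x q i ⟨(pathNode z j).1 ++ [z j], by simpa using h⟩ k') else 0 := by
      simp only [Y, length_pathNode]
      split_ifs with h
      · congr 3
        ext k
        congr 1
        exact Subtype.ext (pathNode_append z j).symm
      · rfl
    rw [e1, e2]
    ring
  have htel : ∑ j : Fin D, (Y z (j + 1) - Y z j) = -Y (fun _ => 0) 0 := by
    rw [← Finset.sum_range fun j => Y z (j + 1) - Y z j, Finset.sum_range_sub, hY0]
    simp [Y]
  rw [logPath_eq, pathScore, sum_pathInd, sum_pathInd_child]
  simp only [hstep, Finset.sum_add_distrib, htel]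
  ring

end PiHat

/-! ### The update of q(z_i) -/

section UpdateZ

theorem measurePreserving_T_gaussianPart (q : MeanField K D p n) (i : Fin n) :
    MeasurePreserving (fun ω : Latent K D p n => (ω.2.1 i, ω.2.2.2.2)) q.toMeasure
      ((q.T i : Measure (Subtree K D)).prod q.gaussianPart) :=
  measurePreserving_snd.comp (measurePreserving_data q i)

theorem logJoint_update_path_sub (M : Hyper K D p) (x : Fin n → Vec p) (ω : Latent K D p n)
    (i : Fin n) (z z' : TreePath K D) :
    logJoint M x (Function.update ω.1 i z, ω.2) - logJoint M x (Function.update ω.1 i z', ω.2) =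
      (logPath ω.2.2.1 z + logData z (ω.2.1 i) ω.2.2.2.2.1 ω.2.2.2.2.2.1 (x i)) -
      (logPath ω.2.2.1 z' + logData z' (ω.2.1 i) ω.2.2.2.2.1 ω.2.2.2.2.2.1 (x i)) := by
  have key (f : Fin n → TreePath K D → ℝ) : ∑ i', f i' (Function.update ω.1 i z i') -
      ∑ i', f i' (Function.update ω.1 i z' i') = f i z - f i z' := by
    rw [← Finset.sum_sub_distrib, Finset.sum_eq_single i]
    · simp
    · intro j _ hj
      simp [Function.update_of_ne hj]
    · simp
  have k1 := key fun _ z => logPath ω.2.2.1 z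
  have k2 := key fun i z => logData z (ω.2.1 i) ω.2.2.2.2.1 ω.2.2.2.2.2.1 (x i)
  simp only [logJoint]
  linarith

theorem eq_withDensity_count_iff {X : Type*} [Countable X] [MeasurableSpace X]
    [MeasurableSingletonClass X] (r : ProbabilityMeasure X) {f : X → ℝ} (hf : ∀ z, 0 ≤ f z) :
    (r : Measure X) = Measure.count.withDensity (fun z => ENNReal.ofReal (f z)) ↔
      ∀ z, (r : Measure X).real {z} = f z := by
  rw [Measure.ext_iff_singleton]
  refine forall_congr' fun z => ?_
  rw [withDensity_apply _ (measurableSet_singleton z), lintegral_singleton, Measure.count_singleton,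
    mul_one, measureReal_def]
  constructor
  · intro h
    rw [h, ENNReal.toReal_ofReal (hf z)]
  · intro h
    rw [← h, ENNReal.ofReal_toReal (measure_ne_top _ _)]

variable [NeZero K] {M : Hyper K D p} {x : Fin n → Vec p} {q : MeanField K D p n}

/-- If s is q-almost never a leaf of T_i, the product vanishes almost surely and nothing need be
known about the Gaussian term; otherwise independence of T_i gives the product of expectations. -/
theorem hasExp_leaf_logGauss (hq : KL M x q ≠ ∞) (i : Fin n) (s : Node K D)
    (h : probLeaf q i s ≠ 0 →
      Integrable (fun w : Vec p × Mat p => Real.log (gaussianDensity w.1 w.2 (x i)))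
        ((q.μ s : Measure (Vec p)).prod (q.Λ s : Measure (Mat p)))) :
    HasExp q.toMeasure
      (fun ω => leafInd s (ω.2.1 i) * logGauss (ω.2.2.2.2.1 s) (ω.2.2.2.2.2.1 s) (x i))
      (logZeta x q i s) := by
  by_cases h0 : probLeaf q i s = 0
  · have h1 : ∀ᵐ T ∂(q.T i : Measure (Subtree K D)), ¬ T.IsLeaf s := by
      rw [probLeaf, measureReal_eq_zero_iff] at h0
      exact measure_eq_zero_iff_ae_notMem.1 h0
    rw [logZeta, h0, zero_mul]
    refine (HasExp.const (0 : ℝ)).congr_ae ?_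
    filter_upwards [(measurePreserving_T q i).quasiMeasurePreserving.ae h1] with ω hω
    rw [leafInd, if_neg hω, zero_mul]
  · have h1 : HasExp ((q.μ s : Measure (Vec p)).prod (q.Λ s : Measure (Mat p)))
        (fun w => logGauss w.1 w.2 (x i))
        (∫ w, Real.log (gaussianDensity w.1 w.2 (x i))
          ∂((q.μ s : Measure (Vec p)).prod (q.Λ s : Measure (Mat p)))) := by
      refine (hasExp_of_integrable (h h0)).congr_ae ?_
      filter_upwards [Measure.quasiMeasurePreserving_snd.ae (p := fun A : Mat p => A.PosDef)
        (ae_posDef_lambda hq s)] with w hw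
      exact log_gaussianDensity hw _ _
    exact ((hasExp_leafInd_factor q i s).mul_prod
      (h1.comp (measurePreserving_gaussianPart_mu_lambda q s))).comp
        (measurePreserving_T_gaussianPart q i)

theorem hasExp_score (hq : KL M x q ≠ ∞) (i : Fin n)
    (h1 : ∀ s k, Integrable (fun v => Real.log (v k)) (q.π s : Measure (Fin K → ℝ)))
    (h2 : ∀ s, probLeaf q i s ≠ 0 →
      Integrable (fun w : Vec p × Mat p => Real.log (gaussianDensity w.1 w.2 (x i)))
        ((q.μ s : Measure (Vec p)).prod (q.Λ s : Measure (Mat p)))) (z : TreePath K D) :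
    HasExp q.toMeasure (fun ω => logPath ω.2.2.1 z +
      logData z (ω.2.1 i) ω.2.2.2.2.1 ω.2.2.2.2.2.1 (x i)) (pathScore x q i z) := by
  refine HasExp.add ?_ ?_
  · exact HasExp.sum fun s => HasExp.sum fun k =>
      ((hasExp_of_integrable (h1 s k)).comp (measurePreserving_pi q s)).const_mul _
  · exact HasExp.sum fun s => ((hasExp_leaf_logGauss hq i s (h2 s)).const_mul
      (pathInd s z)).of_eq (fun ω => by ring) rfl

theorem optimalZ_iff (hq : KL M x q ≠ ∞) (i : Fin n) (r : ProbabilityMeasure (TreePath K D))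
    (h1 : ∀ s k, Integrable (fun v => Real.log (v k)) (q.π s : Measure (Fin K → ℝ)))
    (h2 : ∀ s, probLeaf q i s ≠ 0 →
      Integrable (fun w : Vec p × Mat p => Real.log (gaussianDensity w.1 w.2 (x i)))
        ((q.μ s : Measure (Vec p)).prod (q.Λ s : Measure (Mat p)))) :
    OptimalZ M x q i r ↔
      ∀ z, (r : Measure (TreePath K D)).real {z} = pathProb (piHat x q i) z := by
  have hexp := exp_logPath (piHat_pos x q i)
  have hnonneg (z) : 0 ≤ pathProb (piHat x q i) z := by rw [← hexp]; positivity
  rw [← eq_withDensity_count_iff r hnonneg]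
  have hprob : IsProbabilityMeasure ((Measure.count : Measure (TreePath K D)).withDensity
      fun z => ENNReal.ofReal (pathProb (piHat x q i) z)) := by
    constructor
    rw [withDensity_apply _ .univ, Measure.restrict_univ, lintegral_count, tsum_fintype,
      ← ENNReal.ofReal_sum_of_nonneg fun z _ => hnonneg z,
      sum_pathProb (piHat_pos x q i) (sum_piHat x q i), ENNReal.ofReal_one]
  obtain ⟨c, hc⟩ := exists_logPath_piHat x q i
  obtain ⟨q₂, hF⟩ := splits_z (mz := fun i => (q.z i : Measure (TreePath K D)))
    (mT := fun i => (q.T i : Measure (Subtree K D)))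
    (mπ := fun s => (q.π s : Measure (Fin K → ℝ))) (mg := q.g)
    (mμ := fun s => (q.μ s : Measure (Vec p))) (mΛ := fun s => (q.Λ s : Measure (Mat p)))
    (mL := q.L) i
  obtain ⟨ρ₂, hG⟩ := splits_z
    (mz := fun _ : Fin n => (Measure.count : Measure (TreePath K D)))
    (mT := fun _ => Measure.count) (mπ := fun s => dirichletMeasure (M.α s))
    (mg := Measure.pi fun s => betaMeasure (M.a s) (M.b s)) (mμ := fun _ => volume)
    (mΛ := fun s => wishartMeasure (M.ν s) (M.W s)) (mL := wishartMeasure M.u M.V) i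
  have key := minimizes_iff_of_splits (M := M) (x := x) hF hG (ρ₁ := Measure.count)
    (by rw [Function.update_eq_self (f := fun _ : Fin n =>
      (Measure.count : Measure (TreePath K D)))]; rfl)
    (Q := q.toMeasure) (q.z i)
    (by rw [Function.update_eq_self (f := fun i => (q.z i : Measure (TreePath K D)))]; rfl) hq
    (upd := fun v ω => (Function.update ω.1 i v, ω.2))
    (fun v v' y => by
      obtain ⟨y, w⟩ := y
      simp [zSlot, update_piSlot]) (fun _ => 0)
    -- The reference is the path with all steps 0. The path distribution of π̂ is already
    -- normalized, so its logarithm can serve as Ψ.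
    (-logPath (piHat x q i) fun _ => 0) (Ψ := logPath (piHat x q i)) .of_discrete
    (by simp only [hexp]) hprob (.of_forall fun z => ?_) r
  · refine Iff.trans (Iff.of_eq ?_) key
    simp only [OptimalZ, KL, toMeasure_eq, coe_update]
  · refine ((hasExp_score hq i h1 h2 z).sub (hasExp_score hq i h1 h2 fun _ => 0)).of_eq
      (fun ω => (logJoint_update_path_sub M x ω i z _).symm) ?_
    rw [hc, hc]
    ring

end UpdateZ

/-! ### Integrability for the z-update at an optimum -/

section OptimalForm

variable [NeZero K] {M : Hyper K D p} {x : Fin n → Vec p} {q : MeanField K D p n}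

/-- Finite divergence already controls the quadratic part. Only log det needs a hypothesis, and an
optimal, hence Wishart, q(Λ_s) supplies it. -/
theorem integrable_log_gaussianDensity (hq : KL M x q ≠ ∞) (i : Fin n) (s : Node K D)
    (hΛ : Integrable (fun A : Mat p => Real.log A.det) (q.Λ s : Measure (Mat p))) :
    Integrable (fun w : Vec p × Mat p => Real.log (gaussianDensity w.1 w.2 (x i)))
      ((q.μ s : Measure (Vec p)).prod (q.Λ s : Measure (Mat p))) := by
  have hquad : Integrable (fun w : Vec p × Mat p => quadForm w.2 (w.1 - x i))
      ((q.μ s : Measure (Vec p)).prod (q.Λ s : Measure (Mat p))) := by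
    simp only [quadForm_eq_sum]
    refine integrable_finsetSum _ fun j _ => integrable_finsetSum _ fun k _ => ?_
    refine ((hasExp_mu_sub_mul hq s (x i) j k).1.mul_prod
      (integrable_lambda_entry hq s j k)).congr (.of_forall fun w => ?_)
    ring
  have hlog : Integrable (fun w : Vec p × Mat p => logGauss w.1 w.2 (x i))
      ((q.μ s : Measure (Vec p)).prod (q.Λ s : Measure (Mat p))) := by
    refine ((((hΛ.comp_snd _).const_mul (1 / 2)).sub
      (integrable_const (p / 2 * Real.log (2 * Real.pi)))).sub (hquad.const_mul (1 / 2))).congr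
        (.of_forall fun w => ?_)
    simp only [Pi.sub_apply, logGauss]
    rw [← quadForm_neg, neg_sub]
    rfl
  refine hlog.congr ?_
  filter_upwards [Measure.quasiMeasurePreserving_snd.ae (p := fun A : Mat p => A.PosDef)
    (ae_posDef_lambda hq s)] with w hw
  exact (log_gaussianDensity hw _ _).symm

end OptimalForm

end

end TreeMixture

/-! ### The theorem -/

open TreeMixture in
theorem proposition1 {K D p n : ℕ} [NeZero K] (M : Hyper K D p) (x : Fin n → Vec p)
    (q : MeanField K D p n) (hq : KL M x q ≠ ⊤) :
    -- the optimal update of each factor, for given other factors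
    (∀ s r, OptimalPi M x q s r ↔
      (r : Measure (Fin K → ℝ)) = dirichletMeasure (alphaHat M q s)) ∧
    (∀ s r, OptimalMu M x q s r ↔
      (r : Measure (Vec p)) =
        gaussianMeasure (meanHat M x q (fun t => vecMean (q.μ t)) s) (precHat q s)) ∧
    (∀ s r, OptimalLambda M x q s r ↔
      (r : Measure (Mat p)) =
        wishartMeasure (nuHat M q s) (WHatInv M x q (vecMean (q.μ s)) (vecCov (q.μ s)) s)⁻¹) ∧
    (∀ r, OptimalL M x q r ↔
      (r : Measure (Mat p)) =
        wishartMeasure (uHat M)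
          (VHatInv M (fun s => vecMean (q.μ s)) (fun s => vecCov (q.μ s)))⁻¹) ∧
    (∀ r, OptimalG M x q r ↔
      (r : Measure (Inner K D → ℝ)) =
        Measure.pi fun s => betaMeasure (aHat M q s) (bHat M q s)) ∧
    (∀ i r,
      (∀ s k, Integrable (fun v => Real.log (v k)) (q.π s : Measure (Fin K → ℝ))) →
      (∀ s, probLeaf q i s ≠ 0 →
        Integrable (fun w : Vec p × Mat p => Real.log (gaussianDensity w.1 w.2 (x i)))
          ((q.μ s : Measure (Vec p)).prod (q.Λ s : Measure (Mat p)))) →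
      (OptimalZ M x q i r ↔
        ∀ z, (r : Measure (TreePath K D)).real {z} = pathProb (piHat x q i) z)) ∧
    -- the form of all factors at an optimum
    (Optimal M x q →
      ∃ (α' : Inner K D → Fin K → ℝ) (m' : Node K D → Vec p) (L' : Node K D → Mat p)
        (ν' : Node K D → ℝ) (W' : Node K D → Mat p) (u' : ℝ) (V' : Mat p)
        (a' b' : Inner K D → ℝ) (π' : Fin n → Inner K D → Fin K → ℝ),
        -- admissible parameters
        (∀ s k, 0 < α' s k) ∧ (∀ s, (L' s).PosDef) ∧
        (∀ s, (p : ℝ) - 1 < ν' s) ∧ (∀ s, (W' s).PosDef) ∧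
        (p : ℝ) - 1 < u' ∧ V'.PosDef ∧ (∀ s, 0 < a' s) ∧ (∀ s, 0 < b' s) ∧
        (∀ i s k, 0 < π' i s k) ∧
        -- representation of the factors
        (∀ s, (q.π s : Measure (Fin K → ℝ)) = dirichletMeasure (α' s)) ∧
        (∀ s, (q.μ s : Measure (Vec p)) = gaussianMeasure (m' s) (L' s)) ∧
        (∀ s, (q.Λ s : Measure (Mat p)) = wishartMeasure (ν' s) (W' s)) ∧
        (q.L : Measure (Mat p)) = wishartMeasure u' V' ∧
        (q.g : Measure (Inner K D → ℝ)) = Measure.pi (fun s => betaMeasure (a' s) (b' s)) ∧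
        (∀ i z, (q.z i : Measure (TreePath K D)).real {z} = pathProb (π' i) z) ∧
        -- formulas for the parameters
        (∀ s k, α' s k = alphaHat M q s k) ∧
        (∀ s, L' s = precHat q s) ∧
        (∀ s, m' s = meanHat M x q m' s) ∧
        (∀ s, ν' s = nuHat M q s) ∧
        (∀ s, (W' s)⁻¹ = WHatInv M x q (m' s) (L' s)⁻¹ s) ∧
        u' = uHat M ∧
        V'⁻¹ = VHatInv M m' (fun s => (L' s)⁻¹) ∧
        (∀ s, a' s = aHat M q s) ∧
        (∀ s, b' s = bHat M q s) ∧
        (∀ i s k, π' i s k = piHat x q i s k)) := by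
  refine ⟨fun s r => optimalPi_iff hq s r, fun s r => optimalMu_iff hq s r,
    fun s r => optimalLambda_iff hq s r, fun r => optimalL_iff hq r, fun r => optimalG_iff hq r,
    fun i r h1 h2 => optimalZ_iff hq i r h1 h2, fun h => ?_⟩
  have hπ (s) := (optimalPi_iff hq s _).1 (h.pi s)
  have hμ (s) := (optimalMu_iff hq s _).1 (h.mu s)
  have hΛ (s) := (optimalLambda_iff hq s _).1 (h.lambda s)
  have hL := (optimalL_iff hq _).1 h.L
  have hg := (optimalG_iff hq _).1 h.g
  -- The updates are stated in the actual moments of q. Since the mean and covariance of the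
  -- Gaussian q(μ_s) are its own parameters, they become coupled equations among the parameters.
  have hmean (s) : vecMean (q.μ s) = meanHat M x q (fun t => vecMean (q.μ t)) s := by
    conv_lhs => rw [hμ s, vecMean_gaussian _ (posDef_precHat hq s)]
  have hcov (s) : vecCov (q.μ s) = (precHat q s)⁻¹ := by
    rw [hμ s, vecCov_gaussian _ (posDef_precHat hq s)]
  have hinv {A : Mat p} (hA : A.PosDef) : A⁻¹⁻¹ = A :=
    Matrix.nonsing_inv_nonsing_inv A (isUnit_iff_ne_zero.2 hA.det_pos.ne')
  have hW (s) := posDef_WHatInv hq s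
  have hV := posDef_VHatInv hq
  -- The two integrability hypotheses of the z-update now follow from the Wishart and Dirichlet
  -- forms.
  have hlogdet (s : Node K D) :
      Integrable (fun A : Mat p => Real.log A.det) (q.Λ s : Measure (Mat p)) := by
    rw [hΛ s]
    exact integrable_logDet_wishart (nuHat_gt M q s) (hW s).inv
  have hlogπ (s : Inner K D) (k : Fin K) :
      Integrable (fun v => Real.log (v k)) (q.π s : Measure (Fin K → ℝ)) := by
    rw [hπ s]
    exact integrable_log_dirichlet (alphaHat_pos M q s) k
  have hz (i) := (optimalZ_iff hq i _ hlogπ fun s _ =>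
    integrable_log_gaussianDensity hq i s (hlogdet s)).1 (h.z i)
  refine ⟨alphaHat M q, fun s => vecMean (q.μ s), precHat q, nuHat M q,
    fun s => (WHatInv M x q (vecMean (q.μ s)) (vecCov (q.μ s)) s)⁻¹, uHat M,
    (VHatInv M (fun s => vecMean (q.μ s)) (fun s => vecCov (q.μ s)))⁻¹, aHat M q, bHat M q,
    piHat x q, alphaHat_pos M q, posDef_precHat hq, nuHat_gt M q, fun s => (hW s).inv, uHat_gt M,
    hV.inv, aHat_pos M q, bHat_pos M q, piHat_pos x q, hπ, fun s => ?_, hΛ, hL, hg, hz,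
    fun _ _ => rfl, fun _ => rfl, hmean, fun _ => rfl, fun s => ?_, rfl, ?_, fun _ => rfl,
    fun _ => rfl, fun _ _ _ => rfl⟩
  · exact (hμ s).trans (by rw [← hmean s])
  · rw [hinv (hW s), hcov s]
  · rw [hinv hV, funext hcov]
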